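/- Let $d\ge 1$ be an integer, $\varsigma=(\varsigma_1,\dots,\varsigma_{d+1})\in\{+,-\}^{d+1}$ and $x>0$. Write $e(z)=e^{2\pi i z}$, $\mathbb R_+=(0,\infty)$, $\boldsymbol e_l$ for the $l$-th unit vector and $\boldsymbol e^d=(1,\dots,1)\in\mathbb Z^d$. **The Bessel function.** For $n=d+1$ and $\lambda\in\mathbb C^{n}$ put $G(s;\varsigma,\lambda)=\prod_{l=1}^{n}\Gamma(s-\lambda_l)\,e\big(\varsigma_l (s-\lambda_l)/4\big)$ and $$J(x;\varsigma,\lambda)=\frac1{2\pi i}\int_{\mathcal C_\lambda}G(s;\varsigma,\lambda)\,x^{-ns}\,ds .$$ Here $\mathcal C_\lambda$ is an upward directed contour $s=r(t)+it$, $t\in\mathbb R$, with $r$ continuously differentiable, such that $r(t)$ is equal to a constant $\sigma<\frac12+\frac1n\big(\mathrm{Re}\sum_l\lambda_l-1\big)$ for all large $|t|$ and all the points $\lambda_l-\kappa$ ($1\le l\le n$, $\kappa=0,1,2,\dots$) lie strictly to the left of the contour. **The rigorous interpretation of the formal integral.** Let $\theta(t;\varsigma)=\varsigma_{d+1}t_1\cdots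 t_d+\sum_{l=1}^d\varsigma_l t_l^{-1}$, and let $\mathcal T(\mathbb R_+)$ be the space of $h\in C^\infty(\mathbb R_+)$ with $t^\alpha h^{(\alpha)}(t)$ bounded for all $\alpha\in\mathbb N$. For $\nu\in\mathbb C^d$ and $h(t)=\prod_l h_l(t_l)$ with $h_l\in\mathcal T(\mathbb R_+)$, consider the (a priori formal) integral $$J_\nu(x;\varsigma;h)=\int_{\mathbb R_+^d}h(t)\prod_{l=1}^d t_l^{\nu_l-1}\,e^{ix\theta(t;\varsigma)}\,dt .$$ On formal linear combinations of such integrals (of indices in $\nu+\mathbb Z^d$) over $\mathbb C[x^{-1}]$ define the $\mathbb C[x^{-1}]$-linear operators $$\mathcal P_{+,l}(J_\nu(x;\varsigma;h))=\varsigma_l\varsigma_{d+1}J_{\nu+\boldsymbol e^d+\boldsymbol e_l}(x;\varsigma;h)-\varsigma_l i(\nu_l+1)x^{-1}J_{\nu+\boldsymbol e_l}(x;\varsigma;h)-\varsigma_l i x^{-1}J_{\nu+\boldsymbol e_l}(x;\varsigma;t_l\partial_l h),$$ $$\mathcal P_{-,l}(J_\nu(x;\varsigma;h))=\varsigma_l\varsigma_{d+1}J_{\nu-\boldsymbol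 e^d-\boldsymbol e_l}(x;\varsigma;h)+\varsigma_{d+1} i(\nu_l-1)x^{-1}J_{\nu-\boldsymbol e^d}(x;\varsigma;h)+\varsigma_{d+1} i x^{-1}J_{\nu-\boldsymbol e^d}(x;\varsigma;t_l\partial_l h).$$ Let $I$ be a finite set containing two distinct elements $+$ and $-$, and let $(h_\varrho)_{\varrho\in I}$ be a partition of unity on $\mathbb R_+$ by nonnegative functions in $\mathcal T(\mathbb R_+)$ with $h_-=1$ near $0$ and $h_+=1$ near $\infty$. For $\varrho\in I^d$ put $h_\varrho(t)=\prod_l h_{\varrho_l}(t_l)$ and $L_\pm=\{l:\varrho_l=\pm\}$, and choose $l_+\in L_+$ whenever $L_+\neq\emptyset$. Let $a>0$, let $A\ge a+2$ be an integer, and suppose $|\mathrm{Re}\,\nu_l|<a$ for all $l$. Let $\mathcal P_+=\prod_{l\in L_-}\mathcal P_{+,l}$ (these operators commute). Define $\mathbf J_\nu(x;\varsigma;\varrho)$ to be * if $L_+,L_-\ne\emptyset$: the combination obtained by first forming $\mathcal P_+^{2A}(J_\nu(x;\varsigma;h_\varrho))$ and then applying $\mathcal P_{-,l_+}^{A+m}$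 to each resulting integral, where $m$ is the number of times $\boldsymbol e^d$ has been added to its index (that is, its index is $\nu+m\boldsymbol e^d+2A\sum_{l\in L_-}\boldsymbol e_l$); * if $L_-\ne\emptyset=L_+$: $\mathcal P_+^{A}(J_\nu(x;\varsigma;h_\varrho))$; * if $L_+\ne\emptyset=L_-$: $\mathcal P_{-,l_+}^{A}(J_\nu(x;\varsigma;h_\varrho))$; * if $L_+=L_-=\emptyset$: $J_\nu(x;\varsigma;h_\varrho)$. The rigorous interpretation of the formal integral $\int_{\mathbb R_+^d}\prod_l t_l^{\nu_l-1}e^{ix\theta(t;\varsigma)}dt$ is $\mathbf J_\nu(x;\varsigma)=\sum_{\varrho\in I^d}\mathbf J_\nu(x;\varsigma;\varrho)$. **Proposition.** Let $\lambda\in\mathbb C^{d+1}$ satisfy $\sum_{l=1}^{d+1}\lambda_l=0$ and put $\nu_l=\lambda_l-\lambda_{d+1}$ for $l=1,\dots,d$. Then, for every admissible contour, every partition of unity, all $a$ and $A$ as above with $|\mathrm{Re}\,\nu_l|<a$ for all $l$, and every choice of the $l_+$: the integral defining $J(x;\varsigma,\lambda)$ and all the integrals occurring in $\mathbf J_\nu(x;\varsigma)$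 converge absolutely, and $$J(x;\varsigma,\lambda)=\mathbf J_\nu(x;\varsigma).$$ Moreover, $\nu\mapsto\mathbf J_\nu(x;\varsigma)$ is analytic on $\{\nu\in\mathbb C^d:|\mathrm{Re}\,\nu_l|<a \text{ for all } l\}$ for all such choices, and $J(x;\varsigma,\lambda)$, as a function of $\nu$ (with $\lambda$ the point of the hyperplane determined by $\nu$), is analytic on all of $\mathbb C^d$. -/

import Mathlib

open Polynomial

noncomputable section

namespace BesselIntegral

/-! ### Signs, gamma factors and the Mellin-Barnes Bessel function -/

/-- A sign, i.e. an element of `{+, -}`, viewed as the complex number `1` or `-1`. -/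
def sgn (u : ℤˣ) : ℂ := ((u : ℤ) : ℂ)

/-- The gamma factor `G(s, ±) = Γ(s) e(± s / 4)`, where `e(z) = exp(2 π i z)`. -/
def gammaSign (u : ℤˣ) (s : ℂ) : ℂ :=
  Complex.Gamma s * Complex.exp (2 * Real.pi * Complex.I * (sgn u * s / 4))

/-- `G(s; ς, λ) = ∏_l G(s - λ_l, ς_l)`. -/
def gammaFactor {n : ℕ} (sig : Fin n → ℤˣ) (lam : Fin n → ℂ) (s : ℂ) : ℂ :=
  ∏ l, gammaSign (sig l) (s - lam l)

/-- The upward directed curve `t ↦ r(t) + i t` (`t ∈ ℝ`) is an admissible contour for `λ ∈ ℂⁿ`: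
it is continuously differentiable, it agrees with a vertical line `Re s = σ`,
`σ < 1/2 + (Re (λ_1 + ⋯ + λ_n) - 1) / n`, when `|Im s|` is large, and all the points
`λ_l - κ` with `κ ∈ ℕ` lie strictly to its left. -/
structure IsContour {n : ℕ} (lam : Fin n → ℂ) (r : ℝ → ℝ) : Prop where
  contDiff : ContDiff ℝ 1 r
  vertical : ∃ σ : ℝ, σ < 1 / 2 + ((∑ l, lam l).re - 1) / n ∧
    ∃ T : ℝ, ∀ t : ℝ, T ≤ |t| → r t = σ
  left : ∀ (l : Fin n) (κ : ℕ), (lam l - κ).re < r (lam l - κ).im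

/-- The integrand `G(s; ς, λ) x^{-n s} ds`, pulled back along `s = r(t) + i t`. -/
def mellinBarnesIntegrand {n : ℕ} (sig : Fin n → ℤˣ) (lam : Fin n → ℂ) (r : ℝ → ℝ) (x : ℝ)
    (t : ℝ) : ℂ :=
  gammaFactor sig lam (r t + t * Complex.I) *
    (x : ℂ) ^ (-(n : ℂ) * (r t + t * Complex.I)) * (deriv r t + Complex.I)

/-- The Bessel function `J(x; ς, λ) = (2 π i)⁻¹ ∫_C G(s; ς, λ) x^{-n s} ds`, where `C` is the
contour `t ↦ r(t) + i t`. -/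
def besselJ {n : ℕ} (sig : Fin n → ℤˣ) (lam : Fin n → ℂ) (r : ℝ → ℝ) (x : ℝ) : ℂ :=
  (2 * Real.pi * Complex.I)⁻¹ * ∫ t : ℝ, mellinBarnesIntegrand sig lam r x t

/-! ### `J`-integrals and their formal combinations -/

/-- The phase `θ(t; ς) = ς_{d+1} t_1 ⋯ t_d + ∑_l ς_l t_l⁻¹`. -/
def phase {d : ℕ} (sig : Fin (d + 1) → ℤˣ) (t : Fin d → ℝ) : ℂ :=
  sgn (sig (Fin.last d)) * ∏ l, (t l : ℂ) + ∑ l : Fin d, sgn (sig l.castSucc) * (t l : ℂ)⁻¹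

/-- The positive orthant `ℝ_+^d`. -/
def orthant (d : ℕ) : Set (Fin d → ℝ) := {t | ∀ l, 0 < t l}

/-- A symbol `(k, h)` with `k ∈ ℤ^d` and `h = (h_1, …, h_d)`: once `ν` is fixed, it stands for the
`J`-integral of index `ν + k` with amplitude `h(t) = ∏_l h_l(t_l)`. -/
abbrev JSymbol (d : ℕ) : Type := (Fin d → ℤ) × (Fin d → ℝ → ℂ)

/-- Formal linear combinations of `J`-integrals with coefficients in `ℂ[x⁻¹]`; the polynomial
variable `X` stands for `x⁻¹`. -/
abbrev JForm (d : ℕ) : Type := JSymbol d →₀ ℂ[X]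

/-- The integrand `h(t) p_{ν + k}(t) e^{i x θ(t; ς)}` of a `J`-integral, where
`p_ν(t) = ∏_l t_l^{ν_l - 1}`. -/
def jIntegrand {d : ℕ} (ν : Fin d → ℂ) (sig : Fin (d + 1) → ℤˣ) (x : ℝ) (s : JSymbol d)
    (t : Fin d → ℝ) : ℂ :=
  (∏ l, s.2 l (t l)) * (∏ l, (t l : ℂ) ^ (ν l + s.1 l - 1)) *
    Complex.exp (Complex.I * x * phase sig t)

/-- The `J`-integral `J_{ν + k}(x; ς; h)`. -/
def jIntegral {d : ℕ} (ν : Fin d → ℂ) (sig : Fin (d + 1) → ℤˣ) (x : ℝ) (s : JSymbol d) : ℂ :=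
  ∫ t in orthant d, jIntegrand ν sig x s t

/-- All `J`-integrals that occur in a formal combination converge absolutely. -/
def JForm.Converges {d : ℕ} (ν : Fin d → ℂ) (sig : Fin (d + 1) → ℤˣ) (x : ℝ) (F : JForm d) :
    Prop :=
  ∀ s ∈ F.support, MeasureTheory.IntegrableOn (jIntegrand ν sig x s) (orthant d)

/-- The value at `x` of a formal combination of `J`-integrals. -/
def JForm.value {d : ℕ} (ν : Fin d → ℂ) (sig : Fin (d + 1) → ℤˣ) (x : ℝ) (F : JForm d) : ℂ :=
  F.sum fun s c => c.eval ((x : ℂ)⁻¹) * jIntegral ν sig x s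

/-! ### The two kinds of formal partial integration -/

/-- `t_l ∂_l` applied to `h(t) = ∏_k h_k(t_k)`: it replaces `h_l` by `t h_l'(t)`. -/
def euler {d : ℕ} (l : Fin d) (h : Fin d → ℝ → ℂ) : Fin d → ℝ → ℂ :=
  Function.update h l fun t => (t : ℂ) * deriv (h l) t

/-- The `ℂ[x⁻¹]`-linear operator `P_{+,l}` (formal partial integration of the first kind):
`J_ν(h) ↦ ς_l ς_{d+1} J_{ν+e^d+e_l}(h) - ς_l i (ν_l + 1) x⁻¹ J_{ν+e_l}(h)
  - ς_l i x⁻¹ J_{ν+e_l}(t_l ∂_l h)`. -/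
def partialPlus {d : ℕ} (ν : Fin d → ℂ) (sig : Fin (d + 1) → ℤˣ) (l : Fin d) :
    JForm d →ₗ[ℂ[X]] JForm d :=
  Finsupp.linearCombination ℂ[X] fun s : JSymbol d =>
    Finsupp.single (s.1 + 1 + Pi.single l 1, s.2)
        (C (sgn (sig l.castSucc) * sgn (sig (Fin.last d))))
      - Finsupp.single (s.1 + Pi.single l 1, s.2)
        (C (sgn (sig l.castSucc) * Complex.I * (ν l + s.1 l + 1)) * X)
      - Finsupp.single (s.1 + Pi.single l 1, euler l s.2)
        (C (sgn (sig l.castSucc) * Complex.I) * X)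

/-- The `ℂ[x⁻¹]`-linear operator `P_{-,l}` (formal partial integration of the second kind):
`J_ν(h) ↦ ς_l ς_{d+1} J_{ν-e^d-e_l}(h) + ς_{d+1} i (ν_l - 1) x⁻¹ J_{ν-e^d}(h)
  + ς_{d+1} i x⁻¹ J_{ν-e^d}(t_l ∂_l h)`. -/
def partialMinus {d : ℕ} (ν : Fin d → ℂ) (sig : Fin (d + 1) → ℤˣ) (l : Fin d) :
    JForm d →ₗ[ℂ[X]] JForm d :=
  Finsupp.linearCombination ℂ[X] fun s : JSymbol d =>
    Finsupp.single (s.1 - 1 - Pi.single l 1, s.2)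
        (C (sgn (sig l.castSucc) * sgn (sig (Fin.last d))))
      + Finsupp.single (s.1 - 1, s.2)
        (C (sgn (sig (Fin.last d)) * Complex.I * (ν l + s.1 l - 1)) * X)
      + Finsupp.single (s.1 - 1, euler l s.2)
        (C (sgn (sig (Fin.last d)) * Complex.I) * X)

theorem euler_comm {d : ℕ} {l k : Fin d} (hlk : l ≠ k) (h : Fin d → ℝ → ℂ) :
    euler l (euler k h) = euler k (euler l h) := by
  unfold euler
  rw [Function.update_comm hlk, Function.update_of_ne hlk, Function.update_of_ne hlk.symm]

theorem partialPlus_single {d : ℕ} (ν : Fin d → ℂ) (sig : Fin (d + 1) → ℤˣ) (l : Fin d)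
    (k : Fin d → ℤ) (h : Fin d → ℝ → ℂ) :
    partialPlus ν sig l (Finsupp.single (k, h) 1) =
      C (sgn (sig l.castSucc) * sgn (sig (Fin.last d))) •
          Finsupp.single (k + 1 + Pi.single l 1, h) 1
        - (C (sgn (sig l.castSucc) * Complex.I * (ν l + k l + 1)) * X) •
          Finsupp.single (k + Pi.single l 1, h) 1
        - (C (sgn (sig l.castSucc) * Complex.I) * X) •
          Finsupp.single (k + Pi.single l 1, euler l h) 1 := by
  simp only [partialPlus, Finsupp.linearCombination_single, one_smul, Finsupp.smul_single,
    smul_eq_mul, mul_one]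

/-- The operators of the first kind commute, so that products over a set of indices make sense. -/
theorem partialPlus_commute {d : ℕ} (ν : Fin d → ℂ) (sig : Fin (d + 1) → ℤˣ) (l k : Fin d) :
    Commute (partialPlus ν sig l) (partialPlus ν sig k) := by
  rcases eq_or_ne l k with rfl | hlk
  · exact Commute.refl _
  refine Finsupp.lhom_ext' fun s => LinearMap.ext_ring ?_
  obtain ⟨m, h⟩ := s
  have e1 : m + 1 + Pi.single k 1 + 1 + Pi.single l 1 =
      m + 1 + Pi.single l 1 + 1 + Pi.single k (1 : ℤ) := by abel
  have e2 : m + 1 + Pi.single k 1 + Pi.single l 1 =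
      m + 1 + Pi.single l 1 + Pi.single k (1 : ℤ) := by abel
  have e3 : m + Pi.single k 1 + 1 + Pi.single l 1 =
      m + 1 + Pi.single l 1 + Pi.single k (1 : ℤ) := by abel
  have e4 : m + Pi.single l 1 + 1 + Pi.single k 1 =
      m + 1 + Pi.single l 1 + Pi.single k (1 : ℤ) := by abel
  have e5 : m + Pi.single k 1 + Pi.single l 1 =
      m + Pi.single l 1 + Pi.single k (1 : ℤ) := by abel
  simp only [LinearMap.comp_apply, Module.End.mul_apply, Finsupp.lsingle_apply,
    partialPlus_single, map_sub, map_smul, e1, e2, e3, e4, e5, euler_comm hlk,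
    Pi.add_apply, Pi.one_apply, Pi.single_eq_of_ne hlk, Pi.single_eq_of_ne hlk.symm,
    Int.cast_add, Int.cast_one, add_zero, map_mul, map_add, map_one]
  module

/-! ### Partitions of unity and the rigorous interpretation of the formal integral -/

/-- The space `𝒯(ℝ_+)` of smooth functions on `ℝ_+` such that `t^α h^{(α)}(t)` is bounded for every
`α ∈ ℕ`. -/
def MemT (h : ℝ → ℂ) : Prop :=
  ContDiffOn ℝ (⊤ : ℕ∞) h (Set.Ioi 0) ∧
    ∀ α : ℕ, ∃ B : ℝ, ∀ t : ℝ, 0 < t → ‖(t : ℂ) ^ α * iteratedDeriv α h t‖ ≤ B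

/-- A finite partition of unity on `ℝ_+` by functions in `𝒯(ℝ_+)`, with two distinguished members
`h_-`, `h_+`, which are equal to `1` near zero and near infinity respectively. Only the values on
`ℝ_+` matter. -/
structure UnityPartition (I : Type*) [Fintype I] where
  plus : I
  minus : I
  plus_ne_minus : plus ≠ minus
  fn : I → ℝ → ℝ
  nonneg : ∀ ϱ t, 0 < t → 0 ≤ fn ϱ t
  memT : ∀ ϱ, MemT fun t => (fn ϱ t : ℂ)
  sum_eq_one : ∀ t, 0 < t → ∑ ϱ, fn ϱ t = 1
  minus_eq_one : ∃ δ : ℝ, 0 < δ ∧ ∀ t, 0 < t → t < δ → fn minus t = 1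
  plus_eq_one : ∃ M : ℝ, 0 < M ∧ ∀ t, M < t → fn plus t = 1

section

variable {I : Type*} [Fintype I] [DecidableEq I]

/-- `L_+(ϱ) = {l : ϱ_l = +}`. -/
def UnityPartition.Lplus (P : UnityPartition I) {d : ℕ} (ϱ : Fin d → I) : Finset (Fin d) :=
  Finset.univ.filter fun l => ϱ l = P.plus

/-- `L_-(ϱ) = {l : ϱ_l = -}`. -/
def UnityPartition.Lminus (P : UnityPartition I) {d : ℕ} (ϱ : Fin d → I) : Finset (Fin d) :=
  Finset.univ.filter fun l => ϱ l = P.minus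

/-- The formal `J`-integral `J_ν(x; ς; h_ϱ)`, with `h_ϱ(t) = ∏_l h_{ϱ_l}(t_l)`. -/
def UnityPartition.piece (P : UnityPartition I) {d : ℕ} (ϱ : Fin d → I) : JForm d :=
  Finsupp.single (0, fun l t => (P.fn (ϱ l) t : ℂ)) 1

/-- `P_{+,L} = ∏_{l ∈ L} P_{+,l}`. -/
def partialPlusProd {d : ℕ} (ν : Fin d → ℂ) (sig : Fin (d + 1) → ℤˣ) (L : Finset (Fin d)) :
    JForm d →ₗ[ℂ[X]] JForm d :=
  L.noncommProd (partialPlus ν sig) fun l _ k _ _ => partialPlus_commute ν sig l k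

/-- The linear operator that applies `P_{-,l}^{A + m}` to each `J`-integral of index `ν + k`, where
`m = k_l`. It is used on combinations obtained from an integral of index `ν` by operators
`P_{+,k}` with `k ≠ l`. For these, each use of the first term of some `P_{+,k}` raises the `l`-th
index by one and the other terms leave it unchanged, so `m` is the total number `∑ α_{1,k}` of times
that the vector `e^d` has been added to the index. -/
def partialMinusBalanced {d : ℕ} (ν : Fin d → ℂ) (sig : Fin (d + 1) → ℤˣ) (A : ℕ) (l : Fin d) :
    JForm d →ₗ[ℂ[X]] JForm d :=
  Finsupp.linearCombination ℂ[X] fun s : JSymbol d =>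
    (partialMinus ν sig l ^ (A + (s.1 l).toNat)) (Finsupp.single s 1)

/-- The formal combination of `J`-integrals that defines the rigorous interpretation of
`J_ν(x; ς; h_ϱ)`; `lp` is the chosen element of `L_+(ϱ)` (not used if `L_+(ϱ)` is empty). -/
def UnityPartition.rigorousForm (P : UnityPartition I) {d : ℕ} (ν : Fin d → ℂ)
    (sig : Fin (d + 1) → ℤˣ) (A : ℕ) (ϱ : Fin d → I) (lp : Fin d) : JForm d :=
  if (P.Lminus ϱ).Nonempty then
    if (P.Lplus ϱ).Nonempty then
      partialMinusBalanced ν sig A lp ((partialPlusProd ν sig (P.Lminus ϱ) ^ (2 * A)) (P.piece ϱ))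
    else (partialPlusProd ν sig (P.Lminus ϱ) ^ A) (P.piece ϱ)
  else
    if (P.Lplus ϱ).Nonempty then (partialMinus ν sig lp ^ A) (P.piece ϱ)
    else P.piece ϱ

/-- The rigorous interpretation of the formal integral `J_ν(x; ς)`: the sum over `ϱ ∈ I^d` of the
rigorous interpretations of `J_ν(x; ς; h_ϱ)`. -/
def UnityPartition.rigorousJ (P : UnityPartition I) {d : ℕ} (ν : Fin d → ℂ)
    (sig : Fin (d + 1) → ℤˣ) (A : ℕ) (lp : (Fin d → I) → Fin d) (x : ℝ) : ℂ :=
  ∑ ϱ : Fin d → I, (P.rigorousForm ν sig A ϱ (lp ϱ)).value ν sig x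

end

/-- The point `λ` of the hyperplane `λ_1 + ⋯ + λ_{d+1} = 0` with `λ_l - λ_{d+1} = ν_l` for
`l = 1, …, d`. -/
def hyperplanePoint {d : ℕ} (ν : Fin d → ℂ) : Fin (d + 1) → ℂ :=
  Fin.snoc (fun l => ν l - (∑ k, ν k) / (d + 1)) (-(∑ k, ν k) / (d + 1))

end BesselIntegral

end

/-!
The formal integral is regularised by rotating the coefficients `-i ς_l` of the phase to the numbers
`exp (-i ς_l (π / 2 - ε))` of positive real part `sin ε`. For `ε > 0` all the `J`-integrals then
converge absolutely (`integrableOn_dampedIntegrand`), and both sides of the identity are limits, as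
`ε → 0`, of the same damped integral with constant amplitude.

On the side of the Bessel function, Mellin inversion for the factor `exp (-x z t_1 ⋯ t_d)` and
Fubini's theorem turn the damped integral into a Mellin-Barnes integral over a vertical line far to
the right (`dampedIntegral_one_eq`). Its integrand decays exponentially, so the line may be moved
to the given contour (`IsContour.integral_dampedKernel_eq`). On the contour, the bound
`|Γ(σ + i t)| ≤ C |t| ^ (σ - 1/2) exp (-π |t| / 2)` provides an integrable majorant that does not
depend on `ε` (`exists_norm_Gamma_le`, `IsContour.integrable_contourMajorant`), and `ε → 0` gives
`J(x; ς, λ)`. This limit does not involve the contour.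

On the side of the rigorous interpretation, the damped integral is the sum over `ϱ` of the damped
integrals with amplitudes `h_ϱ`. For these the partial integrations are true identities
(`dampedIntegral_parts`), whose coefficients tend to those of the formal operators. Thus the damped
integral of `h_ϱ` is a deformation of the formal combination of `J`-integrals in the rigorous
interpretation (`UnityPartition.deforms_rigorousForm`). The numbers of partial integrations are such
that in all the resulting integrals the `l`-th index is `ν_l + k_l` with `k_l ≥ A` where `ϱ_l = -`
and `k_l ≤ -A` where `ϱ_l = +`; hence the undamped integrals converge absolutely and are the limits
of the damped ones (`tendsto_dampedIntegral`).

Analyticity is proved for the Bessel function: locally the contour may be held fixed, and the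
integrand is an analytic function of `λ` with values in a weighted space of bounded continuous
functions (`IsContour.analyticAt_besselJ`). It passes to the rigorous interpretation through the
identity.
-/

open Polynomial

noncomputable section

namespace BesselIntegral

open Filter Topology MeasureTheory

section

/-! ### A sharp upper bound for the gamma function on vertical strips -/

theorem convexOn_log_one_add_div_sq (t : ℝ) :
    ConvexOn ℝ (Set.Ioi 0) fun u : ℝ => Real.log (1 + t ^ 2 / u ^ 2) := by
  have hd : ∀ u ∈ Set.Ioi (0 : ℝ), HasDerivAt (fun u : ℝ => Real.log (1 + t ^ 2 / u ^ 2))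
      (-(2 * t ^ 2 / (u * (u ^ 2 + t ^ 2)))) u := by
    intro u hu
    have hu0 : (0 : ℝ) < u := hu
    have hpos : 0 < 1 + t ^ 2 / u ^ 2 := by positivity
    have h1 : HasDerivAt (fun u : ℝ => 1 + t ^ 2 / u ^ 2)
        ((0 * u ^ 2 - t ^ 2 * (2 * u)) / (u ^ 2) ^ 2) u := by
      have h2 : HasDerivAt (fun u : ℝ => u ^ 2) (2 * u) u := by simpa using hasDerivAt_pow 2 u
      exact ((hasDerivAt_const u (t ^ 2)).div h2 (by positivity)).const_add 1
    convert! h1.log hpos.ne' using 1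
    have : u ^ 2 + t ^ 2 ≠ 0 := by positivity
    field_simp
    ring
  refine MonotoneOn.convexOn_of_deriv (convex_Ioi 0)
    (fun u hu => (hd u hu).continuousAt.continuousWithinAt) ?_ ?_
  · rw [interior_Ioi]
    exact fun u hu => (hd u hu).differentiableAt.differentiableWithinAt
  · rw [interior_Ioi]
    intro u hu v hv huv
    rw [(hd u hu).deriv, (hd v hv).deriv]
    have hu0 : (0 : ℝ) < u := hu
    have hv0 : (0 : ℝ) < v := hv
    have : u * (u ^ 2 + t ^ 2) ≤ v * (v ^ 2 + t ^ 2) := by gcongr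
    exact neg_le_neg (by gcongr)

theorem log_div_norm_add_mul_I {u : ℝ} (hu : 0 < u) (t : ℝ) :
    Real.log (u / ‖(u : ℂ) + t * Complex.I‖) = -(1 / 2) * Real.log (1 + t ^ 2 / u ^ 2) := by
  have h1 : ‖(u : ℂ) + t * Complex.I‖ = √(u ^ 2 + t ^ 2) := Complex.norm_add_mul_I u t
  have h2 : 1 + t ^ 2 / u ^ 2 = (u ^ 2 + t ^ 2) / u ^ 2 := by field_simp
  rw [h1, Real.log_div hu.ne' (by positivity), Real.log_sqrt (by positivity), h2,
    Real.log_div (by positivity) (by positivity), Real.log_pow]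
  push_cast
  ring

/-- Since `1` lies between `1 / 2` and `σ`, convexity of `log (1 + t² / u²)` bounds the factor at
`σ` by extrapolation from `1 / 2` and `1`. -/
theorem div_norm_mul_rpow_le {σ j : ℝ} (hσ : 1 ≤ σ) (hj : 0 ≤ j) (t : ℝ) :
    (σ + j) / ‖((σ + j : ℝ) : ℂ) + t * Complex.I‖ *
        ((1 / 2 + j) / ‖((1 / 2 + j : ℝ) : ℂ) + t * Complex.I‖) ^ (2 * σ - 2) ≤
      ((1 + j) / ‖((1 + j : ℝ) : ℂ) + t * Complex.I‖) ^ (2 * σ - 1) := by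
  have hpos : ∀ u : ℝ, 0 < u → 0 < u / ‖(u : ℂ) + t * Complex.I‖ := by
    intro u hu
    rw [Complex.norm_add_mul_I]
    positivity
  have h0 := hpos (σ + j) (by linarith)
  have h1 := hpos (1 / 2 + j) (by linarith)
  have h2 := hpos (1 + j) (by linarith)
  rw [← Real.log_le_log_iff (mul_pos h0 (Real.rpow_pos_of_pos h1 _)) (Real.rpow_pos_of_pos h2 _),
    Real.log_mul h0.ne' (Real.rpow_pos_of_pos h1 _).ne', Real.log_rpow h1, Real.log_rpow h2,
    log_div_norm_add_mul_I (by linarith), log_div_norm_add_mul_I (by linarith),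
    log_div_norm_add_mul_I (by linarith)]
  have hp : 0 < 2 * σ - 1 := by linarith
  have hw : (0 : ℝ) ≤ (2 * σ - 2) / (2 * σ - 1) := div_nonneg (by linarith) hp.le
  have hw' : (0 : ℝ) ≤ 1 / (2 * σ - 1) := by positivity
  have hc := (convexOn_log_one_add_div_sq t).2
    (show 1 / 2 + j ∈ Set.Ioi (0 : ℝ) from Set.mem_Ioi.mpr (by linarith))
    (show σ + j ∈ Set.Ioi (0 : ℝ) from Set.mem_Ioi.mpr (by linarith)) hw hw' (by field_simp; ring)
  have he : (2 * σ - 2) / (2 * σ - 1) * (1 / 2 + j) + 1 / (2 * σ - 1) * (σ + j) = 1 + j := by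
    field_simp
    ring
  simp only [smul_eq_mul, he] at hc
  have hc' := mul_le_mul_of_nonneg_left hc hp.le
  have e2 : (2 * σ - 1) * ((2 * σ - 2) / (2 * σ - 1) * Real.log (1 + t ^ 2 / (1 / 2 + j) ^ 2) +
      1 / (2 * σ - 1) * Real.log (1 + t ^ 2 / (σ + j) ^ 2)) =
      (2 * σ - 2) * Real.log (1 + t ^ 2 / (1 / 2 + j) ^ 2) +
        Real.log (1 + t ^ 2 / (σ + j) ^ 2) := by
    field_simp
  rw [e2] at hc'
  linarith

/-- The factors `n^u n!` of Euler's product cancel in the quotient. -/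
theorem norm_GammaSeq_div {u : ℝ} (hu : 0 < u) (t : ℝ) {n : ℕ} (hn : n ≠ 0) :
    ‖Complex.GammaSeq (u + t * Complex.I) n‖ / ‖Complex.GammaSeq u n‖ =
      ∏ j ∈ Finset.range (n + 1), ((u + j) / ‖((u + j : ℝ) : ℂ) + t * Complex.I‖) := by
  have hn' : (0 : ℝ) < n := by positivity
  have hc : ((n : ℝ) : ℂ) = (n : ℂ) := by simp
  have h1 : ‖(n : ℂ) ^ ((u : ℂ) + t * Complex.I)‖ = (n : ℝ) ^ u := by
    rw [← hc, Complex.norm_cpow_eq_rpow_re_of_pos hn']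
    simp
  have h2 : ‖(n : ℂ) ^ (u : ℂ)‖ = (n : ℝ) ^ u := by
    rw [← hc, Complex.norm_cpow_eq_rpow_re_of_pos hn']
    simp
  have h3 : ∀ j : ℕ, ‖(u : ℂ) + j‖ = u + j := by
    intro j
    have : (u : ℂ) + j = ((u + j : ℝ) : ℂ) := by push_cast; ring
    rw [this, Complex.norm_real, Real.norm_of_nonneg (by positivity)]
  have h4 : ∀ j : ℕ, (u : ℂ) + t * Complex.I + j = ((u + j : ℝ) : ℂ) + t * Complex.I := by
    intro j
    push_cast
    ring
  simp only [Complex.GammaSeq, norm_div, norm_mul, h1, h2, norm_prod, h3, h4,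
    Finset.prod_div_distrib]
  have h5 : (n : ℝ) ^ u ≠ 0 := (Real.rpow_pos_of_pos hn' u).ne'
  have h6 : ‖(n.factorial : ℂ)‖ ≠ 0 := by simpa using Nat.factorial_ne_zero n
  have h7 : ∏ j ∈ Finset.range (n + 1), (u + (j : ℝ)) ≠ 0 :=
    Finset.prod_ne_zero_iff.mpr fun j _ => by positivity
  have h8 : ∏ j ∈ Finset.range (n + 1), ‖((u + j : ℝ) : ℂ) + t * Complex.I‖ ≠ 0 :=
    Finset.prod_ne_zero_iff.mpr fun j _ => by
      rw [Complex.norm_add_mul_I]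
      positivity
  field_simp

/-- The extrapolation inequality for `|Γ(u + i t)| / Γ(u)` at `u = 1 / 2, 1, σ`, a consequence of
the product formula. -/
theorem norm_Gamma_mul_rpow_le {σ : ℝ} (hσ : 1 ≤ σ) (t : ℝ) :
    ‖Complex.Gamma (σ + t * Complex.I)‖ / ‖Complex.Gamma σ‖ *
        (‖Complex.Gamma ((1 / 2 : ℝ) + t * Complex.I)‖ / ‖Complex.Gamma (1 / 2 : ℝ)‖) ^
          (2 * σ - 2) ≤
      (‖Complex.Gamma ((1 : ℝ) + t * Complex.I)‖ / ‖Complex.Gamma (1 : ℝ)‖) ^ (2 * σ - 1) := by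
  have hlim : ∀ u : ℝ, 0 < u → Tendsto (fun n : ℕ =>
      ‖Complex.GammaSeq (u + t * Complex.I) n‖ / ‖Complex.GammaSeq u n‖) atTop
      (𝓝 (‖Complex.Gamma (u + t * Complex.I)‖ / ‖Complex.Gamma u‖)) := by
    intro u hu
    refine (Complex.GammaSeq_tendsto_Gamma _).norm.div (Complex.GammaSeq_tendsto_Gamma _).norm ?_
    exact norm_ne_zero_iff.mpr (Complex.Gamma_ne_zero_of_re_pos (by simpa using hu))
  refine le_of_tendsto_of_tendsto
    ((hlim σ (by linarith)).mul ((hlim (1 / 2) (by norm_num)).rpow_const (Or.inr (by linarith))))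
    ((hlim 1 (by norm_num)).rpow_const (Or.inr (by linarith))) ?_
  filter_upwards [eventually_ne_atTop 0] with n hn
  have hnn : ∀ u : ℝ, 0 < u → ∀ j ∈ Finset.range (n + 1),
      0 ≤ (u + j) / ‖((u + j : ℝ) : ℂ) + t * Complex.I‖ := fun u hu j _ => by positivity
  rw [norm_GammaSeq_div (by linarith) t hn, norm_GammaSeq_div (by norm_num) t hn,
    norm_GammaSeq_div (by norm_num) t hn, ← Real.finsetProd_rpow _ _ (hnn _ (by norm_num)),
    ← Real.finsetProd_rpow _ _ (hnn _ (by norm_num)), ← Finset.prod_mul_distrib]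
  refine Finset.prod_le_prod (fun j hj => ?_) fun j _ => ?_
  · exact mul_nonneg (hnn _ (by linarith) j hj) (Real.rpow_nonneg (hnn _ (by norm_num) j hj) _)
  · exact div_norm_mul_rpow_le hσ (Nat.cast_nonneg j) t

theorem norm_Gamma_half_sq (t : ℝ) :
    ‖Complex.Gamma ((1 / 2 : ℝ) + t * Complex.I)‖ ^ 2 = Real.pi / Real.cosh (Real.pi * t) := by
  have h := Complex.Gamma_mul_Gamma_one_sub ((1 / 2 : ℝ) + t * Complex.I)
  have h1 : (1 : ℂ) - ((1 / 2 : ℝ) + t * Complex.I) =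
      (starRingEnd ℂ) ((1 / 2 : ℝ) + t * Complex.I) := by
    simp only [map_add, map_mul, Complex.conj_ofReal, Complex.conj_I]
    push_cast
    ring
  have h2 : (Real.pi : ℂ) * ((1 / 2 : ℝ) + t * Complex.I) =
      (Real.pi * t : ℝ) * Complex.I + Real.pi / 2 := by
    push_cast
    ring
  rw [h1, Complex.Gamma_conj, Complex.mul_conj, Complex.normSq_eq_norm_sq, h2,
    Complex.sin_add_pi_div_two, Complex.cos_mul_I, ← Complex.ofReal_cosh, ← Complex.ofReal_div] at h
  exact_mod_cast h

theorem norm_Gamma_one_sq {t : ℝ} (ht : t ≠ 0) :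
    ‖Complex.Gamma ((1 : ℝ) + t * Complex.I)‖ ^ 2 =
      Real.pi * t / Real.sinh (Real.pi * t) := by
  have hti : (t : ℂ) * Complex.I ≠ 0 := by simp [ht]
  have h := Complex.Gamma_mul_Gamma_one_sub (t * Complex.I)
  have h1 : (1 : ℂ) - t * Complex.I = (starRingEnd ℂ) ((1 : ℝ) + t * Complex.I) := by
    simp only [map_add, map_mul, Complex.conj_ofReal, Complex.conj_I]
    push_cast
    ring
  have h3 : Complex.Gamma ((1 : ℝ) + t * Complex.I) =
      t * Complex.I * Complex.Gamma (t * Complex.I) := by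
    rw [← Complex.Gamma_add_one _ hti]
    push_cast
    ring_nf
  have h4 : Complex.Gamma ((1 : ℝ) + t * Complex.I) *
      (starRingEnd ℂ) (Complex.Gamma ((1 : ℝ) + t * Complex.I)) =
      t * Complex.I * (Real.pi / Complex.sin (Real.pi * (t * Complex.I))) := by
    rw [← h, h1, Complex.Gamma_conj, h3]
    ring
  rw [Complex.mul_conj, Complex.normSq_eq_norm_sq] at h4
  have h2 : (Real.pi : ℂ) * (t * Complex.I) = (Real.pi * t : ℝ) * Complex.I := by
    push_cast
    ring
  rw [h2, Complex.sin_mul_I, ← Complex.ofReal_sinh] at h4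
  have hs : Real.sinh (Real.pi * t) ≠ 0 := by
    rw [Ne, Real.sinh_eq_zero]
    exact mul_ne_zero Real.pi_ne_zero ht
  have h5 : (t : ℂ) * Complex.I * (Real.pi / (Real.sinh (Real.pi * t) * Complex.I)) =
      ((Real.pi * t / Real.sinh (Real.pi * t) : ℝ) : ℂ) := by
    push_cast
    field_simp
  rw [h5] at h4
  exact_mod_cast h4

theorem norm_Gamma_half_ge (t : ℝ) :
    Real.exp (-(Real.pi * |t| / 2)) ≤
      ‖Complex.Gamma ((1 / 2 : ℝ) + t * Complex.I)‖ / ‖Complex.Gamma (1 / 2 : ℝ)‖ := by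
  have h0 : ‖Complex.Gamma (1 / 2 : ℝ)‖ ^ 2 = Real.pi := by
    have := norm_Gamma_half_sq 0
    simpa using this
  have hc : Real.cosh (Real.pi * t) ≤ Real.exp (Real.pi * |t|) := by
    rw [← Real.cosh_abs, abs_mul, abs_of_pos Real.pi_pos, Real.cosh_eq]
    have : Real.exp (-(Real.pi * |t|)) ≤ Real.exp (Real.pi * |t|) :=
      Real.exp_le_exp.mpr (by have := mul_nonneg Real.pi_pos.le (abs_nonneg t); linarith)
    linarith
  refine le_of_sq_le_sq ?_ (by positivity)
  rw [div_pow, norm_Gamma_half_sq, h0, ← Real.exp_nat_mul, div_right_comm,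
    div_self Real.pi_ne_zero, one_div]
  have : ((2 : ℕ) : ℝ) * -(Real.pi * |t| / 2) = -(Real.pi * |t|) := by push_cast; ring
  rw [this, Real.exp_neg]
  exact inv_anti₀ (Real.cosh_pos _) hc

theorem norm_Gamma_one_le {t : ℝ} (ht : 1 ≤ |t|) :
    ‖Complex.Gamma ((1 : ℝ) + t * Complex.I)‖ / ‖Complex.Gamma (1 : ℝ)‖ ≤
      √(4 * Real.pi) * |t| ^ (1 / 2 : ℝ) * Real.exp (-(Real.pi * |t| / 2)) := by
  have ht0 : t ≠ 0 := by rintro rfl; simp at ht; linarith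
  have h1 : Real.pi * t / Real.sinh (Real.pi * t) =
      Real.pi * |t| / Real.sinh (Real.pi * |t|) := by
    rcases abs_choice t with h | h <;> rw [h]
    rw [mul_neg, Real.sinh_neg, neg_div_neg_eq]
  have hy : 1 ≤ Real.pi * |t| := by nlinarith [Real.pi_gt_three]
  have h2 : Real.exp (Real.pi * |t|) / 4 ≤ Real.sinh (Real.pi * |t|) := by
    rw [Real.sinh_eq]
    have h3 : 2 ≤ Real.exp (Real.pi * |t|) := by
      have := Real.add_one_le_exp (Real.pi * |t|)
      linarith
    have h4 : Real.exp (-(Real.pi * |t|)) ≤ 1 := Real.exp_le_one_iff.mpr (by linarith)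
    linarith
  refine le_of_sq_le_sq ?_ (by positivity)
  have h5 : ‖Complex.Gamma (1 : ℝ)‖ = 1 := by simp
  rw [h5, div_one, norm_Gamma_one_sq ht0, h1, mul_pow, mul_pow, Real.sq_sqrt (by positivity),
    ← Real.sqrt_eq_rpow, Real.sq_sqrt (by positivity), ← Real.exp_nat_mul]
  have : ((2 : ℕ) : ℝ) * -(Real.pi * |t| / 2) = -(Real.pi * |t|) := by push_cast; ring
  rw [this, Real.exp_neg]
  calc Real.pi * |t| / Real.sinh (Real.pi * |t|)
      ≤ Real.pi * |t| / (Real.exp (Real.pi * |t|) / 4) := by gcongr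
    _ = _ := by field_simp

theorem norm_Gamma_le_of_one_le {σ : ℝ} (hσ : 1 ≤ σ) {t : ℝ} (ht : 1 ≤ |t|) :
    ‖Complex.Gamma (σ + t * Complex.I)‖ ≤
      ‖Complex.Gamma σ‖ * √(4 * Real.pi) ^ (2 * σ - 1) *
        (|t| ^ (σ - 1 / 2) * Real.exp (-(Real.pi * |t| / 2))) := by
  have hG : 0 < ‖Complex.Gamma σ‖ :=
    norm_pos_iff.mpr (Complex.Gamma_ne_zero_of_re_pos (by simp; linarith))
  set E := Real.exp (-(Real.pi * |t| / 2)) with hE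
  have hE0 : 0 < E := Real.exp_pos _
  have htp : 0 < |t| := by linarith
  have key := norm_Gamma_mul_rpow_le hσ t
  have h1 : E ^ (2 * σ - 2) ≤ (‖Complex.Gamma ((1 / 2 : ℝ) + t * Complex.I)‖ /
      ‖Complex.Gamma (1 / 2 : ℝ)‖) ^ (2 * σ - 2) :=
    Real.rpow_le_rpow hE0.le (norm_Gamma_half_ge t) (by linarith)
  have h2 : (‖Complex.Gamma ((1 : ℝ) + t * Complex.I)‖ / ‖Complex.Gamma (1 : ℝ)‖) ^ (2 * σ - 1) ≤
      (√(4 * Real.pi) * |t| ^ (1 / 2 : ℝ) * E) ^ (2 * σ - 1) :=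
    Real.rpow_le_rpow (by positivity) (norm_Gamma_one_le ht) (by linarith)
  have h3 : (√(4 * Real.pi) * |t| ^ (1 / 2 : ℝ) * E) ^ (2 * σ - 1) =
      √(4 * Real.pi) ^ (2 * σ - 1) * (|t| ^ (σ - 1 / 2) * E) * E ^ (2 * σ - 2) := by
    rw [Real.mul_rpow (by positivity) hE0.le, Real.mul_rpow (by positivity) (by positivity),
      ← Real.rpow_mul htp.le]
    have e1 : 1 / 2 * (2 * σ - 1) = σ - 1 / 2 := by ring
    have e2 : 2 * σ - 1 = 1 + (2 * σ - 2) := by ring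
    have e3 : E ^ (2 * σ - 1) = E * E ^ (2 * σ - 2) := by
      rw [e2, Real.rpow_add hE0, Real.rpow_one]
    rw [e1, e3]
    ring
  have h4 : ‖Complex.Gamma (σ + t * Complex.I)‖ / ‖Complex.Gamma σ‖ * E ^ (2 * σ - 2) ≤
      √(4 * Real.pi) ^ (2 * σ - 1) * (|t| ^ (σ - 1 / 2) * E) * E ^ (2 * σ - 2) :=
    h3 ▸ ((mul_le_mul_of_nonneg_left h1 (by positivity)).trans (key.trans h2))
  have h5 := le_of_mul_le_mul_right h4 (Real.rpow_pos_of_pos hE0 _)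
  rw [div_le_iff₀ hG] at h5
  linarith

/-- The upper bound `Γ(σ + i t) ≪ |t|^(σ - 1/2) e^(-π |t| / 2)`, uniform for `σ` in a bounded
interval. -/
theorem exists_norm_Gamma_le (α β : ℝ) : ∃ C : ℝ, 0 < C ∧ ∀ σ t : ℝ, α ≤ σ → σ ≤ β → 1 ≤ |t| →
    ‖Complex.Gamma (σ + t * Complex.I)‖ ≤
      C * (|t| ^ (σ - 1 / 2) * Real.exp (-(Real.pi * |t| / 2))) := by
  -- the functional equation moves the interval to the right of `1`
  obtain ⟨N, hN⟩ := exists_nat_ge (1 - α)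
  have hcont : ContinuousOn (fun σ : ℝ => ‖Complex.Gamma σ‖ * √(4 * Real.pi) ^ (2 * σ - 1))
      (Set.Icc 1 (β + N)) := by
    refine ContinuousOn.mul ?_ ?_
    · intro σ hσ
      refine ContinuousAt.continuousWithinAt (ContinuousAt.norm ?_)
      refine ContinuousAt.comp (g := Complex.Gamma) (f := fun σ : ℝ => (σ : ℂ)) ?_
        Complex.continuous_ofReal.continuousAt
      refine (Complex.differentiableAt_Gamma _ fun m hm => ?_).continuousAt
      have := congrArg Complex.re hm
      simp only [Complex.ofReal_re, Complex.neg_re, Complex.natCast_re] at this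
      linarith [hσ.1, Nat.cast_nonneg (α := ℝ) m]
    · have : 0 < √(4 * Real.pi) := by positivity
      exact (Continuous.rpow continuous_const (by fun_prop) fun _ =>
        Or.inl this.ne').continuousOn
  obtain ⟨C, hC⟩ := isCompact_Icc.exists_bound_of_continuousOn hcont
  refine ⟨max C 1, by positivity, fun σ t hσ hσ' ht => ?_⟩
  have hC' : ∀ σ ∈ Set.Icc 1 (β + N),
      ‖Complex.Gamma σ‖ * √(4 * Real.pi) ^ (2 * σ - 1) ≤ max C 1 := fun σ hσ =>
    (le_abs_self _).trans ((hC σ hσ).trans (le_max_left _ _))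
  have htp : 0 < |t| := by linarith
  have hstep : ∀ n : ℕ, ‖Complex.Gamma (σ + t * Complex.I)‖ * |t| ^ (n : ℝ) ≤
      ‖Complex.Gamma (((σ + n : ℝ) : ℂ) + t * Complex.I)‖ := by
    intro n
    induction n with
    | zero => simp
    | succ n ih =>
      have hne : ((σ + n : ℝ) : ℂ) + t * Complex.I ≠ 0 := by
        intro h
        have := congrArg Complex.im h
        simp at this
        simp [this] at htp
      have e : ((σ + (n + 1 : ℕ) : ℝ) : ℂ) + t * Complex.I =
          ((σ + n : ℝ) : ℂ) + t * Complex.I + 1 := by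
        push_cast
        ring
      have hn : |t| ≤ ‖((σ + n : ℝ) : ℂ) + t * Complex.I‖ := by
        have := Complex.abs_im_le_norm (((σ + n : ℝ) : ℂ) + t * Complex.I)
        simpa using this
      rw [e, Complex.Gamma_add_one _ hne, norm_mul, Nat.cast_add_one,
        Real.rpow_add_one htp.ne', ← mul_assoc, mul_comm]
      exact mul_le_mul hn ih (by positivity) (by positivity)
  have h1 := hstep N
  have h2 := norm_Gamma_le_of_one_le (σ := σ + N) (by linarith) ht
  have h3 : ‖Complex.Gamma (((σ + N : ℝ) : ℂ) + t * Complex.I)‖ ≤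
      max C 1 * (|t| ^ (σ + N - 1 / 2) * Real.exp (-(Real.pi * |t| / 2))) :=
    h2.trans (mul_le_mul_of_nonneg_right (hC' (σ + N) ⟨by linarith, by linarith⟩) (by positivity))
  have h4 : |t| ^ (σ + N - 1 / 2) = |t| ^ (σ - 1 / 2) * |t| ^ (N : ℝ) := by
    rw [← Real.rpow_add htp]
    congr 1
    ring
  have h5 : ‖Complex.Gamma (σ + t * Complex.I)‖ * |t| ^ (N : ℝ) ≤
      max C 1 * (|t| ^ (σ - 1 / 2) * Real.exp (-(Real.pi * |t| / 2))) * |t| ^ (N : ℝ) := by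
    refine h1.trans (h3.trans (le_of_eq ?_))
    rw [h4]
    ring
  exact le_of_mul_le_mul_right h5 (Real.rpow_pos_of_pos htp _)

end

section

/-! ### Independence of a contour integral of the contour -/

/-- The point with parameter `u` on the horizontal segment that joins the curves `r₁(t) + i t` and
`r₂(t) + i t` at height `t`. -/
def segmentPoint (r₁ r₂ : ℝ → ℝ) (t u : ℝ) : ℂ :=
  (r₁ t : ℂ) + u * ((r₂ t : ℂ) - r₁ t) + t * Complex.I

/-- The integral of `f` over the horizontal segment that joins two curves, as a function of the
height `t`, is a primitive of the difference of the pulled back integrands. -/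
theorem hasDerivAt_integral_segment {f : ℂ → ℂ} {r₁ r₂ : ℝ → ℝ} (h₁ : ContDiff ℝ 1 r₁)
    (h₂ : ContDiff ℝ 1 r₂)
    (hf : ∀ t : ℝ, ∀ u ∈ Set.Icc (0 : ℝ) 1, AnalyticAt ℂ f (segmentPoint r₁ r₂ t u)) (t₀ : ℝ) :
    HasDerivAt (fun t => ∫ u in (0 : ℝ)..1, ((r₂ t : ℂ) - r₁ t) * f (segmentPoint r₁ r₂ t u))
      (f (r₂ t₀ + t₀ * Complex.I) * (deriv r₂ t₀ + Complex.I) -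
        f (r₁ t₀ + t₀ * Complex.I) * (deriv r₁ t₀ + Complex.I)) t₀ := by
  have hc₁ := h₁.continuous
  have hc₂ := h₂.continuous
  have hd₁ : ∀ t, HasDerivAt (fun t => (r₁ t : ℂ)) (deriv r₁ t : ℝ) t := fun t =>
    (h₁.differentiable one_ne_zero t).hasDerivAt.ofReal_comp
  have hd₂ : ∀ t, HasDerivAt (fun t => (r₂ t : ℂ)) (deriv r₂ t : ℝ) t := fun t =>
    (h₂.differentiable one_ne_zero t).hasDerivAt.ofReal_comp
  have hdc₁ : Continuous (deriv r₁) := h₁.continuous_deriv le_rfl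
  have hdc₂ : Continuous (deriv r₂) := h₂.continuous_deriv le_rfl
  set H := segmentPoint r₁ r₂ with hH
  -- the partial derivatives of `H` in `t` and in `u`
  let Ht : ℝ → ℝ → ℂ := fun t u =>
    (deriv r₁ t : ℝ) + u * (((deriv r₂ t : ℝ) : ℂ) - (deriv r₁ t : ℝ)) + Complex.I
  have hHt : ∀ t u, HasDerivAt (fun t => H t u) (Ht t u) t := by
    intro t u
    have h3 : HasDerivAt (fun t : ℝ => (t : ℂ) * Complex.I) Complex.I t := by
      simpa using (hasDerivAt_id t).ofReal_comp.mul_const Complex.I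
    exact ((hd₁ t).add (((hd₂ t).sub (hd₁ t)).const_mul (u : ℂ))).add h3
  have hHu : ∀ t u, HasDerivAt (fun u => H t u) ((r₂ t : ℂ) - r₁ t) u := by
    intro t u
    have h3 : HasDerivAt (fun u : ℝ => (u : ℂ) * ((r₂ t : ℂ) - r₁ t)) ((r₂ t : ℂ) - r₁ t) u := by
      simpa using (hasDerivAt_id u).ofReal_comp.mul_const ((r₂ t : ℂ) - r₁ t)
    exact (h3.const_add (r₁ t : ℂ)).add_const _
  have hHc : Continuous fun p : ℝ × ℝ => H p.1 p.2 := by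
    simp only [hH, segmentPoint]
    fun_prop
  have hHtc : Continuous fun p : ℝ × ℝ => Ht p.1 p.2 := by
    simp only [Ht]
    fun_prop
  let F' : ℝ → ℝ → ℂ := fun t u => (((deriv r₂ t : ℝ) : ℂ) - (deriv r₁ t : ℝ)) * f (H t u) +
    ((r₂ t : ℂ) - r₁ t) * (deriv f (H t u) * Ht t u)
  have hF' : ContinuousOn (fun p : ℝ × ℝ => F' p.1 p.2) (Set.univ ×ˢ Set.Icc (0 : ℝ) 1) := by
    have c1 : ContinuousOn (fun p : ℝ × ℝ => f (H p.1 p.2)) (Set.univ ×ˢ Set.Icc (0 : ℝ) 1) :=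
      fun p hp => ((hf p.1 p.2 hp.2).continuousAt.comp
        (f := fun p : ℝ × ℝ => H p.1 p.2) hHc.continuousAt).continuousWithinAt
    have c2 : ContinuousOn (fun p : ℝ × ℝ => deriv f (H p.1 p.2))
        (Set.univ ×ˢ Set.Icc (0 : ℝ) 1) :=
      fun p hp => ((hf p.1 p.2 hp.2).deriv.continuousAt.comp
        (f := fun p : ℝ × ℝ => H p.1 p.2) hHc.continuousAt).continuousWithinAt
    refine ContinuousOn.add (ContinuousOn.mul ?_ c1)
      (ContinuousOn.mul ?_ (c2.mul hHtc.continuousOn)) <;>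
      exact Continuous.continuousOn (by fun_prop)
  have hslice : ∀ t, ContinuousOn (fun u => F' t u) (Set.Icc 0 1) := fun t =>
    hF'.comp (f := fun u => (t, u)) (by fun_prop) fun u hu => ⟨trivial, hu⟩
  have hFc : ∀ t, ContinuousOn (fun u => ((r₂ t : ℂ) - r₁ t) * f (H t u)) (Set.Icc 0 1) :=
    fun t u hu => (continuousAt_const.mul ((hf t u hu).continuousAt.comp
      (f := fun u => H t u) (hHu t u).continuousAt)).continuousWithinAt
  obtain ⟨B, hB⟩ := ((isCompact_Icc (a := t₀ - 1) (b := t₀ + 1)).prod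
    (isCompact_Icc (a := (0 : ℝ)) (b := 1))).exists_bound_of_continuousOn
    (hF'.mono (Set.prod_mono_left (Set.subset_univ _)))
  have hIoc : Set.uIoc (0 : ℝ) 1 ⊆ Set.Icc 0 1 := by
    rw [Set.uIoc_of_le zero_le_one]
    exact Set.Ioc_subset_Icc_self
  have key := (intervalIntegral.hasDerivAt_integral_of_dominated_loc_of_deriv_le
    (μ := MeasureTheory.volume) (a := 0) (b := 1)
    (F := fun t u => ((r₂ t : ℂ) - r₁ t) * f (H t u)) (F' := F') (x₀ := t₀)
    (s := Set.Icc (t₀ - 1) (t₀ + 1)) (bound := fun _ => B)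
    (Icc_mem_nhds (by linarith) (by linarith))
    (Eventually.of_forall fun t =>
      ((hFc t).aestronglyMeasurable measurableSet_Icc).mono_measure
        (MeasureTheory.Measure.restrict_mono hIoc le_rfl))
    (ContinuousOn.intervalIntegrable (by rw [Set.uIcc_of_le zero_le_one]; exact hFc t₀))
    (((hslice t₀).aestronglyMeasurable measurableSet_Icc).mono_measure
        (MeasureTheory.Measure.restrict_mono hIoc le_rfl))
    (Eventually.of_forall fun u hu t ht => hB (t, u) ⟨ht, hIoc hu⟩)
    intervalIntegrable_const
    (Eventually.of_forall fun u hu t _ =>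
      ((hd₂ t).sub (hd₁ t)).mul
        ((hf t u (hIoc hu)).differentiableAt.hasDerivAt.comp t (hHt t u)))).2
  have hG : ∀ u ∈ Set.uIcc (0 : ℝ) 1, HasDerivAt (fun u => f (H t₀ u) * Ht t₀ u) (F' t₀ u) u := by
    intro u hu
    rw [Set.uIcc_of_le zero_le_one] at hu
    have d1 := (hf t₀ u hu).differentiableAt.hasDerivAt.comp u (hHu t₀ u)
    have d2 : HasDerivAt (fun u => Ht t₀ u) (((deriv r₂ t₀ : ℝ) : ℂ) - (deriv r₁ t₀ : ℝ)) u := by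
      have h3 : HasDerivAt (fun u : ℝ => (u : ℂ) * (((deriv r₂ t₀ : ℝ) : ℂ) - (deriv r₁ t₀ : ℝ)))
          (((deriv r₂ t₀ : ℝ) : ℂ) - (deriv r₁ t₀ : ℝ)) u := by
        simpa using (hasDerivAt_id u).ofReal_comp.mul_const
          (((deriv r₂ t₀ : ℝ) : ℂ) - (deriv r₁ t₀ : ℝ))
      exact (h3.const_add _).add_const _
    convert! d1.mul d2 using 1
    simp only [F', Function.comp]
    ring
  rw [intervalIntegral.integral_eq_sub_of_hasDerivAt hG
    (ContinuousOn.intervalIntegrable (by rw [Set.uIcc_of_le zero_le_one]; exact hslice t₀))] at key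
  convert! key using 1
  simp only [hH, segmentPoint, Ht, Complex.ofReal_zero, Complex.ofReal_one]
  ring_nf

/-- Cauchy's theorem for two curves `r₁(t) + i t` and `r₂(t) + i t` that bound a region where `f`
is analytic, if `f` decays on the horizontal segments joining them. -/
theorem integral_contour_eq {f : ℂ → ℂ} {r₁ r₂ : ℝ → ℝ} (h₁ : ContDiff ℝ 1 r₁)
    (h₂ : ContDiff ℝ 1 r₂)
    (hf : ∀ t : ℝ, ∀ u ∈ Set.Icc (0 : ℝ) 1, AnalyticAt ℂ f (segmentPoint r₁ r₂ t u))
    (hi₁ : MeasureTheory.Integrable fun t : ℝ =>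
      f (r₁ t + t * Complex.I) * (deriv r₁ t + Complex.I))
    (hi₂ : MeasureTheory.Integrable fun t : ℝ =>
      f (r₂ t + t * Complex.I) * (deriv r₂ t + Complex.I))
    {g : ℝ → ℝ} (hg : Tendsto g (atBot ⊔ atTop) (𝓝 0))
    (hfg : ∀ᶠ t in atBot ⊔ atTop, ∀ u ∈ Set.Icc (0 : ℝ) 1,
      ‖((r₂ t : ℂ) - r₁ t) * f (segmentPoint r₁ r₂ t u)‖ ≤ g t) :
    ∫ t : ℝ, f (r₁ t + t * Complex.I) * (deriv r₁ t + Complex.I) =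
      ∫ t : ℝ, f (r₂ t + t * Complex.I) * (deriv r₂ t + Complex.I) := by
  have hlim : Tendsto (fun t => ∫ u in (0 : ℝ)..1,
      ((r₂ t : ℂ) - r₁ t) * f (segmentPoint r₁ r₂ t u)) (atBot ⊔ atTop) (𝓝 0) := by
    refine squeeze_zero_norm' ?_ hg
    filter_upwards [hfg] with t ht
    refine (intervalIntegral.norm_integral_le_of_norm_le_const (C := g t) fun u hu => ?_).trans
      (by simp)
    rw [Set.uIoc_of_le zero_le_one] at hu
    exact ht u (Set.Ioc_subset_Icc_self hu)
  have := MeasureTheory.integral_of_hasDerivAt_of_tendsto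
    (hasDerivAt_integral_segment h₁ h₂ hf) (hi₂.sub hi₁)
    (hlim.mono_left le_sup_left) (hlim.mono_left le_sup_right)
  rw [MeasureTheory.integral_sub hi₂ hi₁, sub_zero] at this
  exact (sub_eq_zero.mp this).symm

end

section

/-! ### The damped Mellin-Barnes integral -/

/-- The gamma factor with the angle `π / 2` replaced by `π / 2 - ε`. It is the Mellin transform of
`u ↦ exp (-z u)` with `z = exp (-i ς (π / 2 - ε))`, and it decays exponentially on vertical lines
if `ε > 0`. -/
def gammaDamped (ε : ℝ) (u : ℤˣ) (s : ℂ) : ℂ :=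
  Complex.Gamma s * Complex.exp (Complex.I * sgn u * (Real.pi / 2 - ε) * s)

/-- The integrand of the Mellin-Barnes integral with damped gamma factors, as a function of `s`. -/
def dampedKernel {n : ℕ} (ε : ℝ) (sig : Fin n → ℤˣ) (lam : Fin n → ℂ) (x : ℝ) (s : ℂ) : ℂ :=
  (∏ l, gammaDamped ε (sig l) (s - lam l)) * (x : ℂ) ^ (-(n : ℂ) * s)

/-- `|Γ(w)| e^(π |Im w| / 2)`, which bounds all the damped gamma factors and grows at most
polynomially on vertical lines. -/
def gammaMajorant (w : ℂ) : ℝ := ‖Complex.Gamma w‖ * Real.exp (Real.pi / 2 * |w.im|)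

theorem gammaMajorant_nonneg (w : ℂ) : 0 ≤ gammaMajorant w := by
  unfold gammaMajorant
  positivity

theorem gammaDamped_zero (u : ℤˣ) (s : ℂ) : gammaDamped 0 u s = gammaSign u s := by
  unfold gammaDamped gammaSign
  congr 2
  push_cast
  ring

theorem mellinBarnesIntegrand_eq {n : ℕ} (sig : Fin n → ℤˣ) (lam : Fin n → ℂ) (r : ℝ → ℝ)
    (x t : ℝ) : mellinBarnesIntegrand sig lam r x t =
      dampedKernel 0 sig lam x (r t + t * Complex.I) * (deriv r t + Complex.I) := by
  simp only [mellinBarnesIntegrand, dampedKernel, gammaFactor, gammaDamped_zero]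

theorem norm_gammaDamped_le {ε : ℝ} (hε : ε ≤ Real.pi / 2) (u : ℤˣ) (w : ℂ) :
    ‖gammaDamped ε u w‖ ≤ gammaMajorant w * Real.exp (-(ε * |w.im|)) := by
  have h : (Complex.I * sgn u * (Real.pi / 2 - ε) * w).re ≤ (Real.pi / 2 - ε) * |w.im| := by
    have h0 : 0 ≤ Real.pi / 2 - ε := by linarith
    have e1 : (Real.pi / 2 - ε : ℂ) = ((Real.pi / 2 - ε : ℝ) : ℂ) := by push_cast; ring
    rcases Int.units_eq_one_or u with rfl | rfl
    · have : (Complex.I * sgn 1 * (Real.pi / 2 - ε) * w).re = (Real.pi / 2 - ε) * -w.im := by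
        rw [e1]
        simp [sgn]
      rw [this]
      exact mul_le_mul_of_nonneg_left (neg_le_abs _) h0
    · have : (Complex.I * sgn (-1) * (Real.pi / 2 - ε) * w).re = (Real.pi / 2 - ε) * w.im := by
        rw [e1]
        simp [sgn]
      rw [this]
      exact mul_le_mul_of_nonneg_left (le_abs_self _) h0
  rw [gammaDamped, norm_mul, Complex.norm_exp, gammaMajorant, mul_assoc ‖_‖,
    ← Real.exp_add]
  refine mul_le_mul_of_nonneg_left (Real.exp_le_exp.mpr (h.trans (le_of_eq ?_))) (norm_nonneg _)
  ring

/-- Polynomial growth of the majorant; a bounded difference between `Im w` and `t` is allowed so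
that the bound is uniform under small translations of the argument. -/
theorem exists_gammaMajorant_le (α β M : ℝ) : ∃ C : ℝ, 0 < C ∧ ∃ T : ℝ, 0 ≤ T ∧
    ∀ (w : ℂ) (t : ℝ), α ≤ w.re → w.re ≤ β → |w.im - t| ≤ M → T ≤ |t| →
      gammaMajorant w ≤ C * (1 + |t|) ^ (w.re - 1 / 2) := by
  obtain ⟨C, hC, h⟩ := exists_norm_Gamma_le α β
  set Q := max |α - 1 / 2| |β - 1 / 2| with hQ
  have hQ0 : 0 ≤ Q := (abs_nonneg _).trans (le_max_left _ _)
  refine ⟨C * 2 ^ Q, by positivity, 2 * |M| + 2, by positivity, fun w t h1 h2 h3 h4 => ?_⟩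
  have hM := le_abs_self M
  have hb := abs_le.mp h3
  have hlow : (1 + |t|) / 2 ≤ |w.im| := by
    have : |t| - |w.im| ≤ |t - w.im| := abs_sub_abs_le_abs_sub _ _
    rw [abs_sub_comm] at this
    linarith
  have hup : |w.im| ≤ 2 * (1 + |t|) := by
    have : |w.im| - |t| ≤ |w.im - t| := abs_sub_abs_le_abs_sub _ _
    linarith
  have ht0 := abs_nonneg t
  have hMnn := abs_nonneg M
  have hw1 : 1 ≤ |w.im| := by linarith
  have hG := h w.re w.im h1 h2 hw1
  rw [Complex.re_add_im] at hG
  have hexp : Real.exp (-(Real.pi * |w.im| / 2)) * Real.exp (Real.pi / 2 * |w.im|) = 1 := by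
    rw [← Real.exp_add, Real.exp_eq_one_iff]
    ring
  have hpow : |w.im| ^ (w.re - 1 / 2) ≤ 2 ^ Q * (1 + |t|) ^ (w.re - 1 / 2) := by
    have hp : 0 < 1 + |t| := by linarith
    rcases le_total 0 (w.re - 1 / 2) with hs | hs
    · calc |w.im| ^ (w.re - 1 / 2) ≤ (2 * (1 + |t|)) ^ (w.re - 1 / 2) :=
            Real.rpow_le_rpow (by linarith) hup hs
        _ = 2 ^ (w.re - 1 / 2) * (1 + |t|) ^ (w.re - 1 / 2) := Real.mul_rpow (by norm_num) hp.le
        _ ≤ _ := by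
          gcongr
          · norm_num
          · exact le_max_of_le_right
              ((by linarith : w.re - 1 / 2 ≤ β - 1 / 2).trans (le_abs_self _))
    · calc |w.im| ^ (w.re - 1 / 2) ≤ ((1 + |t|) / 2) ^ (w.re - 1 / 2) :=
            Real.rpow_le_rpow_of_nonpos (by linarith) hlow hs
        _ = 2 ^ (-(w.re - 1 / 2)) * (1 + |t|) ^ (w.re - 1 / 2) := by
            rw [Real.div_rpow hp.le (by norm_num), Real.rpow_neg (by norm_num)]
            field_simp
        _ ≤ _ := by
          gcongr
          · norm_num
          · exact le_max_of_le_left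
              ((by linarith : -(w.re - 1 / 2) ≤ -(α - 1 / 2)).trans (neg_le_abs _))
  calc gammaMajorant w
      ≤ C * (|w.im| ^ (w.re - 1 / 2) * Real.exp (-(Real.pi * |w.im| / 2))) *
          Real.exp (Real.pi / 2 * |w.im|) := mul_le_mul_of_nonneg_right hG (Real.exp_pos _).le
    _ = C * |w.im| ^ (w.re - 1 / 2) *
          (Real.exp (-(Real.pi * |w.im| / 2)) * Real.exp (Real.pi / 2 * |w.im|)) := by ring
    _ = C * |w.im| ^ (w.re - 1 / 2) := by rw [hexp, mul_one]
    _ ≤ C * (2 ^ Q * (1 + |t|) ^ (w.re - 1 / 2)) := mul_le_mul_of_nonneg_left hpow hC.le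
    _ = _ := by ring

theorem exists_prod_gammaMajorant_le {n : ℕ} (lam : Fin n → ℂ) (α β : ℝ) :
    ∃ C : ℝ, 0 < C ∧ ∃ T : ℝ, 0 ≤ T ∧ ∀ s : ℂ, α ≤ s.re → s.re ≤ β → T ≤ |s.im| →
      ∏ l, gammaMajorant (s - lam l) ≤
        C * (1 + |s.im|) ^ (n * (s.re - 1 / 2) - (∑ l, lam l).re) := by
  choose C hC T hT h using fun l => exists_gammaMajorant_le (α - (lam l).re) (β - (lam l).re)
    |(lam l).im|
  refine ⟨∏ l, C l, Finset.prod_pos fun l _ => hC l, ∑ l, T l, Finset.sum_nonneg fun l _ => hT l,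
    fun s h1 h2 h3 => ?_⟩
  have hp : 0 < 1 + |s.im| := by positivity
  have hle : ∀ l, gammaMajorant (s - lam l) ≤
      C l * (1 + |s.im|) ^ ((s - lam l).re - 1 / 2) := fun l => by
    refine h l (s - lam l) s.im (by simp; linarith) (by simp; linarith) (by simp) ?_
    exact (Finset.single_le_sum (fun l _ => hT l) (Finset.mem_univ l)).trans h3
  refine (Finset.prod_le_prod (fun l _ => gammaMajorant_nonneg _) fun l _ => hle l).trans
    (le_of_eq ?_)
  rw [Finset.prod_mul_distrib, ← Real.rpow_sum_of_pos hp]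
  congr 2
  simp only [Complex.sub_re, Complex.re_sum, Finset.sum_sub_distrib, Finset.sum_const,
    Finset.card_univ, Fintype.card_fin, nsmul_eq_mul]
  ring

theorem norm_dampedKernel_le {n : ℕ} {ε : ℝ} (hε : ε ≤ Real.pi / 2) (sig : Fin n → ℤˣ)
    (lam : Fin n → ℂ) {x : ℝ} (hx : 0 < x) (s : ℂ) :
    ‖dampedKernel ε sig lam x s‖ ≤ (∏ l, gammaMajorant (s - lam l)) *
      (∏ l, Real.exp (-(ε * |(s - lam l).im|))) * x ^ (-(n : ℝ) * s.re) := by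
  have h1 : ‖(x : ℂ) ^ (-(n : ℂ) * s)‖ = x ^ (-(n : ℝ) * s.re) := by
    rw [Complex.norm_cpow_eq_rpow_re_of_pos hx]
    simp
  rw [dampedKernel, norm_mul, h1, norm_prod, ← Finset.prod_mul_distrib]
  exact mul_le_mul_of_nonneg_right (Finset.prod_le_prod (fun _ _ => norm_nonneg _)
    fun l _ => norm_gammaDamped_le hε _ _) (Real.rpow_nonneg hx.le _)

theorem norm_dampedKernel_le_of_nonneg {n : ℕ} {ε : ℝ} (hε0 : 0 ≤ ε) (hε : ε ≤ Real.pi / 2)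
    (sig : Fin n → ℤˣ) (lam : Fin n → ℂ) {x : ℝ} (hx : 0 < x) (s : ℂ) :
    ‖dampedKernel ε sig lam x s‖ ≤ (∏ l, gammaMajorant (s - lam l)) * x ^ (-(n : ℝ) * s.re) := by
  refine (norm_dampedKernel_le hε sig lam hx s).trans
    (mul_le_mul_of_nonneg_right ?_ (Real.rpow_nonneg hx.le _))
  refine mul_le_of_le_one_right (Finset.prod_nonneg fun l _ => gammaMajorant_nonneg _) ?_
  exact Finset.prod_le_one (fun _ _ => (Real.exp_pos _).le) fun l _ =>
    Real.exp_le_one_iff.mpr (neg_nonpos.mpr (by positivity))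

theorem exists_norm_dampedKernel_le {n : ℕ} (hn : 0 < n) (sig : Fin n → ℤˣ) (lam : Fin n → ℂ)
    {x : ℝ} (hx : 0 < x) {ε : ℝ} (hε0 : 0 ≤ ε) (hε : ε ≤ Real.pi / 2) (α β : ℝ) :
    ∃ C : ℝ, 0 < C ∧ ∃ P T : ℝ, ∀ s : ℂ, α ≤ s.re → s.re ≤ β → T ≤ |s.im| →
      ‖dampedKernel ε sig lam x s‖ ≤ C * ((1 + |s.im|) ^ P * Real.exp (-(ε * |s.im|))) := by
  obtain ⟨C, hC, T, hT, h⟩ := exists_prod_gammaMajorant_le lam α β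
  obtain ⟨D, hD⟩ := (isCompact_Icc (a := α) (b := β)).exists_bound_of_continuousOn
    (f := fun y : ℝ => x ^ (-(n : ℝ) * y))
    (Continuous.rpow continuous_const (by fun_prop) fun _ => Or.inl hx.ne').continuousOn
  let l₀ : Fin n := ⟨0, hn⟩
  refine ⟨C * (max D 1 * Real.exp (ε * |(lam l₀).im|)), by positivity,
    n * (β - 1 / 2) - (∑ l, lam l).re, T, fun s h1 h2 h3 => ?_⟩
  have e1 := h s h1 h2 h3
  have hp : 1 ≤ 1 + |s.im| := by linarith [abs_nonneg s.im]
  have e2 : (1 + |s.im|) ^ (n * (s.re - 1 / 2) - (∑ l, lam l).re) ≤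
      (1 + |s.im|) ^ (n * (β - 1 / 2) - (∑ l, lam l).re) := by
    gcongr
  have e3 : ∏ l, Real.exp (-(ε * |(s - lam l).im|)) ≤
      Real.exp (ε * |(lam l₀).im|) * Real.exp (-(ε * |s.im|)) := by
    rw [← Real.exp_add, ← Real.exp_sum, Real.exp_le_exp]
    have e4 : ∑ l, -(ε * |(s - lam l).im|) ≤ -(ε * |(s - lam l₀).im|) := by
      rw [Finset.sum_neg_distrib, neg_le_neg_iff]
      exact Finset.single_le_sum (f := fun l => ε * |(s - lam l).im|)
        (fun l _ => by positivity) (Finset.mem_univ l₀)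
    have e5 : |s.im| - |(lam l₀).im| ≤ |(s - lam l₀).im| := by
      rw [Complex.sub_im]
      exact abs_sub_abs_le_abs_sub _ _
    nlinarith
  have e6 : x ^ (-(n : ℝ) * s.re) ≤ max D 1 :=
    (le_abs_self _).trans ((hD s.re ⟨h1, h2⟩).trans (le_max_left _ _))
  refine (norm_dampedKernel_le hε sig lam hx s).trans ?_
  calc (∏ l, gammaMajorant (s - lam l)) * (∏ l, Real.exp (-(ε * |(s - lam l).im|))) *
        x ^ (-(n : ℝ) * s.re)
      ≤ (C * (1 + |s.im|) ^ (n * (β - 1 / 2) - (∑ l, lam l).re)) *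
          (Real.exp (ε * |(lam l₀).im|) * Real.exp (-(ε * |s.im|))) * max D 1 := by
        refine mul_le_mul (mul_le_mul (e1.trans (mul_le_mul_of_nonneg_left e2 hC.le)) e3 ?_ ?_)
          e6 (Real.rpow_nonneg hx.le _) (by positivity)
        · exact Finset.prod_nonneg fun _ _ => (Real.exp_pos _).le
        · positivity
    _ = _ := by ring

theorem analyticAt_Gamma {s : ℂ} (hs : ∀ m : ℕ, s ≠ -m) : AnalyticAt ℂ Complex.Gamma s := by
  have h := (Complex.differentiable_one_div_Gamma.analyticAt s).inv
    (inv_ne_zero (Complex.Gamma_ne_zero hs))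
  refine h.congr (Eventually.of_forall fun z => ?_)
  simp

theorem analyticAt_gammaDamped (ε : ℝ) (u : ℤˣ) {s : ℂ} (hs : ∀ m : ℕ, s ≠ -m) :
    AnalyticAt ℂ (gammaDamped ε u) s := by
  refine (analyticAt_Gamma hs).mul ?_
  exact (Differentiable.analyticAt (by fun_prop) s)

theorem analyticAt_dampedKernel {n : ℕ} (ε : ℝ) (sig : Fin n → ℤˣ) (lam : Fin n → ℂ) {x : ℝ}
    (hx : 0 < x) {s : ℂ} (hs : ∀ l, ∀ m : ℕ, s ≠ lam l - m) :
    AnalyticAt ℂ (dampedKernel ε sig lam x) s := by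
  have h1 : ∀ l, AnalyticAt ℂ (fun s => gammaDamped ε (sig l) (s - lam l)) s := fun l => by
    refine (analyticAt_gammaDamped ε (sig l) (s := s - lam l) fun m hm => hs l m ?_).comp_of_eq
      (f := fun s => s - lam l) (by fun_prop) rfl
    linear_combination hm
  refine AnalyticAt.mul (Finset.analyticAt_fun_prod _ fun l _ => h1 l) ?_
  have hx' : (x : ℂ) ≠ 0 := by exact_mod_cast hx.ne'
  refine Differentiable.analyticAt (fun z => ?_) s
  exact DifferentiableAt.const_cpow (by fun_prop) (Or.inl hx')

end

section

theorem integrable_of_norm_le_one_add_abs_rpow {f : ℝ → ℂ} (hf : Continuous f) {C T p : ℝ}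
    (hp : 1 < p) (h : ∀ t : ℝ, T ≤ |t| → ‖f t‖ ≤ C * (1 + |t|) ^ (-p)) : Integrable f := by
  have hg : Integrable fun t : ℝ => (1 + |t|) ^ (-p) :=
    integrable_one_add_norm (E := ℝ) (by simpa using hp)
  have hO : ∀ l : Filter ℝ, (∀ᶠ t in l, T ≤ |t|) → f =O[l] fun t : ℝ => (1 + |t|) ^ (-p) :=
    fun l hl => Asymptotics.IsBigO.of_bound C <| hl.mono fun t ht => by
      rw [Real.norm_of_nonneg (by positivity)]
      exact h t ht
  exact hf.locallyIntegrable.integrable_of_isBigO_atBot_atTop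
    (hO _ (tendsto_abs_atBot_atTop.eventually_ge_atTop T)) (hg.integrableAtFilter _)
    (hO _ (tendsto_abs_atTop_atTop.eventually_ge_atTop T)) (hg.integrableAtFilter _)

theorem exists_rpow_mul_exp_neg_le (P : ℝ) {ε : ℝ} (hε : 0 < ε) : ∃ T : ℝ, ∀ t : ℝ, T ≤ |t| →
    (1 + |t|) ^ P * Real.exp (-(ε * |t|)) ≤ Real.exp ε * (1 + |t|) ^ (-2 : ℝ) := by
  have h := tendsto_rpow_mul_exp_neg_mul_atTop_nhds_zero (P + 2) ε hε
  obtain ⟨T, hT⟩ := eventually_atTop.mp (h.eventually_le_const one_pos)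
  refine ⟨T, fun t ht => ?_⟩
  have hp : 0 < 1 + |t| := by positivity
  have h1 := hT (1 + |t|) (by linarith)
  have e1 : -ε * (1 + |t|) = -ε + -(ε * |t|) := by ring
  rw [e1, Real.exp_add, Real.rpow_add hp, Real.exp_neg ε] at h1
  rw [Real.rpow_neg hp.le]
  have h2 : 0 < Real.exp ε := Real.exp_pos _
  have h3 : 0 < (1 + |t|) ^ (2 : ℝ) := Real.rpow_pos_of_pos hp _
  field_simp at h1 ⊢
  linarith

variable {n : ℕ} {lam : Fin n → ℂ} {r : ℝ → ℝ}

theorem IsContour.ne_pole (hr : IsContour lam r) {t y : ℝ} (hy : r t ≤ y) (l : Fin n) (m : ℕ) :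
    (y : ℂ) + t * Complex.I ≠ lam l - m := by
  intro h
  have h1 := hr.left l m
  have him : (lam l - m).im = t := by rw [← h]; simp
  have hre : (lam l - m).re = y := by rw [← h]; simp
  rw [him, hre] at h1
  linarith

/-- The bound for `σ` in the definition of an admissible contour says that the gamma factors decay
like `|t|^(-p)` on its vertical parts for some `p > 1`. -/
theorem IsContour.exists_majorant_rpow (hn : 0 < n) (hr : IsContour lam r) :
    ∃ σ T p : ℝ, 1 < p ∧ (∀ t, T ≤ |t| → r t = σ ∧ deriv r t = 0) ∧
      n * (σ - 1 / 2) - (∑ l, lam l).re = -p := by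
  obtain ⟨σ, hσ, T, hT⟩ := hr.vertical
  refine ⟨σ, T + 1, -(n * (σ - 1 / 2) - (∑ l, lam l).re), ?_, fun t ht => ⟨hT t (by linarith), ?_⟩,
    by ring⟩
  · have hn' : (0 : ℝ) < n := by exact_mod_cast hn
    have h1 : σ - 1 / 2 < ((∑ l, lam l).re - 1) / n := by linarith
    rw [lt_div_iff₀ hn'] at h1
    linarith
  · have : r =ᶠ[𝓝 t] fun _ => σ := by
      filter_upwards [continuous_abs.continuousAt.eventually_mem
        (lt_mem_nhds (show T < |t| by linarith))] with y hy
      exact hT y (le_of_lt hy)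
    rw [this.deriv_eq]
    simp

/-- An integrable bound for all the damped integrands on an admissible contour. -/
def contourMajorant (lam : Fin n → ℂ) (r : ℝ → ℝ) (x t : ℝ) : ℝ :=
  (∏ l, gammaMajorant (r t + t * Complex.I - lam l)) * x ^ (-(n : ℝ) * r t) *
    ‖((deriv r t : ℝ) : ℂ) + Complex.I‖

theorem norm_dampedKernel_contour_le {ε : ℝ} (hε0 : 0 ≤ ε) (hε : ε ≤ Real.pi / 2)
    (sig : Fin n → ℤˣ) (lam : Fin n → ℂ) (r : ℝ → ℝ) {x : ℝ} (hx : 0 < x) (t : ℝ) :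
    ‖dampedKernel ε sig lam x (r t + t * Complex.I) * (deriv r t + Complex.I)‖ ≤
      contourMajorant lam r x t := by
  rw [norm_mul, contourMajorant]
  refine mul_le_mul_of_nonneg_right ?_ (norm_nonneg _)
  simpa using norm_dampedKernel_le_of_nonneg hε0 hε sig lam hx (r t + t * Complex.I)

theorem continuous_segment (hr : ContDiff ℝ 1 r) :
    Continuous fun t : ℝ => (r t : ℂ) + t * Complex.I := by
  have := hr.continuous
  fun_prop

theorem IsContour.integrable_contourMajorant (hn : 0 < n) (hr : IsContour lam r) {x : ℝ}
    (hx : 0 < x) : Integrable (contourMajorant lam r x) := by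
  obtain ⟨σ, T, p, hp, hT, hexp⟩ := hr.exists_majorant_rpow hn
  obtain ⟨C, hC, T', hT', h⟩ := exists_prod_gammaMajorant_le lam σ σ
  have hrc := hr.contDiff.continuous
  have hrd : Continuous (deriv r) := hr.contDiff.continuous_deriv le_rfl
  have hcont : Continuous (contourMajorant lam r x) := by
    refine Continuous.mul (Continuous.mul (continuous_finsetProd _ fun l _ => ?_) ?_) (by fun_prop)
    · have hG : Continuous fun t : ℝ => Complex.Gamma (r t + t * Complex.I - lam l) := by
        refine continuous_iff_continuousAt.mpr fun t => ?_
        refine ContinuousAt.comp (g := Complex.Gamma)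
          (f := fun t : ℝ => (r t + t * Complex.I - lam l : ℂ)) ?_ (by fun_prop)
        refine (analyticAt_Gamma fun m hm =>
          hr.ne_pole (le_refl (r t)) (t := t) l m ?_).continuousAt
        linear_combination hm
      unfold gammaMajorant
      fun_prop
    · exact Continuous.rpow continuous_const (by fun_prop) fun _ => Or.inl hx.ne'
  have key : Integrable fun t => (contourMajorant lam r x t : ℂ) := by
    refine integrable_of_norm_le_one_add_abs_rpow (C := C * x ^ (-(n : ℝ) * σ)) (T := max T T')
      (p := p) (by fun_prop) hp fun t ht => ?_
    obtain ⟨h1, h2⟩ := hT t ((le_max_left _ _).trans ht)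
    have h3 := h (σ + t * Complex.I) (by simp) (by simp)
      (by simpa using (le_max_right _ _).trans ht)
    simp only [Complex.add_re, Complex.ofReal_re, Complex.mul_re, Complex.I_re, Complex.ofReal_im,
      Complex.I_im, Complex.add_im, Complex.mul_im, mul_zero, sub_zero, mul_one, zero_add,
      add_zero] at h3
    rw [hexp] at h3
    have hx' := Real.rpow_nonneg hx.le (-(n : ℝ) * σ)
    rw [Complex.norm_real, Real.norm_of_nonneg, contourMajorant, h1, h2]
    · simp only [Complex.ofReal_zero, zero_add, Complex.norm_I, mul_one]
      calc _ ≤ C * (1 + |t|) ^ (-p) * x ^ (-(n : ℝ) * σ) := mul_le_mul_of_nonneg_right h3 hx'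
        _ = _ := by ring
    · exact mul_nonneg (mul_nonneg (Finset.prod_nonneg fun _ _ => gammaMajorant_nonneg _)
        (Real.rpow_nonneg hx.le _)) (norm_nonneg _)
  have := key.norm
  refine this.congr (Eventually.of_forall fun t => ?_)
  simp only [Complex.norm_real]
  refine Real.norm_of_nonneg ?_
  exact mul_nonneg (mul_nonneg (Finset.prod_nonneg fun _ _ => gammaMajorant_nonneg _)
        (Real.rpow_nonneg hx.le _)) (norm_nonneg _)

theorem continuous_dampedKernel_curve (hr : ContDiff ℝ 1 r) (ε : ℝ) (sig : Fin n → ℤˣ) {x : ℝ}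
    (hx : 0 < x) (hpole : ∀ t : ℝ, ∀ l, ∀ m : ℕ, (r t : ℂ) + t * Complex.I ≠ lam l - m) :
    Continuous fun t : ℝ =>
      dampedKernel ε sig lam x (r t + t * Complex.I) * (deriv r t + Complex.I) := by
  have hrd : Continuous (deriv r) := hr.continuous_deriv le_rfl
  refine Continuous.mul (continuous_iff_continuousAt.mpr fun t => ?_) (by fun_prop)
  exact ContinuousAt.comp (g := dampedKernel ε sig lam x)
    (f := fun t : ℝ => (r t + t * Complex.I : ℂ))
    (analyticAt_dampedKernel ε sig lam hx (hpole t)).continuousAt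
    (continuous_segment hr).continuousAt

theorem IsContour.integrable_dampedKernel (hn : 0 < n) (hr : IsContour lam r) {x : ℝ}
    (hx : 0 < x) (sig : Fin n → ℤˣ) {ε : ℝ} (hε0 : 0 ≤ ε) (hε : ε ≤ Real.pi / 2) :
    Integrable fun t : ℝ =>
      dampedKernel ε sig lam x (r t + t * Complex.I) * (deriv r t + Complex.I) :=
  (hr.integrable_contourMajorant hn hx).mono'
    (continuous_dampedKernel_curve hr.contDiff ε sig hx
      fun _ l m => hr.ne_pole le_rfl l m).aestronglyMeasurable
    (Eventually.of_forall fun t => norm_dampedKernel_contour_le hε0 hε sig lam r hx t)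

theorem IsContour.tendsto_integral_dampedKernel (hn : 0 < n) (hr : IsContour lam r) {x : ℝ}
    (hx : 0 < x) (sig : Fin n → ℤˣ) :
    Tendsto (fun ε : ℝ => ∫ t : ℝ,
      dampedKernel ε sig lam x (r t + t * Complex.I) * (deriv r t + Complex.I))
      (𝓝[>] 0) (𝓝 (∫ t : ℝ, mellinBarnesIntegrand sig lam r x t)) := by
  have hev : ∀ᶠ ε : ℝ in 𝓝[>] 0, 0 ≤ ε ∧ ε ≤ Real.pi / 2 := by
    filter_upwards [Ioc_mem_nhdsGT (show (0 : ℝ) < Real.pi / 2 by positivity)] with ε hε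
    exact ⟨hε.1.le, hε.2⟩
  refine tendsto_integral_filter_of_dominated_convergence (contourMajorant lam r x) ?_ ?_
    (hr.integrable_contourMajorant hn hx) ?_
  · exact Eventually.of_forall fun ε => (continuous_dampedKernel_curve hr.contDiff ε sig hx
      fun _ l m => hr.ne_pole le_rfl l m).aestronglyMeasurable
  · filter_upwards [hev] with ε hε
    exact Eventually.of_forall fun t => norm_dampedKernel_contour_le hε.1 hε.2 sig lam r hx t
  · refine Eventually.of_forall fun t => ?_
    simp only [mellinBarnesIntegrand_eq]
    have : Continuous fun ε : ℝ =>
        dampedKernel ε sig lam x (r t + t * Complex.I) * (deriv r t + Complex.I) := by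
      simp only [dampedKernel, gammaDamped]
      fun_prop
    exact (this.tendsto 0).mono_left nhdsWithin_le_nhds

theorem line_ne_pole {σ : ℝ} (hσ : ∀ l, (lam l).re < σ) {y : ℝ} (hy : σ ≤ y) (t : ℝ) (l : Fin n)
    (m : ℕ) : (y : ℂ) + t * Complex.I ≠ lam l - m := by
  intro h
  have := congrArg Complex.re h
  simp at this
  linarith [hσ l, Nat.cast_nonneg (α := ℝ) m]

theorem exists_norm_dampedKernel_le_rpow (hn : 0 < n) (sig : Fin n → ℤˣ) (lam : Fin n → ℂ)
    {x : ℝ} (hx : 0 < x) {ε : ℝ} (hε0 : 0 < ε) (hε : ε ≤ Real.pi / 2) (α β : ℝ) :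
    ∃ C T : ℝ, ∀ s : ℂ, α ≤ s.re → s.re ≤ β → T ≤ |s.im| →
      ‖dampedKernel ε sig lam x s‖ ≤ C * (1 + |s.im|) ^ (-2 : ℝ) := by
  obtain ⟨C, hC, P, T₂, hK⟩ := exists_norm_dampedKernel_le hn sig lam hx hε0.le hε α β
  obtain ⟨T₃, hT₃⟩ := exists_rpow_mul_exp_neg_le P hε0
  refine ⟨C * Real.exp ε, max T₂ T₃, fun s h1 h2 h3 => ?_⟩
  refine (hK s h1 h2 ((le_max_left _ _).trans h3)).trans ?_
  rw [mul_assoc]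
  exact mul_le_mul_of_nonneg_left (hT₃ _ ((le_max_right _ _).trans h3)) hC.le

theorem integrable_dampedKernel_line (hn : 0 < n) (sig : Fin n → ℤˣ) {x : ℝ} (hx : 0 < x)
    {ε : ℝ} (hε0 : 0 < ε) (hε : ε ≤ Real.pi / 2) {σ : ℝ} (hσ : ∀ l, (lam l).re < σ) :
    Integrable fun t : ℝ => dampedKernel ε sig lam x (σ + t * Complex.I) := by
  obtain ⟨C, T, hK⟩ := exists_norm_dampedKernel_le_rpow hn sig lam hx hε0 hε σ σ
  refine integrable_of_norm_le_one_add_abs_rpow (C := C) (T := T) (p := 2) ?_ one_lt_two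
    fun t ht => ?_
  · refine continuous_iff_continuousAt.mpr fun t => ?_
    exact ContinuousAt.comp (g := dampedKernel ε sig lam x)
      (f := fun t : ℝ => (σ + t * Complex.I : ℂ))
      (analyticAt_dampedKernel ε sig lam hx (line_ne_pole hσ le_rfl t)).continuousAt
      (by fun_prop)
  · simpa using hK (σ + t * Complex.I) (by simp) (by simp) (by simpa using ht)

/-- For the damped integrand, an admissible contour may be replaced by any vertical line to the
right of the poles. -/
theorem IsContour.integral_dampedKernel_eq (hn : 0 < n) (hr : IsContour lam r) {x : ℝ}
    (hx : 0 < x) (sig : Fin n → ℤˣ) {ε : ℝ} (hε0 : 0 < ε) (hε : ε ≤ Real.pi / 2) {σ : ℝ}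
    (hσ : ∀ l, (lam l).re < σ) :
    ∫ t : ℝ, dampedKernel ε sig lam x (r t + t * Complex.I) * (deriv r t + Complex.I) =
      Complex.I * ∫ t : ℝ, dampedKernel ε sig lam x (σ + t * Complex.I) := by
  obtain ⟨σ₁, T₁, p, -, hT₁, -⟩ := hr.exists_majorant_rpow hn
  obtain ⟨C, T₂, hK⟩ := exists_norm_dampedKernel_le_rpow hn sig lam hx hε0 hε
    (min σ σ₁) (max σ σ₁)
  have hconst : ContDiff ℝ 1 fun _ : ℝ => σ := contDiff_const
  have hi₂ : Integrable fun t : ℝ => dampedKernel ε sig lam x ((fun _ : ℝ => σ) t + t * Complex.I) *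
      (deriv (fun _ : ℝ => σ) t + Complex.I) := by
    simpa using (integrable_dampedKernel_line hn sig hx hε0 hε hσ).mul_const Complex.I
  have hg : Tendsto (fun t : ℝ => |σ - σ₁| * (C * (1 + |t|) ^ (-2 : ℝ)))
      (atBot ⊔ atTop) (𝓝 0) := by
    have h1 : Tendsto (fun t : ℝ => 1 + |t|) (atBot ⊔ atTop) atTop :=
      tendsto_atTop_add_const_left _ _ (tendsto_abs_atBot_atTop.sup tendsto_abs_atTop_atTop)
    have h2 := (tendsto_rpow_neg_atTop (show (0 : ℝ) < 2 by norm_num)).comp h1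
    have h3 := (h2.const_mul C).const_mul |σ - σ₁|
    simpa using h3
  rw [integral_contour_eq hr.contDiff hconst ?_ (hr.integrable_dampedKernel hn hx sig hε0.le hε)
    hi₂ hg ?_, ← integral_const_mul]
  · simp only [deriv_const, Complex.ofReal_zero, zero_add, mul_comm]
  · intro t u hu
    have e : segmentPoint r (fun _ => σ) t u =
        ((r t + u * (σ - r t) : ℝ) : ℂ) + t * Complex.I := by
      simp [segmentPoint]
    rw [e]
    refine analyticAt_dampedKernel ε sig lam hx fun l m => ?_
    rcases le_total (r t) σ with h | h
    · refine hr.ne_pole ?_ l m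
      nlinarith [mul_nonneg hu.1 (sub_nonneg.mpr h)]
    · refine line_ne_pole hσ ?_ t l m
      nlinarith [mul_nonneg (sub_nonneg.mpr hu.2) (sub_nonneg.mpr h)]
  · have hev : ∀ᶠ t : ℝ in atBot ⊔ atTop, max T₁ T₂ ≤ |t| :=
      (tendsto_abs_atBot_atTop.sup tendsto_abs_atTop_atTop).eventually_ge_atTop _
    filter_upwards [hev] with t ht u hu
    have hrt := (hT₁ t ((le_max_left _ _).trans ht)).1
    rw [norm_mul, hrt, ← Complex.ofReal_sub, Complex.norm_real, Real.norm_eq_abs]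
    refine mul_le_mul_of_nonneg_left ?_ (abs_nonneg _)
    have e : segmentPoint r (fun _ => σ) t u =
        ((σ₁ + u * (σ - σ₁) : ℝ) : ℂ) + t * Complex.I := by
      simp [segmentPoint, hrt]
    have h1 : min σ σ₁ ≤ σ₁ + u * (σ - σ₁) := by
      rcases le_total σ σ₁ with h | h
      · rw [min_eq_left h]
        nlinarith [mul_nonneg (sub_nonneg.mpr hu.2) (sub_nonneg.mpr h)]
      · rw [min_eq_right h]
        nlinarith [mul_nonneg hu.1 (sub_nonneg.mpr h)]
    have h2 : σ₁ + u * (σ - σ₁) ≤ max σ σ₁ := by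
      rcases le_total σ σ₁ with h | h
      · rw [max_eq_right h]
        nlinarith [mul_nonneg hu.1 (sub_nonneg.mpr h)]
      · rw [max_eq_left h]
        nlinarith [mul_nonneg (sub_nonneg.mpr hu.2) (sub_nonneg.mpr h)]
    have e1 : (((σ₁ + u * (σ - σ₁) : ℝ) : ℂ) + t * Complex.I).re = σ₁ + u * (σ - σ₁) := by
      rw [Complex.add_re, Complex.ofReal_re]
      simp
    have e2 : (((σ₁ + u * (σ - σ₁) : ℝ) : ℂ) + t * Complex.I).im = t := by
      rw [Complex.add_im, Complex.ofReal_im]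
      simp
    have := hK (((σ₁ + u * (σ - σ₁) : ℝ) : ℂ) + t * Complex.I) (by rw [e1]; exact h1)
      (by rw [e1]; exact h2) (by rw [e2]; exact (le_max_right _ _).trans ht)
    rw [e2] at this
    rw [e]
    exact this

end

section

/-! ### Analytic dependence of the Mellin-Barnes integral on its parameters -/

/-- A uniformly bounded family `g z` of continuous functions that depends holomorphically on one
complex variable `z`, pointwise, is analytic as a map into the Banach algebra of bounded continuous
functions: it is continuous by Cauchy's estimate, and hence given by Cauchy's integral formula. -/
theorem exists_analyticAt_boundedContinuousFunction {g : ℂ → ℝ → ℂ} {z₀ : ℂ} {ρ K : ℝ}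
    (hρ : 0 < ρ) (hd : ∀ t, ∀ z ∈ Metric.closedBall z₀ ρ, DifferentiableAt ℂ (fun z => g z t) z)
    (hc : ∀ z ∈ Metric.closedBall z₀ ρ, Continuous (g z))
    (hK : ∀ z ∈ Metric.closedBall z₀ ρ, ∀ t, ‖g z t‖ ≤ K) :
    ∃ Φ : ℂ → BoundedContinuousFunction ℝ ℂ, AnalyticAt ℂ Φ z₀ ∧
      ∀ᶠ z in 𝓝 z₀, ∀ t, Φ z t = g z t := by
  classical
  let F : ℂ → BoundedContinuousFunction ℝ ℂ := fun z =>
    if h : z ∈ Metric.closedBall z₀ ρ then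
      BoundedContinuousFunction.ofNormedAddCommGroup (g z) (hc z h) K (hK z h) else 0
  have hF : ∀ z ∈ Metric.closedBall z₀ ρ, ∀ t, F z t = g z t := fun z hz t => by
    simp only [F, dif_pos hz]
    rfl
  have hK0 : 0 ≤ K := (norm_nonneg _).trans (hK z₀ (Metric.mem_closedBall_self hρ.le) 0)
  have hR : 0 < ρ / 2 := by positivity
  have hder : ∀ t, ∀ z ∈ Metric.closedBall z₀ (ρ / 2),
      ‖deriv (fun z => g z t) z‖ ≤ K / (ρ / 2) := by
    intro t z hz
    have hsub : Metric.closedBall z (ρ / 2) ⊆ Metric.closedBall z₀ ρ := by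
      refine Metric.closedBall_subset_closedBall' ?_
      have := Metric.mem_closedBall.mp hz
      linarith
    refine Complex.norm_deriv_le_of_forall_mem_sphere_norm_le hR ?_ fun w hw =>
      hK w (hsub (Metric.sphere_subset_closedBall hw)) t
    refine DifferentiableOn.diffContOnCl fun w hw => ?_
    rw [closure_ball _ hR.ne'] at hw
    exact (hd t w (hsub hw)).differentiableWithinAt
  have hball : Metric.closedBall z₀ (ρ / 2) ⊆ Metric.closedBall z₀ ρ :=
    Metric.closedBall_subset_closedBall (by linarith)
  have hlip : ∀ z ∈ Metric.closedBall z₀ (ρ / 2), ∀ w ∈ Metric.closedBall z₀ (ρ / 2),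
      dist (F z) (F w) ≤ K / (ρ / 2) * dist z w := by
    intro z hz w hw
    refine (BoundedContinuousFunction.dist_le (by positivity)).mpr fun t => ?_
    rw [hF z (hball hz), hF w (hball hw), dist_eq_norm, dist_eq_norm]
    exact (convex_closedBall z₀ (ρ / 2)).norm_image_sub_le_of_norm_deriv_le (𝕜 := ℂ)
      (f := fun z => g z t) (fun y hy => hd t y (hball hy)) (hder t) hw hz
  have hFc : ContinuousOn F (Metric.closedBall z₀ (ρ / 2)) := by
    have : LipschitzOnWith (Real.toNNReal (K / (ρ / 2))) F (Metric.closedBall z₀ (ρ / 2)) :=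
      LipschitzOnWith.of_dist_le_mul fun z hz w hw => by
        rw [Real.coe_toNNReal _ (by positivity)]
        exact hlip z hz w hw
    exact this.continuousOn
  let R : NNReal := ⟨ρ / 2, hR.le⟩
  have hint : CircleIntegrable F z₀ R :=
    (hFc.mono Metric.sphere_subset_closedBall).circleIntegrable hR.le
  refine ⟨_, (hasFPowerSeriesOn_cauchy_integral hint (show 0 < R from hR)).analyticAt, ?_⟩
  filter_upwards [Metric.ball_mem_nhds z₀ hR] with w hw t
  have hne : ∀ z ∈ Metric.sphere z₀ (ρ / 2), z - w ≠ 0 := fun z hz h => by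
    rw [sub_eq_zero.mp h] at hz
    exact (Metric.mem_ball.mp hw).ne (Metric.mem_sphere.mp hz)
  have hint2 : CircleIntegrable (fun z => (z - w)⁻¹ • F z) z₀ R := by
    refine ContinuousOn.circleIntegrable hR.le (ContinuousOn.fun_smul ?_
      (hFc.mono Metric.sphere_subset_closedBall))
    exact ContinuousOn.inv₀ (by fun_prop) hne
  have hcauchy : (2 * Real.pi * Complex.I : ℂ)⁻¹ •
      ∮ z in C(z₀, ρ / 2), (z - w)⁻¹ • g z t = g w t := by
    refine DiffContOnCl.two_pi_i_inv_smul_circleIntegral_sub_inv_smul (f := fun z => g z t) ?_ hw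
    refine DifferentiableOn.diffContOnCl fun y hy => ?_
    rw [closure_ball _ hR.ne'] at hy
    exact (hd t y (hball hy)).differentiableWithinAt
  rw [← hcauchy]
  simp only [BoundedContinuousFunction.coe_smul]
  congr 1
  change BoundedContinuousFunction.evalCLM ℂ t (∮ z in C(z₀, R), (z - w)⁻¹ • F z) = _
  unfold circleIntegral
  rw [← ContinuousLinearMap.intervalIntegral_comp_comm]
  · refine intervalIntegral.integral_congr fun θ _ => ?_
    have hmem : circleMap z₀ (ρ / 2) θ ∈ Metric.closedBall z₀ ρ :=
      hball (Metric.sphere_subset_closedBall (circleMap_mem_sphere z₀ hR.le θ))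
    simp only [map_smul]
    have e : (R : ℝ) = ρ / 2 := rfl
    rw [e]
    congr 2
    exact hF _ hmem t
  · exact hint2.out

variable {n : ℕ} {lam₀ : Fin n → ℂ} {r : ℝ → ℝ}

theorem isOpen_left_of_curve (hr : Continuous r) : IsOpen {z : ℂ | z.re < r z.im} :=
  isOpen_lt Complex.continuous_re (hr.comp Complex.continuous_im)

/-- A contour that is admissible for one `λ` is admissible for all nearby `λ`. -/
theorem IsContour.eventually (hr : IsContour lam₀ r) :
    ∀ᶠ lam in 𝓝 lam₀, IsContour lam r := by
  obtain ⟨σ, hσ, hT⟩ := hr.vertical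
  have h1 : ∀ᶠ lam : Fin n → ℂ in 𝓝 lam₀, σ < 1 / 2 + ((∑ l, lam l).re - 1) / n := by
    have : Continuous fun lam : Fin n → ℂ => 1 / 2 + ((∑ l, lam l).re - 1) / n := by
      have h2 : Continuous fun lam : Fin n → ℂ => (∑ l, lam l).re :=
        Complex.continuous_re.comp (by fun_prop)
      fun_prop
    exact this.continuousAt.eventually_mem (lt_mem_nhds hσ)
  have h2 : ∀ᶠ lam : Fin n → ℂ in 𝓝 lam₀, ∀ l, (lam l).re < r (lam l).im := by
    refine eventually_all.mpr fun l => ?_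
    have h3 : lam₀ l ∈ {z : ℂ | z.re < r z.im} := by simpa using hr.left l 0
    have hc : Continuous fun lam : Fin n → ℂ => lam l := continuous_apply l
    exact (hc.tendsto lam₀).eventually
      ((isOpen_left_of_curve hr.contDiff.continuous).eventually_mem h3)
  filter_upwards [h1, h2] with lam hl1 hl2
  refine ⟨hr.contDiff, ⟨σ, hl1, hT⟩, fun l κ => ?_⟩
  have := hl2 l
  simp only [Complex.sub_re, Complex.natCast_re, Complex.sub_im, Complex.natCast_im, sub_zero]
  linarith [Nat.cast_nonneg (α := ℝ) κ]

/-- Near `z₀`, a gamma factor on the contour, divided by a suitable power of `1 + |t|`, is an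
analytic function of `z` with values in the bounded continuous functions of `t`. -/
theorem exists_analyticAt_gammaSign_div {z₀ : ℂ} {ρ₀ σ T : ℝ} (hr : ContDiff ℝ 1 r)
    (hz₀ : z₀.re < r z₀.im) (hT : ∀ t, T ≤ |t| → r t = σ) (hρ₀ : 0 < ρ₀) (u : ℤˣ) :
    ∃ Φ : ℂ → BoundedContinuousFunction ℝ ℂ, AnalyticAt ℂ Φ z₀ ∧ ∀ᶠ z in 𝓝 z₀, ∀ t : ℝ,
      gammaSign u (r t + t * Complex.I - z) =
        Φ z t * ((1 + |t|) ^ (σ - z₀.re + ρ₀ - 1 / 2) : ℝ) := by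
  have hrc := hr.continuous
  obtain ⟨ρ₁, hρ₁, hball₁⟩ := Metric.nhds_basis_closedBall.mem_iff.mp
    ((isOpen_left_of_curve hrc).mem_nhds hz₀)
  set ρ := min ρ₀ ρ₁ with hρdef
  have hρ : 0 < ρ := lt_min hρ₀ hρ₁
  set B := Metric.closedBall z₀ ρ with hB
  have hpole : ∀ z ∈ B, ∀ t : ℝ, ∀ m : ℕ, (r t : ℂ) + t * Complex.I - z ≠ -m := by
    intro z hz t m h
    have h1 : z.re < r z.im :=
      hball₁ (Metric.closedBall_subset_closedBall (min_le_right _ _) hz)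
    have h2 := congrArg Complex.re h
    have h3 := congrArg Complex.im h
    simp at h2 h3
    have h4 : z.im = t := by linarith
    rw [h4] at h1
    linarith [Nat.cast_nonneg (α := ℝ) m]
  have hbd : ∀ z ∈ B, |z.re - z₀.re| ≤ ρ ∧ |z.im - z₀.im| ≤ ρ := by
    intro z hz
    have h1 : ‖z - z₀‖ ≤ ρ := by simpa [dist_eq_norm] using Metric.mem_closedBall.mp hz
    exact ⟨by simpa using (Complex.abs_re_le_norm (z - z₀)).trans h1,
      by simpa using (Complex.abs_im_le_norm (z - z₀)).trans h1⟩
  set q := σ - z₀.re + ρ₀ - 1 / 2 with hq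
  have hv : ∀ t : ℝ, 0 < (1 + |t|) ^ q := fun t => Real.rpow_pos_of_pos (by positivity) _
  have hvc : Continuous fun t : ℝ => (1 + |t|) ^ q :=
    Continuous.rpow_const (by fun_prop) fun t => Or.inl (by positivity)
  have hvc' : Continuous fun t : ℝ => (((1 + |t|) ^ q : ℝ) : ℂ) := by fun_prop
  have hv' : ∀ t : ℝ, (((1 + |t|) ^ q : ℝ) : ℂ) ≠ 0 := fun t => by exact_mod_cast (hv t).ne'
  let g : ℂ → ℝ → ℂ := fun z t =>
    gammaSign u (r t + t * Complex.I - z) / ((1 + |t|) ^ q : ℝ)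
  have han : ∀ z ∈ B, ∀ t : ℝ, AnalyticAt ℂ (gammaSign u) (r t + t * Complex.I - z) := by
    intro z hz t
    have : gammaSign u = gammaDamped 0 u := by
      funext s
      rw [gammaDamped_zero]
    rw [this]
    exact analyticAt_gammaDamped 0 u (hpole z hz t)
  have hgd : ∀ t, ∀ z ∈ B, DifferentiableAt ℂ (fun z => g z t) z := by
    intro t z hz
    refine DifferentiableAt.div_const ?_ _
    exact (han z hz t).differentiableAt.comp z
      (f := fun z : ℂ => (r t : ℂ) + t * Complex.I - z) (by fun_prop)
  have hgjoint : ContinuousOn (fun p : ℂ × ℝ => g p.1 p.2) (B ×ˢ Set.univ) := by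
    intro p hp
    refine ContinuousAt.continuousWithinAt (ContinuousAt.div ?_ ?_ (hv' p.2))
    · exact (han p.1 hp.1 p.2).continuousAt.comp
        (f := fun p : ℂ × ℝ => (r p.2 : ℂ) + p.2 * Complex.I - p.1) (by fun_prop)
    · exact (hvc'.comp continuous_snd).continuousAt
  obtain ⟨C, hC, T', hT', hG⟩ := exists_gammaMajorant_le (σ - z₀.re - ρ₀) (σ - z₀.re + ρ₀)
    (|z₀.im| + ρ₀)
  obtain ⟨D, hD⟩ := ((isCompact_closedBall z₀ ρ).prod
    (isCompact_Icc (a := -max T T') (b := max T T'))).exists_bound_of_continuousOn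
    (hgjoint.mono (Set.prod_mono_right (Set.subset_univ _)))
  have hgK : ∀ z ∈ B, ∀ t, ‖g z t‖ ≤ max C D := by
    intro z hz t
    rcases le_total |t| (max T T') with ht | ht
    · exact (hD (z, t) ⟨hz, abs_le.mp ht⟩).trans (le_max_right _ _)
    · refine le_trans ?_ (le_max_left _ _)
      obtain ⟨h1, h2⟩ := hbd z hz
      have hρ' : ρ ≤ ρ₀ := min_le_left _ _
      have h1' := abs_le.mp (h1.trans hρ')
      rw [norm_div, Complex.norm_real, Real.norm_of_nonneg (hv t).le, div_le_iff₀ (hv t),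
        ← gammaDamped_zero, hT t ((le_max_left _ _).trans ht)]
      have h3 := norm_gammaDamped_le (ε := 0) (by positivity) u (σ + t * Complex.I - z)
      have h4 := hG (σ + t * Complex.I - z) t (by simp; linarith) (by simp; linarith)
        (by
          have e : (σ + t * Complex.I - z : ℂ).im - t = -z.im := by simp
          rw [e, abs_neg]
          have := abs_sub_abs_le_abs_sub z.im z₀.im
          linarith) ((le_max_right _ _).trans ht)
      simp only [zero_mul, neg_zero, Real.exp_zero, mul_one] at h3
      refine h3.trans (h4.trans (mul_le_mul_of_nonneg_left ?_ hC.le))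
      refine Real.rpow_le_rpow_of_exponent_le (by linarith [abs_nonneg t]) ?_
      simp
      linarith
  obtain ⟨Φ, hΦ, hΦg⟩ := exists_analyticAt_boundedContinuousFunction hρ hgd
    (fun z hz => hgjoint.comp_continuous (f := fun t => (z, t)) (by fun_prop)
      fun t => ⟨hz, trivial⟩) hgK
  refine ⟨Φ, hΦ, hΦg.mono fun z hz t => ?_⟩
  rw [hz t]
  exact (div_mul_cancel₀ _ (hv' t)).symm

/-- Integration against an integrable function, as a functional on the bounded continuous
functions. -/
def integralFunctional (w : ℝ → ℂ) (hw : Integrable w) : BoundedContinuousFunction ℝ ℂ →L[ℂ] ℂ :=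
  LinearMap.mkContinuous
    { toFun := fun g => ∫ t, g t * w t
      map_add' := fun g h => by
        have hi : ∀ g : BoundedContinuousFunction ℝ ℂ, Integrable fun t => g t * w t := fun g =>
          hw.bdd_mul g.continuous.aestronglyMeasurable (Eventually.of_forall g.norm_coe_le_norm)
        simp only [BoundedContinuousFunction.coe_add, Pi.add_apply, add_mul]
        exact integral_add (hi g) (hi h)
      map_smul' := fun c g => by
        simp only [BoundedContinuousFunction.coe_smul, smul_eq_mul, mul_assoc, RingHom.id_apply]
        exact integral_const_mul _ _ }
    (∫ t, ‖w t‖) fun g => by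
      rw [mul_comm, ← integral_const_mul]
      refine norm_integral_le_of_norm_le (hw.norm.const_mul _) (Eventually.of_forall fun t => ?_)
      rw [norm_mul]
      exact mul_le_mul_of_nonneg_right (g.norm_coe_le_norm t) (norm_nonneg _)

/-- With the contour fixed, the Bessel function is analytic in `λ`: in a weighted space of bounded
continuous functions on the contour, the integrand is a product of analytic functions of one
variable `λ_l` each. -/
theorem IsContour.analyticAt_besselJ (hn : 0 < n) (hr : IsContour lam₀ r) (sig : Fin n → ℤˣ)
    {x : ℝ} (hx : 0 < x) : AnalyticAt ℂ (fun lam => besselJ sig lam r x) lam₀ := by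
  obtain ⟨σ, T, p, hp, hT, hexp⟩ := hr.exists_majorant_rpow hn
  have hn' : (0 : ℝ) < n := by exact_mod_cast hn
  -- the loss `n ρ₀` in the exponent keeps the integrand integrable
  set ρ₀ := (p - 1) / (2 * n) with hρ₀
  have hρ₀' : 0 < ρ₀ := div_pos (by linarith) (by positivity)
  choose Φ hΦ hΦg using fun l => exists_analyticAt_gammaSign_div (z₀ := lam₀ l) (σ := σ) (T := T)
    hr.contDiff (by simpa using hr.left l 0) (fun t ht => (hT t ht).1) hρ₀' (sig l)
  let v : ℝ → ℝ := fun t => ∏ l, (1 + |t|) ^ (σ - (lam₀ l).re + ρ₀ - 1 / 2)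
  let w : ℝ → ℂ := fun t => (v t : ℂ) *
    ((x : ℂ) ^ (-(n : ℂ) * (r t + t * Complex.I)) * (deriv r t + Complex.I))
  have hrc := hr.contDiff.continuous
  have hrd : Continuous (deriv r) := hr.contDiff.continuous_deriv le_rfl
  have hx' : (x : ℂ) ≠ 0 := by exact_mod_cast hx.ne'
  have hvc : Continuous v := continuous_finsetProd _ fun l _ =>
    Continuous.rpow_const (by fun_prop) fun t => Or.inl (by positivity)
  have hwc : Continuous w := by
    refine Continuous.mul (by fun_prop) (Continuous.mul ?_ (by fun_prop))
    exact Continuous.const_cpow (by fun_prop) (Or.inl hx')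
  have hveq : ∀ t, v t = (1 + |t|) ^ (-((p + 1) / 2)) := by
    intro t
    simp only [v]
    rw [← Real.rpow_sum_of_pos (by positivity)]
    congr 1
    have e1 : n * ρ₀ = (p - 1) / 2 := by
      rw [hρ₀]
      field_simp
    have e2 : ∑ l, (σ - (lam₀ l).re + ρ₀ - 1 / 2) =
        n * (σ - 1 / 2) - (∑ l, lam₀ l).re + n * ρ₀ := by
      simp only [Complex.re_sum, Finset.sum_sub_distrib, Finset.sum_add_distrib, Finset.sum_const,
        Finset.card_univ, Fintype.card_fin, nsmul_eq_mul]
      ring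
    rw [e2, e1, hexp]
    ring
  have hwi : Integrable w := by
    refine integrable_of_norm_le_one_add_abs_rpow hwc (p := (p + 1) / 2) (T := T)
      (C := x ^ (-(n : ℝ) * σ)) (by linarith) fun t ht => ?_
    obtain ⟨h1, h2⟩ := hT t ht
    simp only [w]
    rw [norm_mul, norm_mul, Complex.norm_cpow_eq_rpow_re_of_pos hx, h1, h2, Complex.norm_real,
      hveq, Real.norm_of_nonneg (by positivity)]
    simp [mul_comm]
  have hprod : AnalyticAt ℂ (fun lam : Fin n → ℂ => ∏ l, Φ l (lam l)) lam₀ := by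
    refine Finset.analyticAt_fun_prod _ fun l _ => ?_
    exact (hΦ l).comp_of_eq (f := fun lam : Fin n → ℂ => lam l)
      ((ContinuousLinearMap.proj (R := ℂ) (φ := fun _ : Fin n => ℂ) l).analyticAt lam₀) rfl
  have hcomp : AnalyticAt ℂ (fun lam : Fin n → ℂ => (2 * Real.pi * Complex.I)⁻¹ *
      integralFunctional w hwi (∏ l, Φ l (lam l))) lam₀ :=
    analyticAt_const.mul (((integralFunctional w hwi).analyticAt _).comp hprod)
  refine hcomp.congr ?_
  have hev : ∀ᶠ lam : Fin n → ℂ in 𝓝 lam₀, ∀ l, ∀ t : ℝ,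
      gammaSign (sig l) (r t + t * Complex.I - lam l) =
        Φ l (lam l) t * ((1 + |t|) ^ (σ - (lam₀ l).re + ρ₀ - 1 / 2) : ℝ) :=
    eventually_all.mpr fun l => (continuous_apply l).continuousAt.eventually (hΦg l)
  filter_upwards [hev] with lam hlam
  rw [besselJ]
  congr 1
  change ∫ t, (∏ l, Φ l (lam l)) t * w t = _
  refine integral_congr_ae (Eventually.of_forall fun t => ?_)
  have e1 : (∏ l, Φ l (lam l)) t = ∏ l, Φ l (lam l) t := by
    change BoundedContinuousFunction.evalCLM ℂ t _ = _
    simp [BoundedContinuousFunction.coe_prod]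
  simp only [mellinBarnesIntegrand, gammaFactor, w, v, e1, hlam, Finset.prod_mul_distrib,
    Complex.ofReal_prod]
  ring

end

section

/-! ### Mellin transforms of exponentials -/

theorem norm_cexp_neg_mul_ofReal (z : ℂ) (t : ℝ) :
    ‖Complex.exp (-(z * t))‖ = Real.exp (-z.re * t) := by
  rw [Complex.norm_exp]
  simp

theorem integrableOn_rpow_mul_exp_neg {q b : ℝ} (hq : 0 < q) (hb : 0 < b) :
    IntegrableOn (fun t : ℝ => t ^ (q - 1) * Real.exp (-b * t)) (Set.Ioi 0) := by
  have := integrableOn_rpow_mul_exp_neg_mul_rpow (s := q - 1) (p := 1) (b := b) (by linarith)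
    one_pos hb
  simpa using this

theorem continuousOn_ofReal_cpow (s : ℂ) :
    ContinuousOn (fun t : ℝ => (t : ℂ) ^ s) (Set.Ioi 0) := fun t ht =>
  (Complex.continuousAt_ofReal_cpow_const t s (Or.inr (ne_of_gt ht))).continuousWithinAt

theorem mellinConvergent_exp_neg_mul {z s : ℂ} (hz : 0 < z.re) (hs : 0 < s.re) :
    MellinConvergent (fun t : ℝ => Complex.exp (-(z * t))) s := by
  have h := integrableOn_rpow_mul_exp_neg hs hz
  refine Integrable.mono' h ?_ ?_
  · refine ContinuousOn.aestronglyMeasurable ?_ measurableSet_Ioi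
    exact (continuousOn_ofReal_cpow _).smul (Continuous.continuousOn (by fun_prop))
  · refine (ae_restrict_mem measurableSet_Ioi).mono fun t ht => ?_
    rw [norm_smul, norm_cexp_neg_mul_ofReal, Complex.norm_cpow_eq_rpow_re_of_pos ht]
    simp

theorem hasDerivAt_mellin_exp_neg_mul {z s : ℂ} (hz : 0 < z.re) (hs : 0 < s.re) :
    HasDerivAt (fun z : ℂ => mellin (fun t : ℝ => Complex.exp (-(z * t))) s)
      (∫ t : ℝ in Set.Ioi 0, (t : ℂ) ^ (s - 1) • (Complex.exp (-(z * t)) * -(t : ℂ))) z := by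
  have hopen : {w : ℂ | z.re / 2 < w.re} ∈ 𝓝 z :=
    (isOpen_lt continuous_const Complex.continuous_re).mem_nhds (show z.re / 2 < z.re by linarith)
  refine (hasDerivAt_integral_of_dominated_loc_of_deriv_le
    (μ := volume.restrict (Set.Ioi 0)) (s := {w : ℂ | z.re / 2 < w.re})
    (F := fun z (t : ℝ) => (t : ℂ) ^ (s - 1) • Complex.exp (-(z * t)))
    (F' := fun z (t : ℝ) => (t : ℂ) ^ (s - 1) • (Complex.exp (-(z * t)) * -(t : ℂ)))
    (bound := fun t => t ^ (s.re + 1 - 1) * Real.exp (-(z.re / 2) * t)) hopen ?_ ?_ ?_ ?_ ?_ ?_).2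
  · refine Eventually.of_forall fun w => ContinuousOn.aestronglyMeasurable ?_ measurableSet_Ioi
    exact (continuousOn_ofReal_cpow _).smul (Continuous.continuousOn (by fun_prop))
  · exact mellinConvergent_exp_neg_mul hz hs
  · refine ContinuousOn.aestronglyMeasurable ?_ measurableSet_Ioi
    exact (continuousOn_ofReal_cpow _).smul (Continuous.continuousOn (by fun_prop))
  · refine (ae_restrict_mem measurableSet_Ioi).mono fun t ht w hw => ?_
    have ht' : 0 < t := ht
    have hw' : z.re / 2 < w.re := hw
    rw [norm_smul, norm_mul, norm_cexp_neg_mul_ofReal, norm_neg, Complex.norm_real,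
      Real.norm_of_nonneg ht'.le, Complex.norm_cpow_eq_rpow_re_of_pos ht']
    have e : t ^ (s.re + 1 - 1) = t ^ (s - 1).re * t := by
      rw [← Real.rpow_add_one ht'.ne']
      simp
    have h1 : Real.exp (-w.re * t) ≤ Real.exp (-(z.re / 2) * t) :=
      Real.exp_le_exp.mpr (by nlinarith)
    rw [e]
    calc t ^ (s - 1).re * (Real.exp (-w.re * t) * t)
        ≤ t ^ (s - 1).re * (Real.exp (-(z.re / 2) * t) * t) := by gcongr
      _ = _ := by ring
  · exact integrableOn_rpow_mul_exp_neg (by linarith) (by linarith)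
  · refine Eventually.of_forall fun t w _ => ?_
    have h1 : HasDerivAt (fun w : ℂ => -(w * t)) (-(t : ℂ)) w := by
      simpa using ((hasDerivAt_id w).mul_const (t : ℂ)).fun_neg
    exact h1.cexp.const_smul ((t : ℂ) ^ (s - 1))

/-- The Mellin transform of `t ↦ exp (-z t)` for complex `z` in the right half plane, by analytic
continuation from `z > 0`. -/
theorem mellin_exp_neg_mul {z s : ℂ} (hz : 0 < z.re) (hs : 0 < s.re) :
    mellin (fun t : ℝ => Complex.exp (-(z * t))) s = Complex.Gamma s * z ^ (-s) := by
  set U : Set ℂ := {z | 0 < z.re} with hU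
  have hUo : IsOpen U := isOpen_lt continuous_const Complex.continuous_re
  have h1 : AnalyticOnNhd ℂ (fun z : ℂ => mellin (fun t : ℝ => Complex.exp (-(z * t))) s) U :=
    DifferentiableOn.analyticOnNhd (fun z hz =>
      (hasDerivAt_mellin_exp_neg_mul hz hs).differentiableAt.differentiableWithinAt) hUo
  have h2 : AnalyticOnNhd ℂ (fun z : ℂ => Complex.Gamma s * z ^ (-s)) U :=
    DifferentiableOn.analyticOnNhd (fun z hz =>
      (DifferentiableAt.const_mul (DifferentiableAt.cpow_const differentiableAt_id
        (Or.inl hz)) _).differentiableWithinAt) hUo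
  have hconn : IsPreconnected U := (convex_halfSpace_re_gt 0).isPreconnected
  have heq : ∀ b : ℝ, 0 < b → mellin (fun t : ℝ => Complex.exp (-((b : ℂ) * t))) s =
      Complex.Gamma s * (b : ℂ) ^ (-s) := by
    intro b hb
    have := Complex.integral_cpow_mul_exp_neg_mul_Ioi hs hb
    rw [mellin]
    simp only [smul_eq_mul]
    rw [this, mul_comm, one_div, Complex.inv_cpow, Complex.cpow_neg]
    rw [Complex.arg_ofReal_of_nonneg hb.le]
    exact Real.pi_pos.ne
  refine h1.eqOn_of_preconnected_of_frequently_eq h2 hconn (z₀ := 1) (by simp [hU]) ?_ hz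
  -- the two sides agree at `1 + 1 / (n + 1)`
  have hseq : Tendsto (fun n : ℕ => ((1 + 1 / ((n : ℝ) + 1) : ℝ) : ℂ)) atTop (𝓝[≠] 1) := by
    refine tendsto_nhdsWithin_iff.mpr ⟨?_, Eventually.of_forall fun n => ?_⟩
    · have h3 := (tendsto_one_div_add_atTop_nhds_zero_nat (𝕜 := ℝ)).const_add 1
      rw [add_zero] at h3
      have := (Complex.continuous_ofReal.tendsto 1).comp h3
      simpa [Function.comp_def] using this
    · have h4 : 0 < 1 / ((n : ℝ) + 1) := by positivity
      rw [Set.mem_compl_singleton_iff, ← Complex.ofReal_one, Ne, Complex.ofReal_inj]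
      linarith
  exact hseq.frequently (Frequently.of_forall fun n => heq _ (by positivity))

theorem mellinConvergent_exp_neg_div {z s : ℂ} (hz : 0 < z.re) (hs : s.re < 0) :
    MellinConvergent (fun t : ℝ => Complex.exp (-(z * (t : ℂ)⁻¹))) s := by
  have h := (MellinConvergent.comp_rpow (f := fun t : ℝ => Complex.exp (-(z * t)))
    (s := s) (a := -1) (by norm_num)).mpr
    (by simpa [div_neg] using mellinConvergent_exp_neg_mul hz (s := -s) (by simpa using hs))
  refine IntegrableOn.congr_fun h (fun t ht => ?_) measurableSet_Ioi
  simp only [Real.rpow_neg_one, Complex.ofReal_inv]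

theorem mellin_exp_neg_div {z s : ℂ} (hz : 0 < z.re) (hs : s.re < 0) :
    mellin (fun t : ℝ => Complex.exp (-(z * (t : ℂ)⁻¹))) s = Complex.Gamma (-s) * z ^ s := by
  have h := mellin_comp_inv (fun t : ℝ => Complex.exp (-(z * t))) s
  simp only [Complex.ofReal_inv] at h
  rw [h, mellin_exp_neg_mul hz (by simpa using hs), neg_neg]

end

section

/-! ### The space `𝒯(ℝ_+)` -/

theorem MemT.contDiffOn_iteratedDeriv {h : ℝ → ℂ} (hh : MemT h) (n : ℕ) :
    ContDiffOn ℝ (⊤ : ℕ∞) (iteratedDeriv n h) (Set.Ioi 0) := by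
  induction n with
  | zero => simpa using hh.1
  | succ n ih =>
    rw [iteratedDeriv_succ]
    exact ih.deriv_of_isOpen isOpen_Ioi (by simp)

theorem MemT.differentiableAt_iteratedDeriv {h : ℝ → ℂ} (hh : MemT h) (n : ℕ) {t : ℝ}
    (ht : 0 < t) : DifferentiableAt ℝ (iteratedDeriv n h) t :=
  ((hh.contDiffOn_iteratedDeriv n).differentiableOn (by simp)).differentiableAt
    (Ioi_mem_nhds ht)

theorem MemT.continuousOn {h : ℝ → ℂ} (hh : MemT h) : ContinuousOn h (Set.Ioi 0) :=
  hh.1.continuousOn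

theorem MemT.exists_bound {h : ℝ → ℂ} (hh : MemT h) :
    ∃ B : ℝ, 0 < B ∧ ∀ t : ℝ, 0 < t → ‖h t‖ ≤ B := by
  obtain ⟨B, hB⟩ := hh.2 0
  exact ⟨max B 1, by positivity, fun t ht => by simpa using Or.inl (hB t ht)⟩

theorem MemT.hasDerivAt {h : ℝ → ℂ} (hh : MemT h) {t : ℝ} (ht : 0 < t) :
    HasDerivAt h (deriv h t) t := by
  simpa using (hh.differentiableAt_iteratedDeriv 0 ht).hasDerivAt

theorem MemT.iteratedDeriv_mul_deriv {h : ℝ → ℂ} (hh : MemT h) (n : ℕ) :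
    ∀ t : ℝ, 0 < t → iteratedDeriv n (fun t : ℝ => (t : ℂ) * deriv h t) t =
      t * iteratedDeriv (n + 1) h t + n * iteratedDeriv n h t := by
  induction n with
  | zero =>
    intro t _
    simp [iteratedDeriv_succ]
  | succ n ih =>
    intro t ht
    rw [iteratedDeriv_succ]
    have hev : iteratedDeriv n (fun t : ℝ => (t : ℂ) * deriv h t) =ᶠ[𝓝 t]
        fun t : ℝ => (t : ℂ) * iteratedDeriv (n + 1) h t + n * iteratedDeriv n h t := by
      filter_upwards [Ioi_mem_nhds ht] with y hy
      exact ih y hy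
    rw [hev.deriv_eq]
    have h1 := (hh.differentiableAt_iteratedDeriv (n + 1) ht).hasDerivAt
    have h2 := (hh.differentiableAt_iteratedDeriv n ht).hasDerivAt
    rw [← iteratedDeriv_succ] at h1 h2
    have h3 : HasDerivAt (fun t : ℝ => (t : ℂ)) 1 t := by
      simpa using (hasDerivAt_id t).ofReal_comp
    rw [((h3.fun_mul h1).fun_add (h2.const_mul (n : ℂ))).deriv]
    push_cast
    ring

theorem MemT.mul_deriv {h : ℝ → ℂ} (hh : MemT h) :
    MemT fun t : ℝ => (t : ℂ) * deriv h t := by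
  refine ⟨ContDiffOn.mul ?_ (hh.1.deriv_of_isOpen isOpen_Ioi (by simp)), fun α => ?_⟩
  · exact Complex.ofRealCLM.contDiff.contDiffOn
  · obtain ⟨B₁, hB₁⟩ := hh.2 (α + 1)
    obtain ⟨B₀, hB₀⟩ := hh.2 α
    refine ⟨B₁ + α * B₀, fun t ht => ?_⟩
    rw [hh.iteratedDeriv_mul_deriv α t ht]
    have e : (t : ℂ) ^ α * (t * iteratedDeriv (α + 1) h t + α * iteratedDeriv α h t) =
        (t : ℂ) ^ (α + 1) * iteratedDeriv (α + 1) h t +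
          α * ((t : ℂ) ^ α * iteratedDeriv α h t) := by ring
    rw [e]
    refine (norm_add_le _ _).trans (add_le_add (hB₁ t ht) ?_)
    rw [norm_mul, Complex.norm_natCast]
    exact mul_le_mul_of_nonneg_left (hB₀ t ht) (Nat.cast_nonneg _)

theorem memT_euler {d : ℕ} {h : Fin d → ℝ → ℂ} (hh : ∀ l, MemT (h l)) (l j : Fin d) :
    MemT (euler l h j) := by
  unfold euler
  rcases eq_or_ne j l with rfl | hj
  · rw [Function.update_self]
    exact (hh j).mul_deriv
  · rw [Function.update_of_ne hj]
    exact hh j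

/-! ### Damped `J`-integrals -/

/-- The complex number `exp (-i ς (π / 2 - ε))` of absolute value one and real part `sin ε`. It
replaces the coefficient `-i ς` of the phase. -/
def dampFactor (ε : ℝ) (u : ℤˣ) : ℂ :=
  Complex.exp (-(Complex.I * sgn u * (Real.pi / 2 - ε)))

/-- The damped version of `-i θ(t; ς)`; its real part is positive on the orthant if `ε` is. -/
def dampedPhase {d : ℕ} (ε : ℝ) (sig : Fin (d + 1) → ℤˣ) (t : Fin d → ℝ) : ℂ :=
  dampFactor ε (sig (Fin.last d)) * ∏ l, (t l : ℂ) +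
    ∑ l : Fin d, dampFactor ε (sig l.castSucc) * (t l : ℂ)⁻¹

/-- The integrand of a `J`-integral with damped phase. -/
def dampedIntegrand {d : ℕ} (ε : ℝ) (ν : Fin d → ℂ) (sig : Fin (d + 1) → ℤˣ) (x : ℝ)
    (s : JSymbol d) (t : Fin d → ℝ) : ℂ :=
  (∏ l, s.2 l (t l)) * (∏ l, (t l : ℂ) ^ (ν l + s.1 l - 1)) *
    Complex.exp (-(x * dampedPhase ε sig t))

/-- The `J`-integral with damped phase. -/
def dampedIntegral {d : ℕ} (ε : ℝ) (ν : Fin d → ℂ) (sig : Fin (d + 1) → ℤˣ) (x : ℝ)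
    (s : JSymbol d) : ℂ :=
  ∫ t in orthant d, dampedIntegrand ε ν sig x s t

theorem sgn_cases (u : ℤˣ) : sgn u = 1 ∨ sgn u = -1 := by
  rcases Int.units_eq_one_or u with rfl | rfl
  · left; simp [sgn]
  · right; simp [sgn]

theorem dampFactor_zero (u : ℤˣ) : dampFactor 0 u = -(Complex.I * sgn u) := by
  have h : Complex.exp (-(Complex.I * (Real.pi / 2))) = -Complex.I := by
    rw [Complex.exp_neg, mul_comm, Complex.exp_pi_div_two_mul_I, Complex.inv_I]
  have h' : Complex.exp (Complex.I * (Real.pi / 2)) = Complex.I := by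
    rw [mul_comm, Complex.exp_pi_div_two_mul_I]
  unfold dampFactor
  rcases sgn_cases u with hu | hu <;> rw [hu]
  · simp [h]
  · simp [h']

theorem dampFactor_ne_zero (ε : ℝ) (u : ℤˣ) : dampFactor ε u ≠ 0 := Complex.exp_ne_zero _

theorem dampFactor_re (ε : ℝ) (u : ℤˣ) : (dampFactor ε u).re = Real.sin ε := by
  have e : ∀ c : ℝ, Complex.exp (-(Complex.I * c)) = Complex.exp ((-c : ℝ) * Complex.I) := by
    intro c
    congr 1
    push_cast
    ring
  have e1 : (Real.pi / 2 - ε : ℂ) = ((Real.pi / 2 - ε : ℝ) : ℂ) := by push_cast; ring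
  unfold dampFactor
  rcases sgn_cases u with hu | hu <;> rw [hu, e1]
  · rw [mul_one, e, Complex.exp_ofReal_mul_I_re, Real.cos_neg, Real.cos_pi_div_two_sub]
  · have : -(Complex.I * -1 * ((Real.pi / 2 - ε : ℝ) : ℂ)) =
        -(Complex.I * ((-(Real.pi / 2 - ε) : ℝ) : ℂ)) := by
      push_cast
      ring
    rw [this, e, Complex.exp_ofReal_mul_I_re, Real.cos_neg, Real.cos_neg,
      Real.cos_pi_div_two_sub]

theorem continuous_dampFactor (u : ℤˣ) : Continuous fun ε => dampFactor ε u := by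
  unfold dampFactor
  fun_prop

variable {d : ℕ}

theorem dampedIntegrand_zero (ν : Fin d → ℂ) (sig : Fin (d + 1) → ℤˣ) (x : ℝ) (s : JSymbol d) :
    dampedIntegrand 0 ν sig x s = jIntegrand ν sig x s := by
  funext t
  unfold dampedIntegrand jIntegrand dampedPhase phase
  congr 2
  simp only [dampFactor_zero, mul_add, neg_add, Finset.mul_sum, ← Finset.sum_neg_distrib]
  congr 1
  · ring
  · exact Finset.sum_congr rfl fun l _ => by ring

theorem dampedIntegral_zero (ν : Fin d → ℂ) (sig : Fin (d + 1) → ℤˣ) (x : ℝ) (s : JSymbol d) :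
    dampedIntegral 0 ν sig x s = jIntegral ν sig x s := by
  rw [dampedIntegral, dampedIntegrand_zero, jIntegral]

theorem orthant_eq_pi (d : ℕ) : orthant d = Set.univ.pi fun _ => Set.Ioi 0 := by
  ext t
  simp [orthant]

theorem isOpen_orthant (d : ℕ) : IsOpen (orthant d) := by
  rw [orthant_eq_pi]
  exact isOpen_set_pi Set.finite_univ fun _ _ => isOpen_Ioi

theorem measurableSet_orthant (d : ℕ) : MeasurableSet (orthant d) :=
  (isOpen_orthant d).measurableSet

theorem restrict_orthant (d : ℕ) : (volume : Measure (Fin d → ℝ)).restrict (orthant d) =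
    Measure.pi fun _ => volume.restrict (Set.Ioi 0) := by
  rw [orthant_eq_pi, volume_pi, Measure.restrict_pi_pi]

theorem integrableOn_orthant_prod {𝕜 : Type*} [RCLike 𝕜] {g : Fin d → ℝ → 𝕜}
    (hg : ∀ l, IntegrableOn (g l) (Set.Ioi 0)) :
    IntegrableOn (fun t : Fin d → ℝ => ∏ l, g l (t l)) (orthant d) := by
  rw [IntegrableOn, restrict_orthant]
  exact Integrable.fintype_prod hg

theorem dampedPhase_re (ε : ℝ) (sig : Fin (d + 1) → ℤˣ) (t : Fin d → ℝ) :
    (dampedPhase ε sig t).re = Real.sin ε * (∏ l, t l + ∑ l, (t l)⁻¹) := by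
  have h1 : ∀ (z : ℂ) (y : ℝ), (z * (y : ℂ)).re = z.re * y := fun z y => by simp
  unfold dampedPhase
  rw [Complex.add_re, Complex.re_sum, ← Complex.ofReal_prod, h1, dampFactor_re, mul_add,
    Finset.mul_sum]
  congr 1
  refine Finset.sum_congr rfl fun l _ => ?_
  rw [← Complex.ofReal_inv, h1, dampFactor_re]

theorem norm_exp_dampedPhase (ε : ℝ) (sig : Fin (d + 1) → ℤˣ) (x : ℝ) (t : Fin d → ℝ) :
    ‖Complex.exp (-(x * dampedPhase ε sig t))‖ =
      Real.exp (-(x * Real.sin ε * (∏ l, t l + ∑ l, (t l)⁻¹))) := by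
  rw [Complex.norm_exp, Complex.neg_re, Complex.re_ofReal_mul, dampedPhase_re, mul_assoc]

theorem norm_exp_dampedPhase_le_one {ε : ℝ} (hε0 : 0 ≤ ε) (hε : ε ≤ Real.pi / 2)
    (sig : Fin (d + 1) → ℤˣ) {x : ℝ} (hx : 0 < x) {t : Fin d → ℝ} (ht : t ∈ orthant d) :
    ‖Complex.exp (-(x * dampedPhase ε sig t))‖ ≤ 1 := by
  rw [norm_exp_dampedPhase, Real.exp_le_one_iff, neg_nonpos]
  have h1 : 0 ≤ Real.sin ε := Real.sin_nonneg_of_nonneg_of_le_pi hε0 (by linarith [Real.pi_pos])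
  have h2 : 0 ≤ ∏ l, t l := Finset.prod_nonneg fun l _ => (ht l).le
  have h3 : 0 ≤ ∑ l, (t l)⁻¹ := Finset.sum_nonneg fun l _ => inv_nonneg.mpr (ht l).le
  positivity

theorem continuousOn_exp_dampedPhase (ε : ℝ) (sig : Fin (d + 1) → ℤˣ) (x : ℝ) :
    ContinuousOn (fun t : Fin d → ℝ => Complex.exp (-(x * dampedPhase ε sig t))) (orthant d) := by
  unfold dampedPhase
  refine Complex.continuous_exp.comp_continuousOn (ContinuousOn.neg (continuousOn_const.mul
    (ContinuousOn.add (Continuous.continuousOn (by fun_prop)) ?_)))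
  refine continuousOn_finsetSum _ fun l _ => continuousOn_const.mul (ContinuousOn.inv₀ ?_ ?_)
  · exact Continuous.continuousOn (by fun_prop)
  · intro t ht h
    exact (ht l).ne' (by exact_mod_cast h)

theorem continuousOn_dampedIntegrand (ε : ℝ) (ν : Fin d → ℂ) (sig : Fin (d + 1) → ℤˣ) (x : ℝ)
    {s : JSymbol d} (hs : ∀ l, MemT (s.2 l)) :
    ContinuousOn (dampedIntegrand ε ν sig x s) (orthant d) := by
  have hproj : ∀ l : Fin d, ContinuousOn (fun t : Fin d → ℝ => t l) (orthant d) := fun l =>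
    (continuous_apply l).continuousOn
  refine ContinuousOn.mul (ContinuousOn.mul ?_ ?_) (continuousOn_exp_dampedPhase ε sig x)
  · exact continuousOn_finsetProd _ fun l _ => (hs l).continuousOn.comp (hproj l) fun t ht => ht l
  · exact continuousOn_finsetProd _ fun l _ =>
      (continuousOn_ofReal_cpow _).comp (hproj l) fun t ht => ht l

/-- If the amplitude is absolutely integrable against the power function, then so is the integrand
of the `J`-integral, with or without damping, and the damped integrals tend to the undamped one. -/
theorem integrableOn_dampedIntegrand_of_factors {ε : ℝ} (hε0 : 0 ≤ ε) (hε : ε ≤ Real.pi / 2)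
    (ν : Fin d → ℂ) (sig : Fin (d + 1) → ℤˣ) {x : ℝ} (hx : 0 < x) {s : JSymbol d}
    (hs : ∀ l, MemT (s.2 l))
    (hi : ∀ l, IntegrableOn (fun t : ℝ => s.2 l t * (t : ℂ) ^ (ν l + s.1 l - 1)) (Set.Ioi 0)) :
    IntegrableOn (dampedIntegrand ε ν sig x s) (orthant d) := by
  refine Integrable.mono (integrableOn_orthant_prod hi)
    ((continuousOn_dampedIntegrand ε ν sig x hs).aestronglyMeasurable (measurableSet_orthant d)) ?_
  refine (ae_restrict_mem (measurableSet_orthant d)).mono fun t ht => ?_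
  rw [dampedIntegrand, ← Finset.prod_mul_distrib, norm_mul]
  exact mul_le_of_le_one_right (norm_nonneg _) (norm_exp_dampedPhase_le_one hε0 hε sig hx ht)

theorem tendsto_dampedIntegral (ν : Fin d → ℂ) (sig : Fin (d + 1) → ℤˣ) {x : ℝ} (hx : 0 < x)
    {s : JSymbol d} (hs : ∀ l, MemT (s.2 l))
    (hi : ∀ l, IntegrableOn (fun t : ℝ => s.2 l t * (t : ℂ) ^ (ν l + s.1 l - 1)) (Set.Ioi 0)) :
    Tendsto (fun ε => dampedIntegral ε ν sig x s) (𝓝[>] 0) (𝓝 (jIntegral ν sig x s)) := by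
  rw [← dampedIntegral_zero]
  refine tendsto_integral_filter_of_dominated_convergence
    (fun t => ‖∏ l, (s.2 l (t l) * (t l : ℂ) ^ (ν l + s.1 l - 1))‖) ?_ ?_
    (integrableOn_orthant_prod hi).norm ?_
  · exact Eventually.of_forall fun ε =>
      (continuousOn_dampedIntegrand ε ν sig x hs).aestronglyMeasurable (measurableSet_orthant d)
  · filter_upwards [Ioc_mem_nhdsGT (show (0 : ℝ) < Real.pi / 2 by positivity)] with ε hε
    refine (ae_restrict_mem (measurableSet_orthant d)).mono fun t ht => ?_
    rw [dampedIntegrand, ← Finset.prod_mul_distrib, norm_mul]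
    exact mul_le_of_le_one_right (norm_nonneg _)
      (norm_exp_dampedPhase_le_one hε.1.le hε.2 sig hx ht)
  · refine Eventually.of_forall fun t => ?_
    have : Continuous fun ε => dampedIntegrand ε ν sig x s t := by
      have := continuous_dampFactor
      unfold dampedIntegrand dampedPhase
      fun_prop
    exact (this.tendsto 0).mono_left nhdsWithin_le_nhds

theorem exp_neg_mul_le_div_pow {c y : ℝ} (hc : 0 < c) (hy : 0 < y) (N : ℕ) :
    Real.exp (-(c * y)) ≤ N.factorial / (c ^ N * y ^ N) := by
  have h := Real.pow_div_factorial_le_exp (c * y) (by positivity) N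
  rw [Real.exp_neg, inv_le_comm₀ (Real.exp_pos _) (by positivity), inv_div, ← mul_pow]
  exact h

/-- With damping, all the `J`-integrals converge absolutely: `exp (-x z_l / t_l)` makes up for any
power of `t_l` at zero and `exp (-x z t_1 ⋯ t_d)` for any power at infinity. -/
theorem integrableOn_dampedIntegrand {ε : ℝ} (hε0 : 0 < ε) (hε : ε ≤ Real.pi / 2)
    (ν : Fin d → ℂ) (sig : Fin (d + 1) → ℤˣ) {x : ℝ} (hx : 0 < x) {s : JSymbol d}
    (hs : ∀ l, MemT (s.2 l)) :
    IntegrableOn (dampedIntegrand ε ν sig x s) (orthant d) := by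
  have hsin : 0 < Real.sin ε := Real.sin_pos_of_pos_of_lt_pi hε0 (by linarith [Real.pi_pos])
  set δ := x * Real.sin ε with hδdef
  have hδ : 0 < δ := by positivity
  choose B hB0 hB using fun l => (hs l).exists_bound
  -- `exp (-δ t_1 ⋯ t_d)` provides any negative power of all the variables at infinity
  obtain ⟨N, hN⟩ := exists_nat_gt (∑ l, |(ν l + s.1 l).re|)
  have hN' : ∀ l, (ν l + s.1 l).re - N < 0 := by
    intro l
    have h1 := Finset.single_le_sum (f := fun l => |(ν l + s.1 l).re|)
      (fun l _ => abs_nonneg _) (Finset.mem_univ l)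
    have h2 := le_abs_self (ν l + s.1 l).re
    linarith
  have h1d : ∀ l, IntegrableOn (fun t : ℝ =>
      B l * (t ^ ((ν l + s.1 l).re - N - 1) * Real.exp (-(δ * t⁻¹)))) (Set.Ioi 0) := by
    intro l
    have h := (mellinConvergent_exp_neg_div (z := (δ : ℂ)) (s := (((ν l + s.1 l).re - N : ℝ) : ℂ))
      (by simpa using hδ) (by simpa using hN' l)).norm
    refine Integrable.const_mul (Integrable.congr h ?_) _
    refine (ae_restrict_mem measurableSet_Ioi).mono fun t ht => ?_
    beta_reduce
    rw [norm_smul, Complex.norm_cpow_eq_rpow_re_of_pos ht, Complex.norm_exp, ← Complex.ofReal_inv,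
      ← Complex.ofReal_mul, ← Complex.ofReal_neg, Complex.ofReal_re, ← Complex.ofReal_one,
      ← Complex.ofReal_sub, Complex.ofReal_re]
  refine ((integrableOn_orthant_prod h1d).const_mul (N.factorial / δ ^ N)).mono'
    ((continuousOn_dampedIntegrand ε ν sig x hs).aestronglyMeasurable (measurableSet_orthant d)) ?_
  refine (ae_restrict_mem (measurableSet_orthant d)).mono fun t ht => ?_
  have hP : 0 < ∏ l, t l := Finset.prod_pos fun l _ => ht l
  rw [dampedIntegrand, ← Finset.prod_mul_distrib, norm_mul, norm_exp_dampedPhase, mul_add, neg_add,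
    Real.exp_add, norm_prod]
  have e1 : Real.exp (-(δ * ∑ l, (t l)⁻¹)) = ∏ l, Real.exp (-(δ * (t l)⁻¹)) := by
    rw [Finset.mul_sum, ← Finset.sum_neg_distrib, Real.exp_sum]
  have e2 : ∏ l, ‖s.2 l (t l) * (t l : ℂ) ^ (ν l + s.1 l - 1)‖ ≤
      ∏ l, (B l * (t l ^ ((ν l + s.1 l).re - 1))) := by
    refine Finset.prod_le_prod (fun _ _ => norm_nonneg _) fun l _ => ?_
    rw [norm_mul, Complex.norm_cpow_eq_rpow_re_of_pos (ht l), Complex.sub_re, Complex.one_re]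
    exact mul_le_mul_of_nonneg_right (hB l _ (ht l)) (Real.rpow_nonneg (ht l).le _)
  have e3 := exp_neg_mul_le_div_pow hδ hP N
  rw [← hδdef, e1]
  calc (∏ l, ‖s.2 l (t l) * (t l : ℂ) ^ (ν l + s.1 l - 1)‖) *
        (Real.exp (-(δ * ∏ l, t l)) * ∏ l, Real.exp (-(δ * (t l)⁻¹)))
      ≤ (∏ l, (B l * (t l ^ ((ν l + s.1 l).re - 1)))) *
        (N.factorial / (δ ^ N * (∏ l, t l) ^ N) * ∏ l, Real.exp (-(δ * (t l)⁻¹))) := by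
        refine mul_le_mul e2 (mul_le_mul_of_nonneg_right e3
          (Finset.prod_nonneg fun _ _ => (Real.exp_pos _).le)) ?_ ?_
        · exact mul_nonneg (Real.exp_pos _).le (Finset.prod_nonneg fun _ _ => (Real.exp_pos _).le)
        · exact Finset.prod_nonneg fun l _ =>
            mul_nonneg (hB0 l).le (Real.rpow_nonneg (ht l).le _)
    _ = N.factorial / δ ^ N *
        ∏ l, (B l * (t l ^ ((ν l + s.1 l).re - N - 1) * Real.exp (-(δ * (t l)⁻¹)))) := by
        have e4 : ∀ l, t l ^ ((ν l + s.1 l).re - N - 1) =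
            t l ^ ((ν l + s.1 l).re - 1) / t l ^ N := by
          intro l
          rw [← Real.rpow_natCast, ← Real.rpow_sub (ht l)]
          congr 1
          ring
        simp only [e4, Finset.prod_mul_distrib, Finset.prod_div_distrib, Finset.prod_pow]
        field_simp

end

section

/-! ### Partial integration of damped integrals -/

/-- The damped integrand as a function of one of the variables, extended by zero. -/
def axisFun (h : ℝ → ℂ) (w a b : ℂ) (u : ℝ) : ℂ :=
  if 0 < u then h u * (u : ℂ) ^ w * Complex.exp (-(a * u + b * (u : ℂ)⁻¹)) else 0

/-- The extension by zero is differentiable at zero since `exp (-b / u)` vanishes there to infinite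
order. -/
theorem hasDerivAt_axisFun {h : ℝ → ℂ} (hh : MemT h) (w : ℂ) {a b : ℂ} (ha : 0 ≤ a.re)
    (hb : 0 < b.re) (u : ℝ) :
    HasDerivAt (axisFun h w a b) (if 0 < u then
      (w * (h u * (u : ℂ) ^ (w - 1)) + u * deriv h u * (u : ℂ) ^ (w - 1) - a * (h u * (u : ℂ) ^ w) +
        b * (h u * (u : ℂ) ^ (w - 1 - 1))) * Complex.exp (-(a * u + b * (u : ℂ)⁻¹)) else 0) u := by
  rcases lt_trichotomy u 0 with hu | rfl | hu
  · rw [if_neg hu.not_gt]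
    refine (hasDerivAt_const u (0 : ℂ)).congr_of_eventuallyEq ?_
    filter_upwards [Iio_mem_nhds hu] with y hy
    exact if_neg (not_lt.mpr (le_of_lt hy))
  · rw [if_neg (lt_irrefl _)]
    obtain ⟨B, hB0, hB⟩ := hh.exists_bound
    obtain ⟨N, hN⟩ := exists_nat_ge (2 - w.re)
    have hO : axisFun h w a b =O[𝓝 0] fun y : ℝ => ‖y - 0‖ ^ 2 := by
      refine Asymptotics.IsBigO.of_bound (B * (N.factorial / b.re ^ N)) ?_
      filter_upwards [Iio_mem_nhds (zero_lt_one (α := ℝ))] with y hy1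
      unfold axisFun
      split_ifs with hy
      · have hy1' : y ≤ 1 := le_of_lt hy1
        have hexp : ‖Complex.exp (-(a * y + b * (y : ℂ)⁻¹))‖ ≤
            N.factorial / (b.re ^ N * (y⁻¹) ^ N) := by
          refine le_trans ?_ (exp_neg_mul_le_div_pow hb (inv_pos.mpr hy) N)
          rw [Complex.norm_exp, Real.exp_le_exp, ← Complex.ofReal_inv, Complex.neg_re,
            Complex.add_re, Complex.re_mul_ofReal, Complex.re_mul_ofReal]
          have := mul_nonneg ha hy.le
          linarith
        have hpow : y ^ w.re * y ^ N ≤ y ^ 2 := by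
          rw [← Real.rpow_natCast, ← Real.rpow_add hy, ← Real.rpow_natCast y 2]
          refine Real.rpow_le_rpow_of_exponent_ge hy hy1' ?_
          push_cast
          linarith
        rw [norm_mul, norm_mul, Complex.norm_cpow_eq_rpow_re_of_pos hy, sub_zero, norm_pow,
          norm_norm, Real.norm_of_nonneg hy.le]
        calc ‖h y‖ * y ^ w.re * ‖Complex.exp (-(a * y + b * (y : ℂ)⁻¹))‖
            ≤ B * y ^ w.re * (N.factorial / (b.re ^ N * (y⁻¹) ^ N)) := by
              refine mul_le_mul (mul_le_mul_of_nonneg_right (hB y hy) (by positivity)) hexp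
                (norm_nonneg _) (by positivity)
          _ = B * (N.factorial / b.re ^ N) * (y ^ w.re * y ^ N) := by
              rw [inv_pow]
              field_simp
          _ ≤ _ := mul_le_mul_of_nonneg_left hpow (by positivity)
      · rw [norm_zero]
        positivity
    have := hO.hasFDerivAt (𝕜 := ℝ) one_lt_two
    exact hasFDerivAt_iff_hasDerivAt.mp this |>.congr_deriv (by simp)
  · rw [if_pos hu]
    have hu0 : (u : ℂ) ≠ 0 := by exact_mod_cast hu.ne'
    have h1 : HasDerivAt (fun y : ℝ => (y : ℂ) ^ w) (w * (u : ℂ) ^ (w - 1)) u := by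
      have := (hasDerivAt_id (u : ℂ)).cpow_const (c := w) (Complex.ofReal_mem_slitPlane.mpr hu)
      simpa using this.comp_ofReal
    have h2 : HasDerivAt (fun y : ℝ => Complex.exp (-(a * y + b * (y : ℂ)⁻¹)))
        (Complex.exp (-(a * u + b * (u : ℂ)⁻¹)) * -(a - b * ((u : ℂ) ^ 2)⁻¹)) u := by
      have h3 : HasDerivAt (fun z : ℂ => -(a * z + b * z⁻¹)) (-(a - b * ((u : ℂ) ^ 2)⁻¹)) u := by
        have := (((hasDerivAt_id (u : ℂ)).const_mul a).fun_add
          ((hasDerivAt_inv hu0).const_mul b)).fun_neg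
        convert! this using 1
        simp
        ring
      exact h3.comp_ofReal.cexp
    have h4 := ((hh.hasDerivAt hu).fun_mul h1).fun_mul h2
    refine (h4.congr_of_eventuallyEq ?_).congr_deriv ?_
    · filter_upwards [Ioi_mem_nhds hu] with y hy
      exact if_pos hy
    · have e1 : (u : ℂ) ^ w = u * (u : ℂ) ^ (w - 1) := by
        rw [Complex.cpow_sub _ _ hu0, Complex.cpow_one]
        field_simp
      have e2 : (u : ℂ) ^ (w - 1) = u * (u : ℂ) ^ (w - 1 - 1) := by
        rw [Complex.cpow_sub (w - 1) _ hu0, Complex.cpow_one]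
        field_simp
      rw [e1, e2]
      field_simp
      ring

variable {d : ℕ}

/-- The part of the damped integrand that does not depend on `t_l`. -/
def restFactor (ε : ℝ) (ν : Fin d → ℂ) (sig : Fin (d + 1) → ℤˣ) (x : ℝ) (s : JSymbol d) (l : Fin d)
    (t : Fin d → ℝ) : ℂ :=
  (∏ j ∈ Finset.univ.erase l, s.2 j (t j)) *
    (∏ j ∈ Finset.univ.erase l, (t j : ℂ) ^ (ν j + s.1 j - 1)) *
    Complex.exp (-(x * ∑ j ∈ Finset.univ.erase l, dampFactor ε (sig j.castSucc) * (t j : ℂ)⁻¹))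

theorem dampedIntegrand_split (ε : ℝ) (ν : Fin d → ℂ) (sig : Fin (d + 1) → ℤˣ) (x : ℝ)
    (s : JSymbol d) (l : Fin d) (t : Fin d → ℝ) :
    dampedIntegrand ε ν sig x s t = restFactor ε ν sig x s l t *
      (s.2 l (t l) * (t l : ℂ) ^ (ν l + s.1 l - 1) *
        Complex.exp (-(x * dampFactor ε (sig (Fin.last d)) *
          (∏ j ∈ Finset.univ.erase l, (t j : ℂ)) * t l +
          x * dampFactor ε (sig l.castSucc) * (t l : ℂ)⁻¹))) := by
  have e1 : -(x * dampedPhase ε sig t) =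
      -(x * ∑ j ∈ Finset.univ.erase l, dampFactor ε (sig j.castSucc) * (t j : ℂ)⁻¹) +
      -(x * dampFactor ε (sig (Fin.last d)) * (∏ j ∈ Finset.univ.erase l, (t j : ℂ)) * t l +
          x * dampFactor ε (sig l.castSucc) * (t l : ℂ)⁻¹) := by
    rw [dampedPhase, ← Finset.mul_prod_erase Finset.univ (fun j => (t j : ℂ)) (Finset.mem_univ l),
      ← Finset.add_sum_erase Finset.univ
        (fun j : Fin d => dampFactor ε (sig j.castSucc) * (t j : ℂ)⁻¹) (Finset.mem_univ l)]
    ring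
  rw [dampedIntegrand, e1, Complex.exp_add, restFactor,
    ← Finset.mul_prod_erase Finset.univ (fun j => s.2 j (t j)) (Finset.mem_univ l),
    ← Finset.mul_prod_erase Finset.univ (fun j => (t j : ℂ) ^ (ν j + s.1 j - 1))
      (Finset.mem_univ l)]
  ring

theorem restFactor_congr (ε : ℝ) (ν : Fin d → ℂ) (sig : Fin (d + 1) → ℤˣ) (x : ℝ)
    {s s' : JSymbol d} {l : Fin d} {t t' : Fin d → ℝ} (ht : ∀ j ≠ l, t j = t' j)
    (hk : ∀ j ≠ l, s.1 j = s'.1 j) (hh : ∀ j ≠ l, s.2 j = s'.2 j) :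
    restFactor ε ν sig x s l t = restFactor ε ν sig x s' l t' := by
  unfold restFactor
  congr 1
  · congr 1
    · exact Finset.prod_congr rfl fun j hj => by
        rw [hh j (Finset.ne_of_mem_erase hj), ht j (Finset.ne_of_mem_erase hj)]
    · exact Finset.prod_congr rfl fun j hj => by
        rw [hk j (Finset.ne_of_mem_erase hj), ht j (Finset.ne_of_mem_erase hj)]
  · congr 3
    exact Finset.sum_congr rfl fun j hj => by rw [ht j (Finset.ne_of_mem_erase hj)]

theorem restFactor_add_one (ε : ℝ) (ν : Fin d → ℂ) (sig : Fin (d + 1) → ℤˣ) (x : ℝ)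
    (k : Fin d → ℤ) (h : Fin d → ℝ → ℂ) (l : Fin d) {t : Fin d → ℝ} (ht : ∀ j ≠ l, 0 < t j) :
    restFactor ε ν sig x (k + 1, h) l t =
      restFactor ε ν sig x (k, h) l t * ∏ j ∈ Finset.univ.erase l, (t j : ℂ) := by
  have e : ∏ j ∈ Finset.univ.erase l, (t j : ℂ) ^ (ν j + ((k + 1) j : ℤ) - 1) =
      (∏ j ∈ Finset.univ.erase l, (t j : ℂ) ^ (ν j + k j - 1)) *
        ∏ j ∈ Finset.univ.erase l, (t j : ℂ) := by
    rw [← Finset.prod_mul_distrib]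
    refine Finset.prod_congr rfl fun j hj => ?_
    have h0 : (t j : ℂ) ≠ 0 := by exact_mod_cast (ht j (Finset.ne_of_mem_erase hj)).ne'
    rw [Pi.add_apply, Pi.one_apply, Int.cast_add, Int.cast_one]
    nth_rw 3 [← Complex.cpow_one (t j : ℂ)]
    rw [← Complex.cpow_add _ _ h0]
    congr 1
    ring
  unfold restFactor
  simp only
  rw [e]
  ring

/-- The integral over the orthant of the `t_l`-derivative of `t_l` times a damped integrand
vanishes. Both kinds of partial integration are instances of this identity. -/
theorem dampedIntegral_parts {ε : ℝ} (hε0 : 0 < ε) (hε : ε ≤ Real.pi / 2) (ν : Fin d → ℂ)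
    (sig : Fin (d + 1) → ℤˣ) {x : ℝ} (hx : 0 < x) (k : Fin d → ℤ) {h : Fin d → ℝ → ℂ}
    (hh : ∀ l, MemT (h l)) (l : Fin d) :
    (ν l + k l) * dampedIntegral ε ν sig x (k, h) + dampedIntegral ε ν sig x (k, euler l h) -
      x * dampFactor ε (sig (Fin.last d)) * dampedIntegral ε ν sig x (k + 1, h) +
      x * dampFactor ε (sig l.castSucc) * dampedIntegral ε ν sig x (k - Pi.single l 1, h) = 0 := by
  have hsin : 0 < Real.sin ε := Real.sin_pos_of_pos_of_lt_pi hε0 (by linarith [Real.pi_pos])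
  have hint : ∀ k' h', (∀ l, MemT (h' l)) →
      IntegrableOn (dampedIntegrand ε ν sig x (k', h')) (orthant d) := fun k' h' hh' =>
    integrableOn_dampedIntegrand hε0 hε ν sig hx hh'
  have heul : ∀ j, MemT (euler l h j) := memT_euler hh l
  let G : (Fin d → ℝ) → ℂ := fun t =>
    (ν l + k l) * dampedIntegrand ε ν sig x (k, h) t + dampedIntegrand ε ν sig x (k, euler l h) t -
      x * dampFactor ε (sig (Fin.last d)) * dampedIntegrand ε ν sig x (k + 1, h) t +
      x * dampFactor ε (sig l.castSucc) * dampedIntegrand ε ν sig x (k - Pi.single l 1, h) t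
  have i1 := (hint k h hh).const_mul (ν l + k l)
  have i2 := hint k _ heul
  have i3 := (hint (k + 1) h hh).const_mul (x * dampFactor ε (sig (Fin.last d)))
  have i4 := (hint (k - Pi.single l 1) h hh).const_mul (x * dampFactor ε (sig l.castSucc))
  have i12 : IntegrableOn (fun t => (ν l + k l) * dampedIntegrand ε ν sig x (k, h) t +
      dampedIntegrand ε ν sig x (k, euler l h) t) (orthant d) := i1.add i2
  have i123 : IntegrableOn (fun t => (ν l + k l) * dampedIntegrand ε ν sig x (k, h) t +
      dampedIntegrand ε ν sig x (k, euler l h) t -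
      x * dampFactor ε (sig (Fin.last d)) * dampedIntegrand ε ν sig x (k + 1, h) t) (orthant d) :=
    i12.sub i3
  have hG : IntegrableOn G (orthant d) := i123.add i4
  let F : (Fin d → ℝ) → ℂ :=
    (orthant d).indicator (dampedIntegrand ε ν sig x (k + Pi.single l 1, h))
  have hF : Integrable F :=
    (integrable_indicator_iff (measurableSet_orthant d)).mpr (hint _ _ hh)
  have hG' : Integrable ((orthant d).indicator G) :=
    (integrable_indicator_iff (measurableSet_orthant d)).mpr hG
  have hderiv : ∀ t, HasLineDerivAt ℝ F ((orthant d).indicator G t) t (Pi.single l 1) := by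
    intro t
    unfold HasLineDerivAt
    have hcoord : ∀ (y : ℝ) (j : Fin d), j ≠ l → (t + y • (Pi.single l 1 : Fin d → ℝ)) j = t j := by
      intro y j hj
      simp [hj]
    have hcoord' : ∀ y : ℝ, (t + y • (Pi.single l 1 : Fin d → ℝ)) l = t l + y := by
      intro y
      simp
    by_cases ht : ∀ j ≠ l, 0 < t j
    · set P : ℂ := ∏ j ∈ Finset.univ.erase l, (t j : ℂ) with hP
      set a : ℂ := x * dampFactor ε (sig (Fin.last d)) * P with ha
      set b : ℂ := x * dampFactor ε (sig l.castSucc) with hb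
      set w : ℂ := ν l + k l with hw
      have ha0 : 0 ≤ a.re := by
        have hPp : 0 ≤ ∏ j ∈ Finset.univ.erase l, t j :=
          Finset.prod_nonneg fun j hj => (ht j (Finset.ne_of_mem_erase hj)).le
        rw [ha, hP, ← Complex.ofReal_prod, Complex.re_mul_ofReal, Complex.re_ofReal_mul,
          dampFactor_re]
        positivity
      have hb0 : 0 < b.re := by
        rw [hb, Complex.re_ofReal_mul, dampFactor_re]
        positivity
      have hmem : ∀ y : ℝ, t + y • (Pi.single l 1 : Fin d → ℝ) ∈ orthant d ↔ 0 < t l + y := by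
        intro y
        constructor
        · intro h1
          have := h1 l
          rwa [hcoord'] at this
        · intro h1 j
          rcases eq_or_ne j l with rfl | hj
          · rwa [hcoord']
          · rw [hcoord y j hj]
            exact ht j hj
      have hFy : (fun y : ℝ => F (t + y • (Pi.single l 1 : Fin d → ℝ))) =
          fun y => restFactor ε ν sig x (k, h) l t * axisFun (h l) w a b (t l + y) := by
        funext y
        by_cases h1 : 0 < t l + y
        · simp only [F]
          rw [Set.indicator_of_mem ((hmem y).mpr h1), axisFun, if_pos h1]
          have eP : ∏ j ∈ Finset.univ.erase l,
              (((t + y • (Pi.single l 1 : Fin d → ℝ)) j : ℝ) : ℂ) = P :=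
            Finset.prod_congr rfl fun j hj => by rw [hcoord y j (Finset.ne_of_mem_erase hj)]
          rw [dampedIntegrand_split ε ν sig x _ l, eP, hcoord' y,
            restFactor_congr ε ν sig x (s := (k + Pi.single l 1, h)) (s' := (k, h)) (t' := t)
              (hcoord y)
              (fun j hj => by simp [hj]) (fun j _ => rfl)]
          have ew : ν l + ((k + Pi.single l 1 : Fin d → ℤ) l : ℤ) - 1 = w := by
            simp [hw]
            ring
          simp only [ew]
          rfl
        · simp only [F]
          rw [Set.indicator_of_notMem fun hy => h1 ((hmem y).mp hy), axisFun, if_neg h1, mul_zero]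
      rw [hFy]
      have hax := (hasDerivAt_axisFun (hh l) w ha0 hb0 (t l + 0)).comp_const_add (t l) 0
      refine (hax.const_mul _).congr_deriv ?_
      have hmem0 : t ∈ orthant d ↔ 0 < t l := by simpa using hmem 0
      simp only [add_zero]
      by_cases h1 : 0 < t l
      · rw [if_pos h1, Set.indicator_of_mem (hmem0.mpr h1)]
        have e3 : restFactor ε ν sig x (k, euler l h) l t = restFactor ε ν sig x (k, h) l t :=
          restFactor_congr ε ν sig x (fun _ _ => rfl) (fun _ _ => rfl) fun j hj => by
            simp [euler, hj]
        have e4 : restFactor ε ν sig x (k - Pi.single l 1, h) l t =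
            restFactor ε ν sig x (k, h) l t :=
          restFactor_congr ε ν sig x (fun _ _ => rfl) (fun j hj => by simp [hj]) fun j _ => rfl
        have e5 : euler l h l (t l) = t l * deriv (h l) (t l) := by simp [euler]
        have e6 : ν l + ((k + 1 : Fin d → ℤ) l : ℤ) - 1 = w := by
          simp [hw]
          ring
        have e7 : ν l + ((k - Pi.single l 1 : Fin d → ℤ) l : ℤ) - 1 = w - 1 - 1 := by
          simp [hw]
          ring
        simp only [G, dampedIntegrand_split ε ν sig x _ l t, e3, e4, e5, e6, e7,
          restFactor_add_one ε ν sig x k h l ht]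
        simp only [← hP, ← hw, ← ha, ← hb]
        rw [ha]
        ring
      · rw [if_neg h1, Set.indicator_of_notMem fun hy => h1 (hmem0.mp hy), mul_zero]
    · -- another coordinate is not positive, so that everything vanishes along the line
      push Not at ht
      obtain ⟨j, hj, hj0⟩ := ht
      have hnot : ∀ y : ℝ, t + y • (Pi.single l 1 : Fin d → ℝ) ∉ orthant d := fun y hy => by
        have := hy j
        rw [hcoord y j hj] at this
        linarith
      have hnot0 : t ∉ orthant d := by simpa using hnot 0
      have hFy : (fun y : ℝ => F (t + y • (Pi.single l 1 : Fin d → ℝ))) = fun _ => 0 := by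
        funext y
        exact Set.indicator_of_notMem (hnot y) _
      rw [hFy, Set.indicator_of_notMem hnot0]
      exact hasDerivAt_const _ _
  have hparts := integral_bilinear_hasLineDerivAt_right_eq_neg_left_of_integrable
    (μ := volume) (f := F) (f' := (orthant d).indicator G) (g := fun _ => (1 : ℂ))
    (g' := fun _ => 0) (v := Pi.single l 1) (B := ContinuousLinearMap.mul ℝ ℂ)
    (by simpa using hG') (by simp) (by simpa using hF) (fun t _ => hderiv t)
    (fun t _ => by
      unfold HasLineDerivAt
      exact hasDerivAt_const _ _)
  simp only [map_zero, integral_zero, ContinuousLinearMap.mul_apply', mul_one] at hparts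
  rw [integral_indicator (measurableSet_orthant d), zero_eq_neg] at hparts
  have e := integral_add i123 i4
  rw [integral_sub i12 i3, integral_add i1 i2] at e
  simp only [integral_const_mul] at e
  simp only [dampedIntegral]
  rw [← e]
  exact hparts

end

section

/-! ### The damped integral as a Mellin-Barnes integral -/

/-- The principal branch is harmless since the argument of the damping factor is at most `π / 2` in
absolute value. -/
theorem dampFactor_mul_cpow {ε : ℝ} (hε0 : 0 ≤ ε) (hε : ε ≤ Real.pi / 2) (u : ℤˣ) {x : ℝ}
    (hx : 0 < x) (s : ℂ) :
    (x * dampFactor ε u) ^ (-s) =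
      (x : ℂ) ^ (-s) * Complex.exp (Complex.I * sgn u * (Real.pi / 2 - ε) * s) := by
  have hx0 : (x : ℂ) ≠ 0 := by exact_mod_cast hx.ne'
  have him : (-(Complex.I * sgn u * (Real.pi / 2 - ε) : ℂ)).im = -(Real.pi / 2 - ε) ∨
      (-(Complex.I * sgn u * (Real.pi / 2 - ε) : ℂ)).im = Real.pi / 2 - ε := by
    have e : (Real.pi / 2 - ε : ℂ) = ((Real.pi / 2 - ε : ℝ) : ℂ) := by push_cast; ring
    rcases sgn_cases u with hu | hu <;> rw [hu, e]
    · left; simp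
    · right; simp
  have hlog : Complex.log (dampFactor ε u) = -(Complex.I * sgn u * (Real.pi / 2 - ε)) := by
    unfold dampFactor
    have := Real.pi_pos
    refine Complex.log_exp ?_ ?_
    · rcases him with h | h <;> rw [h] <;> linarith
    · rcases him with h | h <;> rw [h] <;> linarith
  rw [Complex.cpow_def_of_ne_zero (mul_ne_zero hx0 (dampFactor_ne_zero ε u)),
    Complex.log_ofReal_mul hx (dampFactor_ne_zero ε u), hlog,
    Complex.cpow_def_of_ne_zero hx0, ← Complex.ofReal_log hx.le, ← Complex.exp_add]
  congr 1
  ring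

theorem Gamma_mul_dampFactor_cpow {ε : ℝ} (hε0 : 0 ≤ ε) (hε : ε ≤ Real.pi / 2) (u : ℤˣ) {x : ℝ}
    (hx : 0 < x) (s : ℂ) :
    Complex.Gamma s * (x * dampFactor ε u) ^ (-s) = gammaDamped ε u s * (x : ℂ) ^ (-s) := by
  rw [dampFactor_mul_cpow hε0 hε u hx, gammaDamped]
  ring

theorem dampedKernel_one (ε : ℝ) (u : ℤˣ) (x : ℝ) (s : ℂ) :
    dampedKernel (n := 1) ε (fun _ => u) (fun _ => 0) x s =
      gammaDamped ε u s * (x : ℂ) ^ (-s) := by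
  simp [dampedKernel]

theorem integrable_gammaDamped_line {ε : ℝ} (hε0 : 0 < ε) (hε : ε ≤ Real.pi / 2) (u : ℤˣ) {x : ℝ}
    (hx : 0 < x) {σ : ℝ} (hσ : 0 < σ) : Integrable fun y : ℝ =>
      gammaDamped ε u (σ + y * Complex.I) * (x : ℂ) ^ (-(σ + y * Complex.I)) := by
  have := integrable_dampedKernel_line one_pos (fun _ => u) hx hε0 hε (lam := fun _ => 0) (σ := σ)
    (fun _ => hσ)
  simpa only [dampedKernel_one] using this

/-- Mellin inversion for the damped exponential function. -/
theorem exp_neg_mul_eq_integral {ε : ℝ} (hε0 : 0 < ε) (hε : ε ≤ Real.pi / 2) (u : ℤˣ) {x : ℝ}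
    (hx : 0 < x) {σ : ℝ} (hσ : 0 < σ) {v : ℝ} (hv : 0 < v) :
    Complex.exp (-(x * dampFactor ε u * v)) =
      (2 * Real.pi : ℂ)⁻¹ * ∫ y : ℝ, (v : ℂ) ^ (-(σ + y * Complex.I)) *
        (gammaDamped ε u (σ + y * Complex.I) * (x : ℂ) ^ (-(σ + y * Complex.I))) := by
  have hsin : 0 < Real.sin ε := Real.sin_pos_of_pos_of_lt_pi hε0 (by linarith [Real.pi_pos])
  have hz : 0 < ((x : ℂ) * dampFactor ε u).re := by
    rw [Complex.re_ofReal_mul, dampFactor_re]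
    positivity
  have hM : ∀ y : ℝ, mellin (fun t : ℝ => Complex.exp (-(x * dampFactor ε u * t)))
      (σ + y * Complex.I) =
      gammaDamped ε u (σ + y * Complex.I) * (x : ℂ) ^ (-(σ + y * Complex.I)) := fun y => by
    rw [mellin_exp_neg_mul hz (by simpa using hσ), Gamma_mul_dampFactor_cpow hε0.le hε u hx]
  have h := mellinInv_mellin_eq σ (fun t : ℝ => Complex.exp (-(x * dampFactor ε u * t))) hv
    (mellinConvergent_exp_neg_mul hz (by simpa using hσ)) ?_
    (Continuous.continuousAt (by fun_prop))
  · rw [← h, mellinInv]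
    simp only [hM, smul_eq_mul]
    rw [Complex.real_smul]
    push_cast
    rw [one_div]
  · unfold Complex.VerticalIntegrable
    simp only [hM]
    exact integrable_gammaDamped_line hε0 hε u hx hσ

variable {d : ℕ}

theorem prod_ofReal_cpow {t : Fin d → ℝ} (ht : ∀ l, 0 < t l) (w : ℂ) :
    ((∏ l, t l : ℝ) : ℂ) ^ w = ∏ l, (t l : ℂ) ^ w := by
  have h0 : ∀ l, (t l : ℂ) ≠ 0 := fun l => by exact_mod_cast (ht l).ne'
  have hP : 0 < ∏ l, t l := Finset.prod_pos fun l _ => ht l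
  rw [Complex.cpow_def_of_ne_zero (by exact_mod_cast hP.ne'), ← Complex.ofReal_log hP.le,
    Real.log_prod fun l _ => (ht l).ne', Complex.ofReal_sum, Finset.sum_mul, Complex.exp_sum]
  exact Finset.prod_congr rfl fun l _ => by
    rw [Complex.cpow_def_of_ne_zero (h0 l), ← Complex.ofReal_log (ht l).le]

theorem prod_cpow_eq_cpow_sum {z : ℂ} (hz : z ≠ 0) (w : Fin d → ℂ) :
    ∏ l, z ^ w l = z ^ ∑ l, w l := by
  simp only [Complex.cpow_def_of_ne_zero hz, Finset.mul_sum, Complex.exp_sum]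

theorem mellin_exp_dampFactor_div {ε : ℝ} (hε0 : 0 < ε) (hε : ε ≤ Real.pi / 2) (u : ℤˣ) {x : ℝ}
    (hx : 0 < x) {w : ℂ} (hw : w.re < 0) :
    IntegrableOn (fun t : ℝ => (t : ℂ) ^ (w - 1) *
      Complex.exp (-(x * dampFactor ε u * (t : ℂ)⁻¹))) (Set.Ioi 0) ∧
    ∫ t : ℝ in Set.Ioi 0, (t : ℂ) ^ (w - 1) * Complex.exp (-(x * dampFactor ε u * (t : ℂ)⁻¹)) =
      gammaDamped ε u (-w) * (x : ℂ) ^ w := by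
  have hsin : 0 < Real.sin ε := Real.sin_pos_of_pos_of_lt_pi hε0 (by linarith [Real.pi_pos])
  have hz : 0 < ((x : ℂ) * dampFactor ε u).re := by
    rw [Complex.re_ofReal_mul, dampFactor_re]
    positivity
  refine ⟨mellinConvergent_exp_neg_div hz hw, ?_⟩
  have h1 := mellin_exp_neg_div hz hw
  have h2 := Gamma_mul_dampFactor_cpow hε0.le hε u hx (-w)
  rw [neg_neg] at h2
  rw [← h2, ← h1]
  rfl

/-- The damped integral with constant amplitude is a Mellin-Barnes integral over a vertical line:
insert the Mellin inversion formula for the factor that contains `t_1 ⋯ t_d` and integrate over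
each `t_l` first. -/
theorem dampedIntegral_one_eq {ε : ℝ} (hε0 : 0 < ε) (hε : ε ≤ Real.pi / 2) (ν : Fin d → ℂ)
    (sig : Fin (d + 1) → ℤˣ) {x : ℝ} (hx : 0 < x) {σ : ℝ} (hσ : 0 < σ)
    (hσν : ∀ l, (ν l).re < σ) :
    dampedIntegral ε ν sig x (0, fun _ _ => 1) = (2 * Real.pi : ℂ)⁻¹ * ∫ y : ℝ,
      gammaDamped ε (sig (Fin.last d)) (σ + y * Complex.I) * (x : ℂ) ^ (-(σ + y * Complex.I)) *
        ∏ l : Fin d, gammaDamped ε (sig l.castSucc) (σ + y * Complex.I - ν l) *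
          (x : ℂ) ^ (-(σ + y * Complex.I - ν l)) := by
  set K : ℝ → ℂ := fun y =>
    gammaDamped ε (sig (Fin.last d)) (σ + y * Complex.I) * (x : ℂ) ^ (-(σ + y * Complex.I)) with hK
  have hKi : Integrable K := integrable_gammaDamped_line hε0 hε _ hx hσ
  set E : Fin d → ℝ → ℝ → ℂ := fun l y t => (t : ℂ) ^ (ν l - (σ + y * Complex.I) - 1) *
    Complex.exp (-(x * dampFactor ε (sig l.castSucc) * (t : ℂ)⁻¹)) with hE
  have hEl : ∀ l (y : ℝ), IntegrableOn (E l y) (Set.Ioi 0) ∧ ∫ t in Set.Ioi 0, E l y t =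
      gammaDamped ε (sig l.castSucc) (σ + y * Complex.I - ν l) *
        (x : ℂ) ^ (-(σ + y * Complex.I - ν l)) := by
    intro l y
    have h := mellin_exp_dampFactor_div hε0 hε (sig l.castSucc) hx
      (w := ν l - (σ + y * Complex.I)) (by simpa using hσν l)
    rw [neg_sub] at h
    rwa [neg_sub (σ + y * Complex.I : ℂ) (ν l)]
  have hF : Integrable (Function.uncurry fun (t : Fin d → ℝ) (y : ℝ) =>
      (∏ l, E l y (t l)) * K y) ((volume.restrict (orthant d)).prod volume) := by
    have h0 : IntegrableOn (fun t : Fin d → ℝ => ∏ l, E l 0 (t l)) (orthant d) :=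
      integrableOn_orthant_prod fun l => (hEl l 0).1
    refine (Integrable.mul_prod h0 hKi).mono ?_ ?_
    · refine AEStronglyMeasurable.mul (Measurable.aestronglyMeasurable ?_)
        (hKi.aestronglyMeasurable.comp_snd)
      simp only [hE]
      fun_prop
    · have : (volume.restrict (orthant d)).prod (volume : Measure ℝ) =
          (volume.prod volume).restrict (orthant d ×ˢ Set.univ) := by
        rw [← Measure.prod_restrict, Measure.restrict_univ]
      rw [this]
      refine (ae_restrict_mem ((measurableSet_orthant d).prod MeasurableSet.univ)).mono
        fun p hp => ?_
      have hp1 : ∀ l, 0 < p.1 l := hp.1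
      simp only [Function.uncurry]
      rw [norm_mul, norm_mul (∏ l, E l 0 (p.1 l)), norm_prod, norm_prod]
      refine le_of_eq ?_
      congr 1
      refine Finset.prod_congr rfl fun l _ => ?_
      simp only [hE, norm_mul, Complex.norm_cpow_eq_rpow_re_of_pos (hp1 l)]
      simp
  have h1 : dampedIntegral ε ν sig x (0, fun _ _ => 1) = ∫ t in orthant d,
      (2 * Real.pi : ℂ)⁻¹ * ∫ y : ℝ, (∏ l, E l y (t l)) * K y := by
    refine setIntegral_congr_fun (measurableSet_orthant d) fun t ht => ?_
    have hP : 0 < ∏ l, t l := Finset.prod_pos fun l _ => ht l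
    have e1 : -(x * dampedPhase ε sig t) =
        -(x * dampFactor ε (sig (Fin.last d)) * ((∏ l, t l : ℝ) : ℂ)) +
          ∑ l : Fin d, -(x * dampFactor ε (sig l.castSucc) * (t l : ℂ)⁻¹) := by
      rw [dampedPhase, Finset.sum_neg_distrib, mul_add, Finset.mul_sum]
      push_cast
      simp only [mul_assoc]
      ring
    simp only [dampedIntegrand, Finset.prod_const_one, one_mul]
    rw [e1, Complex.exp_add, exp_neg_mul_eq_integral hε0 hε _ hx hσ hP, Complex.exp_sum]
    rw [mul_comm _ (∏ l : Fin d, _), ← mul_assoc, ← Finset.prod_mul_distrib, ← mul_assoc,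
      mul_comm _ (2 * Real.pi : ℂ)⁻¹, mul_assoc, ← integral_const_mul]
    congr 1
    refine integral_congr_ae (Eventually.of_forall fun y => ?_)
    simp only [hE]
    rw [← mul_assoc]
    congr 1
    rw [prod_ofReal_cpow ht, ← Finset.prod_mul_distrib]
    refine Finset.prod_congr rfl fun l _ => ?_
    have h0 : (t l : ℂ) ≠ 0 := by exact_mod_cast (ht l).ne'
    have e2 : ν l - (σ + y * Complex.I) - 1 = (ν l - 1) + -(σ + y * Complex.I) := by ring
    rw [e2, Complex.cpow_add _ _ h0]
    simp
    ring
  rw [h1, integral_const_mul, integral_integral_swap hF]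
  congr 1
  refine integral_congr_ae (Eventually.of_forall fun y => ?_)
  simp only
  rw [integral_mul_const, mul_comm, restrict_orthant, integral_fintype_prod_eq_prod]
  simp only [(hEl _ y).2, hK]

/-- For `λ` in the hyperplane, the damped integral is the damped Mellin-Barnes integral over any
admissible contour. -/
theorem dampedIntegral_one_eq_contour {ε : ℝ} (hε0 : 0 < ε) (hε : ε ≤ Real.pi / 2)
    {lam : Fin (d + 1) → ℂ} {ν : Fin d → ℂ} (hlam : ∑ l, lam l = 0)
    (hν : ∀ l : Fin d, ν l = lam l.castSucc - lam (Fin.last d)) (sig : Fin (d + 1) → ℤˣ) {x : ℝ}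
    (hx : 0 < x) {r : ℝ → ℝ} (hr : IsContour lam r) :
    dampedIntegral ε ν sig x (0, fun _ _ => 1) = (2 * Real.pi * Complex.I)⁻¹ *
      ∫ t : ℝ, dampedKernel ε sig lam x (r t + t * Complex.I) * (deriv r t + Complex.I) := by
  -- the line `Re s = σ` and its translate by `λ_{d+1}` lie to the right of all the poles
  set σ : ℝ := 1 + ∑ l, |(ν l).re| with hσdef
  have hσ : 0 < σ := add_pos_of_pos_of_nonneg one_pos (Finset.sum_nonneg fun _ _ => abs_nonneg _)
  have hσν : ∀ l, (ν l).re < σ := fun l => by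
    have h1 := Finset.single_le_sum (f := fun l => |(ν l).re|)
      (fun l _ => abs_nonneg _) (Finset.mem_univ l)
    have h2 := le_abs_self (ν l).re
    linarith
  have hσl : ∀ l, (lam l).re < σ + (lam (Fin.last d)).re := by
    intro l
    refine Fin.lastCases ?_ (fun j => ?_) l
    · linarith
    · have := hσν j
      rw [hν j, Complex.sub_re] at this
      linarith
  have hx0 : (x : ℂ) ≠ 0 := by exact_mod_cast hx.ne'
  rw [dampedIntegral_one_eq hε0 hε ν sig hx hσ hσν,
    hr.integral_dampedKernel_eq (Nat.succ_pos d) hx sig hε0 hε hσl,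
    ← integral_add_right_eq_self (fun t : ℝ => dampedKernel ε sig lam x
      ((σ + (lam (Fin.last d)).re : ℝ) + t * Complex.I)) (lam (Fin.last d)).im,
    mul_inv (2 * Real.pi : ℂ), mul_assoc (2 * Real.pi : ℂ)⁻¹,
    inv_mul_cancel_left₀ Complex.I_ne_zero]
  congr 1
  refine integral_congr_ae (Eventually.of_forall fun y => ?_)
  simp only
  set s : ℂ := σ + y * Complex.I with hs
  have e1 : ((σ + (lam (Fin.last d)).re : ℝ) : ℂ) + ((y + (lam (Fin.last d)).im : ℝ) : ℂ) *
      Complex.I = s + lam (Fin.last d) := by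
    conv_rhs => rw [← Complex.re_add_im (lam (Fin.last d))]
    rw [hs]
    push_cast
    ring
  rw [e1, dampedKernel, Fin.prod_univ_castSucc, Finset.prod_mul_distrib]
  have e2 : ∏ l : Fin d, (x : ℂ) ^ (-(s - ν l)) = (x : ℂ) ^ (∑ l : Fin d, -(s - ν l)) :=
    prod_cpow_eq_cpow_sum hx0 _
  have e3 : -((d + 1 : ℕ) : ℂ) * (s + lam (Fin.last d)) = -s + ∑ l : Fin d, -(s - ν l) := by
    have h4 : ∑ l : Fin d, lam l.castSucc = -lam (Fin.last d) := by
      rw [Fin.sum_univ_castSucc] at hlam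
      linear_combination hlam
    simp only [hν, Finset.sum_neg_distrib, Finset.sum_sub_distrib, Finset.sum_const,
      Finset.card_univ, Fintype.card_fin, nsmul_eq_mul, h4]
    push_cast
    ring
  rw [e2, e3, Complex.cpow_add _ _ hx0]
  have e4 : ∀ l : Fin d, s - ν l = s + lam (Fin.last d) - lam l.castSucc := fun l => by
    rw [hν]
    ring
  simp only [e4, add_sub_cancel_right]
  ring

end

section

/-! ### Formal combinations as limits of damped combinations -/

variable {d : ℕ}

/-- `Deforms ν sig x S F j` says that the function `j` of the damping parameter `ε` is, for small
`ε > 0`, a finite combination of damped integrals with symbols in `S` whose coefficients tend, as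
`ε → 0`, to those of the formal combination `F` at the given value of `x`. -/
inductive Deforms (ν : Fin d → ℂ) (sig : Fin (d + 1) → ℤˣ) (x : ℝ) (S : Set (JSymbol d)) :
    JForm d → (ℝ → ℂ) → Prop
  | single {s : JSymbol d} (hs : s ∈ S) {p : ℂ[X]} {c : ℝ → ℂ}
      (hc : Tendsto c (𝓝[>] 0) (𝓝 (p.eval (x : ℂ)⁻¹))) :
      Deforms ν sig x S (Finsupp.single s p) fun ε => c ε * dampedIntegral ε ν sig x s
  | zero : Deforms ν sig x S 0 fun _ => 0
  | add {F G : JForm d} {i j : ℝ → ℂ} (hF : Deforms ν sig x S F i) (hG : Deforms ν sig x S G j) :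
      Deforms ν sig x S (F + G) fun ε => i ε + j ε
  | congr {F : JForm d} {i j : ℝ → ℂ} (hF : Deforms ν sig x S F i) (hij : i =ᶠ[𝓝[>] 0] j) :
      Deforms ν sig x S F j

/-- `L` turns a damped integral with symbol in `S` into a deformed combination with symbols in `S'`
without changing its value. -/
def Admissible (ν : Fin d → ℂ) (sig : Fin (d + 1) → ℤˣ) (x : ℝ) (S S' : Set (JSymbol d))
    (L : JForm d →ₗ[ℂ[X]] JForm d) : Prop :=
  ∀ s ∈ S, Deforms ν sig x S' (L (Finsupp.single s 1)) fun ε => dampedIntegral ε ν sig x s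

variable {ν : Fin d → ℂ} {sig : Fin (d + 1) → ℤˣ} {x : ℝ} {S S' S'' : Set (JSymbol d)}

theorem Deforms.mono (hSS : S ⊆ S') {F : JForm d} {j : ℝ → ℂ} (h : Deforms ν sig x S F j) :
    Deforms ν sig x S' F j := by
  induction h with
  | single hs hc => exact .single (hSS hs) hc
  | zero => exact .zero
  | add _ _ h1 h2 => exact .add h1 h2
  | congr _ hij h => exact .congr h hij

theorem Deforms.of_mem {s : JSymbol d} (hs : s ∈ S) :
    Deforms ν sig x S (Finsupp.single s 1) fun ε => dampedIntegral ε ν sig x s :=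
  (Deforms.single hs (p := 1) (c := fun _ => 1) (by simp)).congr (by simp)

theorem Deforms.smul {F : JForm d} {j : ℝ → ℂ} (h : Deforms ν sig x S F j) {p : ℂ[X]} {c : ℝ → ℂ}
    (hc : Tendsto c (𝓝[>] 0) (𝓝 (p.eval (x : ℂ)⁻¹))) :
    Deforms ν sig x S (p • F) fun ε => c ε * j ε := by
  induction h with
  | single hs hc' =>
    rw [Finsupp.smul_single, smul_eq_mul]
    refine (Deforms.single hs (c := fun ε => c ε * _) ?_).congr
      (Eventually.of_forall fun ε => mul_assoc _ _ _)
    rw [eval_mul]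
    exact hc.mul hc'
  | zero =>
    rw [smul_zero]
    exact Deforms.zero.congr (by simp)
  | add _ _ h1 h2 =>
    rw [smul_add]
    exact (h1.add h2).congr (Eventually.of_forall fun ε => (mul_add _ _ _).symm)
  | congr _ hij h => exact h.congr (hij.mono fun ε hε => by simp only [hε])

theorem Admissible.apply {L : JForm d →ₗ[ℂ[X]] JForm d} (hL : Admissible ν sig x S S' L)
    {F : JForm d} {j : ℝ → ℂ} (h : Deforms ν sig x S F j) : Deforms ν sig x S' (L F) j := by
  induction h with
  | @single s hs p c hc =>
    have e : L (Finsupp.single s p) = p • L (Finsupp.single s 1) := by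
      rw [← map_smul, Finsupp.smul_single, smul_eq_mul, mul_one]
    rw [e]
    exact (hL s hs).smul hc
  | zero =>
    rw [map_zero]
    exact .zero
  | add _ _ h1 h2 =>
    rw [map_add]
    exact h1.add h2
  | congr _ hij h => exact h.congr hij

theorem Admissible.mul {L L' : Module.End ℂ[X] (JForm d)} (hL : Admissible ν sig x S S' L)
    (hL' : Admissible ν sig x S' S'' L') : Admissible ν sig x S S'' (L' * L) := fun s hs =>
  hL'.apply (hL s hs)

theorem admissible_one : Admissible ν sig x S S (1 : Module.End ℂ[X] (JForm d)) := fun _ hs =>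
  .of_mem hs

/-- A family of symbol sets indexed by the vectors of `ℤ^d` along which `L` is a translation by `v`
is translated by `n v` by `L ^ n`. -/
theorem admissible_pow {𝒮 : (Fin d → ℤ) → Set (JSymbol d)} {L : Module.End ℂ[X] (JForm d)}
    {v : Fin d → ℤ} (hL : ∀ f, Admissible ν sig x (𝒮 f) (𝒮 (f + v)) L) (n : ℕ) (f : Fin d → ℤ) :
    Admissible ν sig x (𝒮 f) (𝒮 (f + n • v)) (L ^ n) := by
  induction n with
  | zero =>
    rw [zero_smul, add_zero, pow_zero]
    exact admissible_one
  | succ n ih =>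
    rw [pow_succ', succ_nsmul, ← add_assoc]
    exact ih.mul (hL _)

theorem Deforms.support_subset {F : JForm d} {j : ℝ → ℂ} (h : Deforms ν sig x S F j) :
    (F.support : Set (JSymbol d)) ⊆ S := by
  induction h with
  | single hs hc =>
    intro s' hs'
    have := Finsupp.support_single_subset (Finset.mem_coe.mp hs')
    rw [Finset.mem_singleton] at this
    rwa [this]
  | zero => simp
  | add _ _ h1 h2 =>
    classical
    intro s hs
    rcases Finset.mem_union.mp (Finsupp.support_add (Finset.mem_coe.mp hs)) with h | h
    · exact h1 h
    · exact h2 h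
  | congr _ _ h => exact h

theorem JForm.value_add (ν : Fin d → ℂ) (sig : Fin (d + 1) → ℤˣ) (x : ℝ) (F G : JForm d) :
    (F + G).value ν sig x = F.value ν sig x + G.value ν sig x := by
  unfold JForm.value
  exact Finsupp.sum_add_index' (by simp) fun s p q => by rw [eval_add, add_mul]

theorem Deforms.tendsto_value {F : JForm d} {j : ℝ → ℂ} (h : Deforms ν sig x S F j)
    (hS : ∀ s ∈ S, Tendsto (fun ε => dampedIntegral ε ν sig x s) (𝓝[>] 0)
      (𝓝 (jIntegral ν sig x s))) :
    Tendsto j (𝓝[>] 0) (𝓝 (F.value ν sig x)) := by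
  induction h with
  | @single s hs p c hc =>
    have e : JForm.value ν sig x (Finsupp.single s p) =
        p.eval ((x : ℂ)⁻¹) * jIntegral ν sig x s := Finsupp.sum_single_index (by simp)
    rw [e]
    exact hc.mul (hS _ hs)
  | zero => simp [JForm.value]
  | add _ _ h1 h2 =>
    rw [JForm.value_add]
    exact h1.add h2
  | congr _ hij h => exact h.congr' hij

/-! ### Admissibility of the formal partial integrations -/

theorem tendsto_dampFactor (u : ℤˣ) :
    Tendsto (fun ε => dampFactor ε u) (𝓝[>] 0) (𝓝 (-(Complex.I * sgn u))) := by
  rw [← dampFactor_zero]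
  exact ((continuous_dampFactor u).tendsto 0).mono_left nhdsWithin_le_nhds

theorem sgn_mul_self (u : ℤˣ) : sgn u * sgn u = 1 := by
  rcases sgn_cases u with h | h <;> simp [h]

theorem sgn_ne_zero (u : ℤˣ) : sgn u ≠ 0 := by
  rcases sgn_cases u with h | h <;> simp [h]

theorem tendsto_dampFactor_div (u v : ℤˣ) :
    Tendsto (fun ε => dampFactor ε u / dampFactor ε v) (𝓝[>] 0) (𝓝 (sgn u * sgn v)) := by
  have h := (tendsto_dampFactor u).div (tendsto_dampFactor v)
    (neg_ne_zero.mpr (mul_ne_zero Complex.I_ne_zero (sgn_ne_zero v)))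
  have e : -(Complex.I * sgn u) / -(Complex.I * sgn v) = sgn u * sgn v := by
    rw [neg_div_neg_eq, mul_div_mul_left _ _ Complex.I_ne_zero, div_eq_iff (sgn_ne_zero v),
      mul_assoc, sgn_mul_self, mul_one]
  rwa [e] at h

theorem tendsto_inv_mul_dampFactor (x : ℝ) (u : ℤˣ) :
    Tendsto (fun ε => (x * dampFactor ε u)⁻¹) (𝓝[>] 0)
      (𝓝 (sgn u * Complex.I * (x : ℂ)⁻¹)) := by
  have h := ((tendsto_dampFactor u).inv₀
    (neg_ne_zero.mpr (mul_ne_zero Complex.I_ne_zero (sgn_ne_zero u)))).mul_const (x : ℂ)⁻¹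
  have e : (-(Complex.I * sgn u))⁻¹ = sgn u * Complex.I := by
    refine inv_eq_of_mul_eq_one_right ?_
    linear_combination (-Complex.I ^ 2) * sgn_mul_self u - Complex.I_sq
  rw [e] at h
  refine h.congr fun ε => ?_
  rw [mul_inv, mul_comm]

theorem deforms_partialPlus (hx : 0 < x) {k : Fin d → ℤ} {h : Fin d → ℝ → ℂ}
    (hh : ∀ l, MemT (h l)) {l : Fin d} (h1 : (k + 1 + Pi.single l 1, h) ∈ S)
    (h2 : (k + Pi.single l 1, h) ∈ S) (h3 : (k + Pi.single l 1, euler l h) ∈ S) :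
    Deforms ν sig x S (partialPlus ν sig l (Finsupp.single (k, h) 1))
      fun ε => dampedIntegral ε ν sig x (k, h) := by
  have hx0 : (x : ℂ) ≠ 0 := by exact_mod_cast hx.ne'
  rw [partialPlus_single, sub_eq_add_neg, sub_eq_add_neg, ← neg_smul, ← neg_smul]
  have t1 := tendsto_dampFactor_div (sig (Fin.last d)) (sig l.castSucc)
  have t2 := tendsto_inv_mul_dampFactor x (sig l.castSucc)
  refine ((((Deforms.of_mem h1).smul (c := fun ε =>
    dampFactor ε (sig (Fin.last d)) / dampFactor ε (sig l.castSucc)) ?_).add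
    ((Deforms.of_mem h2).smul (c := fun ε =>
      -((x * dampFactor ε (sig l.castSucc))⁻¹ * (ν l + k l + 1))) ?_)).add
    ((Deforms.of_mem h3).smul (c := fun ε =>
      -(x * dampFactor ε (sig l.castSucc))⁻¹) ?_)).congr ?_
  · simpa [mul_comm] using t1
  · convert (t2.mul_const (ν l + k l + 1)).neg using 2
    simp
    ring
  · convert t2.neg using 2
    simp
  · filter_upwards [Ioc_mem_nhdsGT (show (0 : ℝ) < Real.pi / 2 by positivity)] with ε hε
    have h4 := dampedIntegral_parts hε.1 hε.2 ν sig hx (k + Pi.single l 1) hh l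
    have e1 : (k + Pi.single l 1 : Fin d → ℤ) l = k l + 1 := by simp
    have e2 : k + Pi.single l 1 + 1 = k + 1 + Pi.single l (1 : ℤ) := by abel
    rw [e1, e2, add_sub_cancel_right] at h4
    push_cast at h4
    have hz := dampFactor_ne_zero ε (sig l.castSucc)
    field_simp
    linear_combination -h4

theorem partialMinus_single (ν : Fin d → ℂ) (sig : Fin (d + 1) → ℤˣ) (l : Fin d)
    (k : Fin d → ℤ) (h : Fin d → ℝ → ℂ) :
    partialMinus ν sig l (Finsupp.single (k, h) 1) =
      C (sgn (sig l.castSucc) * sgn (sig (Fin.last d))) •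
          Finsupp.single (k - 1 - Pi.single l 1, h) 1
        + (C (sgn (sig (Fin.last d)) * Complex.I * (ν l + k l - 1)) * X) •
          Finsupp.single (k - 1, h) 1
        + (C (sgn (sig (Fin.last d)) * Complex.I) * X) •
          Finsupp.single (k - 1, euler l h) 1 := by
  simp only [partialMinus, Finsupp.linearCombination_single, one_smul, Finsupp.smul_single,
    smul_eq_mul, mul_one]

theorem deforms_partialMinus (hx : 0 < x) {k : Fin d → ℤ} {h : Fin d → ℝ → ℂ}
    (hh : ∀ l, MemT (h l)) {l : Fin d} (h1 : (k - 1 - Pi.single l 1, h) ∈ S)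
    (h2 : (k - 1, h) ∈ S) (h3 : (k - 1, euler l h) ∈ S) :
    Deforms ν sig x S (partialMinus ν sig l (Finsupp.single (k, h) 1))
      fun ε => dampedIntegral ε ν sig x (k, h) := by
  have hx0 : (x : ℂ) ≠ 0 := by exact_mod_cast hx.ne'
  rw [partialMinus_single]
  have t1 := tendsto_dampFactor_div (sig l.castSucc) (sig (Fin.last d))
  have t2 := tendsto_inv_mul_dampFactor x (sig (Fin.last d))
  refine ((((Deforms.of_mem h1).smul (c := fun ε =>
    dampFactor ε (sig l.castSucc) / dampFactor ε (sig (Fin.last d))) ?_).add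
    ((Deforms.of_mem h2).smul (c := fun ε =>
      (x * dampFactor ε (sig (Fin.last d)))⁻¹ * (ν l + k l - 1)) ?_)).add
    ((Deforms.of_mem h3).smul (c := fun ε =>
      (x * dampFactor ε (sig (Fin.last d)))⁻¹) ?_)).congr ?_
  · simpa using t1
  · convert t2.mul_const (ν l + k l - 1) using 2
    simp
    ring
  · convert t2 using 2
    simp
  · filter_upwards [Ioc_mem_nhdsGT (show (0 : ℝ) < Real.pi / 2 by positivity)] with ε hε
    have h4 := dampedIntegral_parts hε.1 hε.2 ν sig hx (k - 1) hh l
    have e1 : (k - 1 : Fin d → ℤ) l = k l - 1 := by simp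
    rw [e1, sub_add_cancel] at h4
    push_cast at h4
    have hz := dampFactor_ne_zero ε (sig (Fin.last d))
    field_simp
    linear_combination h4

/-! ### Indices and amplitudes -/

/-- The symbols with index in `K` and with amplitudes `h_l` in `𝒜 l`. -/
def symbolSet (𝒜 : Fin d → Set (ℝ → ℂ)) (K : Set (Fin d → ℤ)) : Set (JSymbol d) :=
  {s | s.1 ∈ K ∧ ∀ l, s.2 l ∈ 𝒜 l}

/-- A set of functions in `𝒯(ℝ_+)` that is stable under `t ∂_t`. -/
def EulerStable (𝒜 : Set (ℝ → ℂ)) : Prop :=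
  ∀ h ∈ 𝒜, MemT h ∧ (fun t : ℝ => (t : ℂ) * deriv h t) ∈ 𝒜

/-- The indices `f + m (1, …, 1)` with `m ∈ ℕ`. -/
def upwardRay (f : Fin d → ℤ) : Set (Fin d → ℤ) := {k | ∃ m : ℕ, ∀ j, k j = f j + m}

/-- The indices `f - m e_l` with `m ∈ ℕ`. -/
def downwardRay (l : Fin d) (f : Fin d → ℤ) : Set (Fin d → ℤ) :=
  {k | ∃ m : ℕ, k = f - m • Pi.single l 1}

variable {𝒜 : Fin d → Set (ℝ → ℂ)}

theorem symbolSet_mono {K K' : Set (Fin d → ℤ)} (hK : K ⊆ K') : symbolSet 𝒜 K ⊆ symbolSet 𝒜 K' :=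
  fun _ hs => ⟨hK hs.1, hs.2⟩

theorem euler_mem (h𝒜 : ∀ l, EulerStable (𝒜 l)) {h : Fin d → ℝ → ℂ} (hh : ∀ l, h l ∈ 𝒜 l)
    (l j : Fin d) : euler l h j ∈ 𝒜 j := by
  unfold euler
  rcases eq_or_ne j l with rfl | hj
  · rw [Function.update_self]
    exact (h𝒜 j _ (hh j)).2
  · rw [Function.update_of_ne hj]
    exact hh j

/-- The first of the three terms moves one step up the ray, the others stay at the same height. -/
theorem admissible_partialPlus (hx : 0 < x) (h𝒜 : ∀ l, EulerStable (𝒜 l)) (l : Fin d)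
    (f : Fin d → ℤ) : Admissible ν sig x (symbolSet 𝒜 (upwardRay f))
      (symbolSet 𝒜 (upwardRay (f + Pi.single l 1))) (partialPlus ν sig l) := by
  rintro ⟨k, h⟩ ⟨⟨m, hm⟩, hh⟩
  simp only at hm hh
  have h2 : k + Pi.single l 1 ∈ upwardRay (f + Pi.single l 1) :=
    ⟨m, fun j => by rw [Pi.add_apply, Pi.add_apply, hm]; ring⟩
  refine deforms_partialPlus hx (fun j => (h𝒜 j _ (hh j)).1)
    ⟨⟨m + 1, fun j => ?_⟩, hh⟩ ⟨h2, hh⟩ ⟨h2, euler_mem h𝒜 hh l⟩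
  simp only [Pi.add_apply, Pi.one_apply, hm]
  push_cast
  ring

/-- The first of the three terms moves one step down the ray, the others stay at the same height. -/
theorem admissible_partialMinus (hx : 0 < x) (h𝒜 : ∀ l, EulerStable (𝒜 l)) (l : Fin d)
    (f : Fin d → ℤ) : Admissible ν sig x (symbolSet 𝒜 (downwardRay l f))
      (symbolSet 𝒜 (downwardRay l (f + (-1)))) (partialMinus ν sig l) := by
  rintro ⟨k, h⟩ ⟨⟨m, hm⟩, hh⟩
  simp only at hm hh
  have h2 : k - 1 ∈ downwardRay l (f + (-1)) := ⟨m, by rw [hm, ← sub_eq_add_neg, sub_right_comm]⟩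
  refine deforms_partialMinus hx (fun j => (h𝒜 j _ (hh j)).1)
    ⟨⟨m + 1, ?_⟩, hh⟩ ⟨h2, hh⟩ ⟨h2, euler_mem h𝒜 hh l⟩
  simp only [hm, succ_nsmul, ← sub_eq_add_neg]
  rw [sub_right_comm f, sub_sub (f - 1)]

theorem partialPlusProd_empty : partialPlusProd ν sig ∅ = 1 :=
  Finset.noncommProd_empty (partialPlus ν sig) _

theorem partialPlusProd_insert {l : Fin d} {L : Finset (Fin d)} (hl : l ∉ L) :
    partialPlusProd ν sig (insert l L) = partialPlus ν sig l * partialPlusProd ν sig L :=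
  Finset.noncommProd_insert_of_notMem L l (partialPlus ν sig) _ hl

theorem admissible_partialPlusProd (hx : 0 < x) (h𝒜 : ∀ l, EulerStable (𝒜 l))
    (L : Finset (Fin d)) (f : Fin d → ℤ) : Admissible ν sig x (symbolSet 𝒜 (upwardRay f))
      (symbolSet 𝒜 (upwardRay (f + ∑ l ∈ L, Pi.single l 1))) (partialPlusProd ν sig L) := by
  induction L using Finset.induction_on with
  | empty =>
    rw [Finset.sum_empty, add_zero, partialPlusProd_empty]
    exact admissible_one
  | insert l L hl ih =>
    rw [partialPlusProd_insert hl, Finset.sum_insert hl,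
      add_comm (Pi.single l 1), ← add_assoc]
    exact ih.mul (admissible_partialPlus hx h𝒜 l _)

theorem sum_single_apply (L : Finset (Fin d)) (j : Fin d) :
    (∑ l ∈ L, Pi.single l (1 : ℤ) : Fin d → ℤ) j = if j ∈ L then 1 else 0 := by
  rw [Finset.sum_apply]
  simp [Pi.single_apply]

theorem admissible_partialMinus_pow (hx : 0 < x) (h𝒜 : ∀ l, EulerStable (𝒜 l)) (l : Fin d)
    (n : ℕ) {k : Fin d → ℤ} {h : Fin d → ℝ → ℂ} (hh : ∀ l, h l ∈ 𝒜 l) :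
    Deforms ν sig x (symbolSet 𝒜 (downwardRay l (k - n)))
      ((partialMinus ν sig l ^ n) (Finsupp.single (k, h) 1))
      fun ε => dampedIntegral ε ν sig x (k, h) := by
  have h1 := admissible_pow (𝒮 := fun f => symbolSet 𝒜 (downwardRay l f))
    (admissible_partialMinus (ν := ν) (sig := sig) hx h𝒜 l) n k (k, h) ⟨⟨0, by simp⟩, hh⟩
  have e : k + n • (-1 : Fin d → ℤ) = k - n := by
    rw [smul_neg, nsmul_one, sub_eq_add_neg]
  rwa [e] at h1

end

section

/-! ### Convergence of the integrals in the rigorous interpretation -/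

/-- A power bound with exponent above `-1` takes care of the neighbourhood of zero and one with
exponent below `-1` of the neighbourhood of infinity. -/
theorem integrableOn_Ioi_of_two_power_bounds {f : ℝ → ℂ} (hf : ContinuousOn f (Set.Ioi 0))
    {p q C D : ℝ} (hp : 0 < p) (hq : q < 0) (h0 : ∀ t : ℝ, 0 < t → ‖f t‖ ≤ C * t ^ (p - 1))
    (h1 : ∀ t : ℝ, 0 < t → ‖f t‖ ≤ D * t ^ (q - 1)) : IntegrableOn f (Set.Ioi 0) := by
  rw [← Set.Ioc_union_Ioi_eq_Ioi (zero_le_one (α := ℝ))]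
  refine IntegrableOn.union ?_ ?_
  · have hi : IntegrableOn (fun t : ℝ => C * t ^ (p - 1)) (Set.Ioc 0 1) := by
      refine Integrable.const_mul ?_ C
      exact (intervalIntegrable_iff_integrableOn_Ioc_of_le zero_le_one).mp
        (intervalIntegral.intervalIntegrable_rpow' (by linarith))
    refine hi.mono' ((hf.mono Set.Ioc_subset_Ioi_self).aestronglyMeasurable measurableSet_Ioc) ?_
    exact (ae_restrict_mem measurableSet_Ioc).mono fun t ht => h0 t ht.1
  · have hi : IntegrableOn (fun t : ℝ => D * t ^ (q - 1)) (Set.Ioi 1) :=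
      Integrable.const_mul (integrableOn_Ioi_rpow_of_lt (by linarith) one_pos) D
    refine hi.mono' ((hf.mono (Set.Ioi_subset_Ioi zero_le_one)).aestronglyMeasurable
      measurableSet_Ioi) ?_
    exact (ae_restrict_mem measurableSet_Ioi).mono fun t ht => h1 t (zero_lt_one.trans ht)

theorem MemT.norm_mul_cpow_le {h : ℝ → ℂ} {B : ℝ} (hB : ∀ t : ℝ, 0 < t → ‖h t‖ ≤ B) (w : ℂ)
    {t : ℝ} (ht : 0 < t) : ‖h t * (t : ℂ) ^ (w - 1)‖ ≤ B * t ^ (w.re - 1) := by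
  rw [norm_mul, Complex.norm_cpow_eq_rpow_re_of_pos ht, Complex.sub_re, Complex.one_re]
  exact mul_le_mul_of_nonneg_right (hB t ht) (Real.rpow_nonneg ht.le _)

/-- A function in `𝒯(ℝ_+)` times a power is integrable on `ℝ_+` if at each end of the half line
either the function vanishes or the exponent is good. -/
theorem MemT.integrableOn_mul_cpow {h : ℝ → ℂ} (hh : MemT h) {w : ℂ}
    (h0 : 0 < w.re ∨ ∃ δ : ℝ, 0 < δ ∧ ∀ t, 0 < t → t < δ → h t = 0)
    (h1 : w.re < 0 ∨ ∃ M : ℝ, 0 < M ∧ ∀ t, M < t → h t = 0) :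
    IntegrableOn (fun t : ℝ => h t * (t : ℂ) ^ (w - 1)) (Set.Ioi 0) := by
  obtain ⟨B, hB0, hB⟩ := hh.exists_bound
  have hN : 0 < |w.re| + 1 := by positivity
  have hcont : ContinuousOn (fun t : ℝ => h t * (t : ℂ) ^ (w - 1)) (Set.Ioi 0) :=
    hh.continuousOn.mul (continuousOn_ofReal_cpow _)
  obtain ⟨p, hp, C, hC⟩ : ∃ p : ℝ, 0 < p ∧ ∃ C : ℝ, ∀ t : ℝ, 0 < t →
      ‖h t * (t : ℂ) ^ (w - 1)‖ ≤ C * t ^ (p - 1) := by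
    rcases h0 with h0 | ⟨δ, hδ, h0⟩
    · exact ⟨w.re, h0, B, fun t ht => MemT.norm_mul_cpow_le hB w ht⟩
    · refine ⟨w.re + (|w.re| + 1), by linarith [neg_abs_le w.re], B * δ ^ (-(|w.re| + 1)),
        fun t ht => ?_⟩
      rcases lt_or_ge t δ with h2 | h2
      · rw [h0 t ht h2, zero_mul, norm_zero]
        positivity
      · refine (MemT.norm_mul_cpow_le hB w ht).trans ?_
        have e : B * δ ^ (-(|w.re| + 1)) * t ^ (w.re + (|w.re| + 1) - 1) =
            B * t ^ (w.re - 1) * (t / δ) ^ (|w.re| + 1) := by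
          rw [Real.div_rpow ht.le hδ.le, Real.rpow_neg hδ.le, add_sub_right_comm,
            Real.rpow_add ht]
          ring
        rw [e]
        exact le_mul_of_one_le_right (by positivity)
          (Real.one_le_rpow ((one_le_div hδ).mpr h2) hN.le)
  obtain ⟨q, hq, D, hD⟩ : ∃ q : ℝ, q < 0 ∧ ∃ D : ℝ, ∀ t : ℝ, 0 < t →
      ‖h t * (t : ℂ) ^ (w - 1)‖ ≤ D * t ^ (q - 1) := by
    rcases h1 with h1 | ⟨M, hM, h1⟩
    · exact ⟨w.re, h1, B, fun t ht => MemT.norm_mul_cpow_le hB w ht⟩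
    · refine ⟨w.re - (|w.re| + 1), by linarith [le_abs_self w.re], B * M ^ (|w.re| + 1),
        fun t ht => ?_⟩
      rcases lt_or_ge M t with h2 | h2
      · rw [h1 t h2, zero_mul, norm_zero]
        positivity
      · refine (MemT.norm_mul_cpow_le hB w ht).trans ?_
        have e : B * M ^ (|w.re| + 1) * t ^ (w.re - (|w.re| + 1) - 1) =
            B * t ^ (w.re - 1) * (M / t) ^ (|w.re| + 1) := by
          rw [Real.div_rpow hM.le ht.le, sub_right_comm, Real.rpow_sub ht _ (|w.re| + 1)]
          ring
        rw [e]
        exact le_mul_of_one_le_right (by positivity)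
          (Real.one_le_rpow ((one_le_div ht).mpr h2) hN.le)
  exact integrableOn_Ioi_of_two_power_bounds hcont hp hq hC hD

section

variable {I : Type*} [Fintype I]

/-- The functions in `𝒯(ℝ_+)` that vanish near infinity unless `ϱ` is `+` and near zero unless `ϱ`
is `-`. They contain the member `h_ϱ` of the partition of unity. -/
def UnityPartition.amplitudes (P : UnityPartition I) (ϱ : I) : Set (ℝ → ℂ) :=
  {h | MemT h ∧ (ϱ = P.minus ∨ ∃ δ : ℝ, 0 < δ ∧ ∀ t, 0 < t → t < δ → h t = 0) ∧
    (ϱ = P.plus ∨ ∃ M : ℝ, 0 < M ∧ ∀ t, M < t → h t = 0)}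

theorem UnityPartition.eulerStable_amplitudes (P : UnityPartition I) (ϱ : I) :
    EulerStable (P.amplitudes ϱ) := by
  have key : ∀ {h : ℝ → ℂ} {U : Set ℝ}, IsOpen U → (∀ t ∈ U, h t = 0) → ∀ t ∈ U,
      (t : ℂ) * deriv h t = 0 := by
    intro h U hU h0 t ht
    have : h =ᶠ[𝓝 t] fun _ => 0 := by
      filter_upwards [hU.mem_nhds ht] with y hy
      exact h0 y hy
    rw [this.deriv_eq]
    simp
  rintro h ⟨hT, h0, h1⟩
  refine ⟨hT, hT.mul_deriv, h0.imp_right ?_, h1.imp_right ?_⟩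
  · rintro ⟨δ, hδ, h2⟩
    exact ⟨δ, hδ, fun t ht ht' =>
      key (U := Set.Ioo 0 δ) isOpen_Ioo (fun y hy => h2 y hy.1 hy.2) t ⟨ht, ht'⟩⟩
  · rintro ⟨M, hM, h2⟩
    exact ⟨M, hM, fun t ht => key (U := Set.Ioi M) isOpen_Ioi h2 t ht⟩

theorem UnityPartition.fn_eq_zero (P : UnityPartition I) {ϱ ϱ' : I} (hne : ϱ' ≠ ϱ) {t : ℝ}
    (ht : 0 < t) (h1 : P.fn ϱ t = 1) : P.fn ϱ' t = 0 := by
  classical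
  have h2 := P.sum_eq_one t ht
  rw [← Finset.add_sum_erase _ _ (Finset.mem_univ ϱ), h1, add_eq_left] at h2
  exact (Finset.sum_eq_zero_iff_of_nonneg fun i _ => P.nonneg i t ht).mp h2 ϱ'
    (Finset.mem_erase.mpr ⟨hne, Finset.mem_univ _⟩)

theorem UnityPartition.fn_mem_amplitudes (P : UnityPartition I) (ϱ : I) :
    (fun t => (P.fn ϱ t : ℂ)) ∈ P.amplitudes ϱ := by
  refine ⟨P.memT ϱ, ?_, ?_⟩
  · refine or_iff_not_imp_left.mpr fun h => ?_
    obtain ⟨δ, hδ, h1⟩ := P.minus_eq_one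
    exact ⟨δ, hδ, fun t ht ht' => by simp [P.fn_eq_zero h ht (h1 t ht ht')]⟩
  · refine or_iff_not_imp_left.mpr fun h => ?_
    obtain ⟨M, hM, h1⟩ := P.plus_eq_one
    exact ⟨M, hM, fun t ht => by simp [P.fn_eq_zero h (hM.trans ht) (h1 t ht)]⟩

/-- The indices `k` with `k_l ≥ A` if `ϱ_l = -` and `k_l ≤ -A` if `ϱ_l = +`. -/
def UnityPartition.goodIndices (P : UnityPartition I) {d : ℕ} (ϱ : Fin d → I) (A : ℕ) :
    Set (Fin d → ℤ) :=
  {k | ∀ l, (ϱ l = P.minus → (A : ℤ) ≤ k l) ∧ (ϱ l = P.plus → k l ≤ -(A : ℤ))}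

variable {d : ℕ}

theorem UnityPartition.integrableOn_factor (P : UnityPartition I) {ϱ : Fin d → I} {A : ℕ}
    {ν : Fin d → ℂ} (hν : ∀ l, |(ν l).re| < A) {s : JSymbol d}
    (hs : s ∈ symbolSet (fun l => P.amplitudes (ϱ l)) (P.goodIndices ϱ A)) (l : Fin d) :
    IntegrableOn (fun t : ℝ => s.2 l t * (t : ℂ) ^ (ν l + s.1 l - 1)) (Set.Ioi 0) := by
  obtain ⟨hT, h0, h1⟩ := hs.2 l
  obtain ⟨k0, k1⟩ := hs.1 l
  have hre : (ν l + s.1 l).re = (ν l).re + s.1 l := by simp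
  have hν' := abs_lt.mp (hν l)
  refine hT.integrableOn_mul_cpow (h0.imp_left fun h => ?_) (h1.imp_left fun h => ?_)
  · have : (A : ℝ) ≤ s.1 l := by exact_mod_cast k0 h
    rw [hre]
    linarith
  · have : (s.1 l : ℝ) ≤ -(A : ℝ) := by exact_mod_cast k1 h
    rw [hre]
    linarith

/-- The symbol of the `J`-integral `J_ν(x; ς; h_ϱ)`. -/
def UnityPartition.symbol (P : UnityPartition I) (ϱ : Fin d → I) : JSymbol d :=
  (0, fun l t => (P.fn (ϱ l) t : ℂ))

theorem UnityPartition.sum_dampedIntegral_symbol (P : UnityPartition I) {ε : ℝ} (hε0 : 0 < ε)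
    (hε : ε ≤ Real.pi / 2) (ν : Fin d → ℂ) (sig : Fin (d + 1) → ℤˣ) {x : ℝ} (hx : 0 < x) :
    ∑ ϱ : Fin d → I, dampedIntegral ε ν sig x (P.symbol ϱ) =
      dampedIntegral ε ν sig x (0, fun _ _ => 1) := by
  unfold dampedIntegral
  rw [← integral_finsetSum _ fun ϱ _ => integrableOn_dampedIntegrand hε0 hε ν sig hx fun l =>
    P.memT (ϱ l)]
  refine setIntegral_congr_fun (measurableSet_orthant d) fun t ht => ?_
  have h1 : ∑ ϱ : Fin d → I, ∏ l, ((P.fn (ϱ l) (t l) : ℝ) : ℂ) = 1 := by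
    rw [← Fintype.piFinset_univ,
      ← Finset.prod_univ_sum (fun _ => Finset.univ) fun l i => ((P.fn i (t l) : ℝ) : ℂ)]
    refine Finset.prod_eq_one fun l _ => ?_
    rw [← Complex.ofReal_sum, P.sum_eq_one _ (ht l), Complex.ofReal_one]
  simp only [dampedIntegrand, symbol, ← Finset.sum_mul, h1, Finset.prod_const_one]

variable [DecidableEq I]

/-- The combination in the rigorous interpretation arises from the damped integral with amplitude
`h_ϱ`, and only indices occur that ensure absolute convergence if `|Re ν_l| < A`. -/
theorem UnityPartition.deforms_rigorousForm (P : UnityPartition I) (ν : Fin d → ℂ)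
    (sig : Fin (d + 1) → ℤˣ) {x : ℝ} (hx : 0 < x) (A : ℕ) (ϱ : Fin d → I) {lp : Fin d}
    (hlp : (P.Lplus ϱ).Nonempty → lp ∈ P.Lplus ϱ) :
    Deforms ν sig x (symbolSet (fun l => P.amplitudes (ϱ l)) (P.goodIndices ϱ A))
      (P.rigorousForm ν sig A ϱ lp) fun ε => dampedIntegral ε ν sig x (P.symbol ϱ) := by
  set 𝒜 : Fin d → Set (ℝ → ℂ) := fun l => P.amplitudes (ϱ l) with h𝒜def
  have h𝒜 : ∀ l, EulerStable (𝒜 l) := fun l => P.eulerStable_amplitudes (ϱ l)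
  have hpiece : ∀ l, (P.symbol ϱ).2 l ∈ 𝒜 l := fun l => P.fn_mem_amplitudes (ϱ l)
  have hminus : ∀ l, l ∈ P.Lminus ϱ ↔ ϱ l = P.minus := fun l => by
    simp [UnityPartition.Lminus]
  have hplus : ∀ l, l ∈ P.Lplus ϱ ↔ ϱ l = P.plus := fun l => by
    simp [UnityPartition.Lplus]
  have hdisj : ∀ l, l ∈ P.Lplus ϱ → l ∉ P.Lminus ϱ := fun l h1 h2 =>
    P.plus_ne_minus (((hplus l).mp h1).symm.trans ((hminus l).mp h2))
  have hup : ∀ n : ℕ, Deforms ν sig x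
      (symbolSet 𝒜 (upwardRay (0 + n • ∑ l ∈ P.Lminus ϱ, Pi.single l 1)))
      ((partialPlusProd ν sig (P.Lminus ϱ) ^ n) (P.piece ϱ))
      fun ε => dampedIntegral ε ν sig x (P.symbol ϱ) := fun n =>
    admissible_pow (𝒮 := fun f => symbolSet 𝒜 (upwardRay f))
      (admissible_partialPlusProd hx h𝒜 _) n 0 (P.symbol ϱ) ⟨⟨0, by simp [symbol]⟩, hpiece⟩
  have hray : ∀ (n : ℕ) {k : Fin d → ℤ},
      k ∈ upwardRay (0 + n • ∑ l ∈ P.Lminus ϱ, Pi.single l (1 : ℤ)) →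
      ∃ m : ℕ, ∀ l, k l = (if l ∈ P.Lminus ϱ then (n : ℤ) else 0) + m := by
    rintro n k ⟨m, hm⟩
    refine ⟨m, fun l => ?_⟩
    rw [hm, zero_add, Pi.smul_apply, sum_single_apply]
    split_ifs <;> simp
  unfold UnityPartition.rigorousForm
  split_ifs with h1 h2 h2
  · -- The first kind raises `k_l` to `2 A + m` for `l ∈ L_-` and to `m` otherwise; the second kind
    -- then lowers all of them by `A + m`, and `k_l` for the chosen `l ∈ L_+` possibly further.
    have hl := hlp h2
    refine Admissible.apply (S := symbolSet 𝒜 (upwardRay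
      (0 + (2 * A) • ∑ l ∈ P.Lminus ϱ, Pi.single l 1))) ?_ (hup (2 * A))
    rintro ⟨k, h⟩ ⟨hk, hh⟩
    obtain ⟨m, hm⟩ := hray (2 * A) (k := k) hk
    have hmlp : k lp = m := by rw [hm, if_neg (hdisj lp hl), zero_add]
    rw [partialMinusBalanced, Finsupp.linearCombination_single, one_smul]
    simp only [hmlp, Int.toNat_natCast]
    refine (admissible_partialMinus_pow hx h𝒜 lp (A + m) hh).mono (symbolSet_mono ?_)
    rintro k' ⟨j, rfl⟩ l
    have e : (k - ((A + m : ℕ) : Fin d → ℤ) - j • Pi.single lp 1 : Fin d → ℤ) l =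
        k l - (A + m) - if l = lp then (j : ℤ) else 0 := by
      by_cases hll : l = lp
      · subst hll; simp
      · simp [hll]
    rw [e]
    refine ⟨fun h3 => ?_, fun h3 => ?_⟩
    · have h4 : l ≠ lp := fun h5 => hdisj lp hl (h5 ▸ (hminus l).mpr h3)
      rw [hm, if_pos ((hminus l).mpr h3), if_neg h4]
      push_cast
      linarith
    · rw [hm, if_neg (hdisj l ((hplus l).mpr h3))]
      split_ifs
      · linarith [Int.natCast_nonneg j]
      · linarith
  · -- only partial integrations of the first kind
    refine (hup A).mono (symbolSet_mono fun k hk => ?_)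
    obtain ⟨m, hm⟩ := hray A hk
    refine fun l => ⟨fun h3 => ?_, fun h3 => absurd ⟨l, (hplus l).mpr h3⟩ h2⟩
    rw [hm, if_pos ((hminus l).mpr h3)]
    linarith [Int.natCast_nonneg m]
  · -- only partial integrations of the second kind
    refine (admissible_partialMinus_pow hx h𝒜 lp A hpiece).mono (symbolSet_mono ?_)
    rintro k' ⟨j, rfl⟩ l
    refine ⟨fun h3 => absurd ⟨l, (hminus l).mpr h3⟩ h1, fun h3 => ?_⟩
    have e : ((0 : Fin d → ℤ) - (A : Fin d → ℤ) - j • Pi.single lp 1 : Fin d → ℤ) l =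
        -(A : ℤ) - if l = lp then (j : ℤ) else 0 := by
      by_cases hll : l = lp
      · subst hll; simp
      · simp [hll]
    rw [e]
    split_ifs
    · linarith [Int.natCast_nonneg j]
    · linarith
  · -- no partial integration is needed
    refine Deforms.of_mem ⟨fun l => ⟨fun h3 => ?_, fun h3 => ?_⟩, hpiece⟩
    · exact absurd ⟨l, (hminus l).mpr h3⟩ h1
    · exact absurd ⟨l, (hplus l).mpr h3⟩ h2

theorem UnityPartition.converges_rigorousForm (P : UnityPartition I) {ν : Fin d → ℂ}
    (sig : Fin (d + 1) → ℤˣ) {x : ℝ} (hx : 0 < x) {A : ℕ} (hν : ∀ l, |(ν l).re| < A)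
    (ϱ : Fin d → I) {lp : Fin d} (hlp : (P.Lplus ϱ).Nonempty → lp ∈ P.Lplus ϱ) :
    (P.rigorousForm ν sig A ϱ lp).Converges ν sig x := by
  intro s hs
  have hs' := (P.deforms_rigorousForm ν sig hx A ϱ hlp).support_subset hs
  rw [← dampedIntegrand_zero]
  exact integrableOn_dampedIntegrand_of_factors le_rfl (by positivity) ν sig hx
    (fun l => (hs'.2 l).1) (P.integrableOn_factor hν hs')

theorem UnityPartition.tendsto_dampedIntegral_symbol (P : UnityPartition I) {ν : Fin d → ℂ}
    (sig : Fin (d + 1) → ℤˣ) {x : ℝ} (hx : 0 < x) {A : ℕ} (hν : ∀ l, |(ν l).re| < A)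
    (ϱ : Fin d → I) {lp : Fin d} (hlp : (P.Lplus ϱ).Nonempty → lp ∈ P.Lplus ϱ) :
    Tendsto (fun ε => dampedIntegral ε ν sig x (P.symbol ϱ)) (𝓝[>] 0)
      (𝓝 ((P.rigorousForm ν sig A ϱ lp).value ν sig x)) :=
  (P.deforms_rigorousForm ν sig hx A ϱ hlp).tendsto_value fun _ hs =>
    tendsto_dampedIntegral ν sig hx (fun l => (hs.2 l).1) (P.integrableOn_factor hν hs)

/-! ### The Bessel function and the rigorous interpretation -/

theorem tendsto_dampedIntegral_one {lam : Fin (d + 1) → ℂ} {ν : Fin d → ℂ}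
    (hlam : ∑ l, lam l = 0) (hν : ∀ l : Fin d, ν l = lam l.castSucc - lam (Fin.last d))
    (sig : Fin (d + 1) → ℤˣ) {x : ℝ} (hx : 0 < x) {r : ℝ → ℝ} (hr : IsContour lam r) :
    Tendsto (fun ε => dampedIntegral ε ν sig x (0, fun _ _ => 1)) (𝓝[>] 0)
      (𝓝 (besselJ sig lam r x)) := by
  refine ((hr.tendsto_integral_dampedKernel (Nat.succ_pos d) hx sig).const_mul
    (2 * Real.pi * Complex.I)⁻¹).congr' ?_
  filter_upwards [Ioc_mem_nhdsGT (show (0 : ℝ) < Real.pi / 2 by positivity)] with ε hε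
  exact (dampedIntegral_one_eq_contour hε.1 hε.2 hlam hν sig hx hr).symm

/-- Both sides are the limit of the damped integral with constant amplitude. -/
theorem UnityPartition.besselJ_eq_rigorousJ (P : UnityPartition I) {lam : Fin (d + 1) → ℂ}
    {ν : Fin d → ℂ} (hlam : ∑ l, lam l = 0)
    (hν : ∀ l : Fin d, ν l = lam l.castSucc - lam (Fin.last d)) (sig : Fin (d + 1) → ℤˣ) {x : ℝ}
    (hx : 0 < x) {r : ℝ → ℝ} (hr : IsContour lam r) {A : ℕ} (hνA : ∀ l, |(ν l).re| < A)
    {lp : (Fin d → I) → Fin d} (hlp : ∀ ϱ, (P.Lplus ϱ).Nonempty → lp ϱ ∈ P.Lplus ϱ) :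
    besselJ sig lam r x = P.rigorousJ ν sig A lp x := by
  refine tendsto_nhds_unique (tendsto_dampedIntegral_one hlam hν sig hx hr) ?_
  refine (tendsto_finsetSum Finset.univ fun ϱ _ =>
    P.tendsto_dampedIntegral_symbol sig hx hνA ϱ (hlp ϱ)).congr' ?_
  filter_upwards [Ioc_mem_nhdsGT (show (0 : ℝ) < Real.pi / 2 by positivity)] with ε hε
  exact P.sum_dampedIntegral_symbol hε.1 hε.2 ν sig hx

end

variable {d : ℕ}

theorem sum_hyperplanePoint (ν : Fin d → ℂ) : ∑ l, hyperplanePoint ν l = 0 := by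
  have : (d : ℂ) + 1 ≠ 0 := by exact_mod_cast Nat.succ_ne_zero d
  unfold hyperplanePoint
  simp only [Fin.sum_univ_castSucc, Fin.snoc_castSucc, Fin.snoc_last, Finset.sum_sub_distrib,
    Finset.sum_const, Finset.card_univ, Fintype.card_fin, nsmul_eq_mul]
  field_simp
  ring

theorem hyperplanePoint_sub (ν : Fin d → ℂ) (l : Fin d) :
    ν l = hyperplanePoint ν l.castSucc - hyperplanePoint ν (Fin.last d) := by
  unfold hyperplanePoint
  simp only [Fin.snoc_castSucc, Fin.snoc_last]
  ring

theorem analyticAt_hyperplanePoint (ν₀ : Fin d → ℂ) :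
    AnalyticAt ℂ (hyperplanePoint : (Fin d → ℂ) → Fin (d + 1) → ℂ) ν₀ := by
  refine analyticAt_pi_iff.mpr fun l => ?_
  have h : ∀ k : Fin d, AnalyticAt ℂ (fun ν : Fin d → ℂ => ν k) ν₀ := fun k =>
    (ContinuousLinearMap.proj (R := ℂ) k).analyticAt ν₀
  have hs : AnalyticAt ℂ (fun ν : Fin d → ℂ => ∑ k, ν k) ν₀ :=
    Finset.analyticAt_fun_sum _ fun k _ => h k
  refine Fin.lastCases ?_ (fun j => ?_) l
  · simp only [hyperplanePoint, Fin.snoc_last]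
    exact hs.fun_neg.div_const
  · simp only [hyperplanePoint, Fin.snoc_castSucc]
    exact (h j).fun_sub hs.div_const

/-- The value of the Mellin-Barnes integral does not depend on the contour, which may therefore be
held fixed in a neighbourhood of a given point. -/
theorem analyticAt_besselJ_hyperplanePoint {r : (Fin (d + 1) → ℂ) → ℝ → ℝ}
    (hr : ∀ lam : Fin (d + 1) → ℂ, ∑ l, lam l = 0 → IsContour lam (r lam))
    (sig : Fin (d + 1) → ℤˣ) {x : ℝ} (hx : 0 < x) (ν₀ : Fin d → ℂ) :
    AnalyticAt ℂ (fun ν => besselJ sig (hyperplanePoint ν) (r (hyperplanePoint ν)) x) ν₀ := by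
  have hr₀ := hr _ (sum_hyperplanePoint ν₀)
  have h1 := (hr₀.analyticAt_besselJ (Nat.succ_pos d) sig hx).comp (analyticAt_hyperplanePoint ν₀)
  refine h1.congr ?_
  filter_upwards [(analyticAt_hyperplanePoint ν₀).continuousAt.eventually hr₀.eventually]
    with ν hν
  exact tendsto_nhds_unique
    (tendsto_dampedIntegral_one (sum_hyperplanePoint ν) (hyperplanePoint_sub ν) sig hx hν)
    (tendsto_dampedIntegral_one (sum_hyperplanePoint ν) (hyperplanePoint_sub ν) sig hx
      (hr _ (sum_hyperplanePoint ν)))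

end

end BesselIntegral

end

theorem mainTheorem10 {d : ℕ} (hd : 0 < d) (sig : Fin (d + 1) → ℤˣ) (x : ℝ) (hx : 0 < x)
    -- for every `λ` in the hyperplane, a choice of the contour in the definition of `J(x; ς, λ)`
    (r : (Fin (d + 1) → ℂ) → ℝ → ℝ)
    (hr : ∀ lam : Fin (d + 1) → ℂ, ∑ l, lam l = 0 → BesselIntegral.IsContour lam (r lam))
    -- the choices in the definition of the rigorous interpretation of `J_ν(x; ς)`
    {I : Type*} [Fintype I] [DecidableEq I] (P : BesselIntegral.UnityPartition I)
    (a : ℝ) (ha : 0 < a) (A : ℕ) (hA : a + 2 ≤ A)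
    (lp : (Fin d → I) → Fin d) (hlp : ∀ ϱ, (P.Lplus ϱ).Nonempty → lp ϱ ∈ P.Lplus ϱ) :
    (∀ (lam : Fin (d + 1) → ℂ) (ν : Fin d → ℂ), ∑ l, lam l = 0 →
      (∀ l : Fin d, ν l = lam l.castSucc - lam (Fin.last d)) →
      (∀ l : Fin d, |(ν l).re| < a) →
        MeasureTheory.Integrable (BesselIntegral.mellinBarnesIntegrand sig lam (r lam) x) ∧
        (∀ ϱ : Fin d → I, (P.rigorousForm ν sig A ϱ (lp ϱ)).Converges ν sig x) ∧
        BesselIntegral.besselJ sig lam (r lam) x = P.rigorousJ ν sig A lp x) ∧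
    AnalyticOnNhd ℂ (fun ν : Fin d → ℂ => P.rigorousJ ν sig A lp x)
      {ν | ∀ l : Fin d, |(ν l).re| < a} ∧
    AnalyticOnNhd ℂ (fun ν : Fin d → ℂ =>
        BesselIntegral.besselJ sig (BesselIntegral.hyperplanePoint ν)
          (r (BesselIntegral.hyperplanePoint ν)) x)
      Set.univ := by
  have hA' : ∀ ν : Fin d → ℂ, (∀ l : Fin d, |(ν l).re| < a) → ∀ l, |(ν l).re| < A :=
    fun ν hν l => (hν l).trans (by linarith)
  refine ⟨fun lam ν hlam hν hνa => ⟨?_, fun ϱ => ?_, ?_⟩, fun ν₀ hν₀ => ?_, fun ν₀ _ => ?_⟩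
  · have h := (hr lam hlam).integrable_dampedKernel (Nat.succ_pos d) hx sig le_rfl
      (Real.pi_div_two_pos.le)
    refine h.congr (Filter.Eventually.of_forall fun t => ?_)
    rw [BesselIntegral.mellinBarnesIntegrand_eq]
  · exact P.converges_rigorousForm sig hx (hA' ν hνa) ϱ (hlp ϱ)
  · exact P.besselJ_eq_rigorousJ hlam hν sig hx (hr lam hlam) (hA' ν hνa) hlp
  · refine (BesselIntegral.analyticAt_besselJ_hyperplanePoint hr sig hx ν₀).congr ?_
    have hopen : IsOpen {ν : Fin d → ℂ | ∀ l : Fin d, |(ν l).re| < a} := by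
      rw [Set.ofPred_forall]
      exact isOpen_iInter_of_finite fun l => isOpen_lt (by fun_prop) continuous_const
    filter_upwards [hopen.mem_nhds hν₀] with ν hν
    exact P.besselJ_eq_rigorousJ (BesselIntegral.sum_hyperplanePoint ν)
      (BesselIntegral.hyperplanePoint_sub ν) sig hx
      (hr _ (BesselIntegral.sum_hyperplanePoint ν)) (hA' ν hν) hlp
  · exact BesselIntegral.analyticAt_besselJ_hyperplanePoint hr sig hx ν₀
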